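/- Fix a universe; "small" means that the objects and all morphism sets lie in this universe. A \emph{marking} on a category is a wide subgroupoid of its groupoid of isomorphisms, whose elements are called marked isomorphisms. Let $\mathcal{C}$ be one of the following four categories: $\mathbf{Cat}$ (small categories and functors), $\mathbf{Cat}^+$ (small categories with a marking, and functors which preserve marked isomorphisms), $\mathbf{preAdd}$ (small categories enriched in abelian groups, and additive functors), $\mathbf{preAdd}^+$ (small categories enriched in abelian groups with a marking on the underlying category, and additive functors which preserve marked isomorphisms). For $\mathbf{Cat}$ and $\mathbf{preAdd}$ every isomorphism is regarded as marked. For objects $A,B$ of $\mathcal{C}$ let $\mathrm{Map}(A,B)$ be the nerve of the groupoid whose objects are the morphisms $A\to B$ of $\mathcal{C}$ and whose morphisms are the natural isomorphisms all of whose components are marked; composition of functors and horizontal composition of natural transformations make $\mathcal{C}$ a simplicially enriched category. Call a morphism $f\colon A\to B$ of $\mathcal{C}$ - a \emph{weak equivalence} if there are a morphism $g\colon B\to A$ of $\mathcal{C}$ and natural isomorphisms $g\circ f\cong \mathrm{id}_A$ and $f\circ g\cong\mathrm{id}_B$ with marked components; - a \emph{cofibration} if it is injective on objects; - a \emph{fibration}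 if it has the right lifting property with respect to all cofibrations which are weak equivalences; - a \emph{marked isofibration} if for every object $c$ of $A$ and every marked isomorphism $u\colon f(c)\to d$ in $B$ there is a marked isomorphism $v\colon c\to c'$ in $A$ with $f(v)=u$. Then in each of the four cases: 1. With these weak equivalences, cofibrations and fibrations, $\mathcal{C}$ is a model category (with all small limits and colimits and with functorial factorizations). 2. With the above enrichment it is a simplicial model category: there are functorial tensors $A\otimes K$ and cotensors $B^K$ with simplicial sets $K$ and isomorphisms of simplicial sets $\mathrm{Map}(A\otimes K,B)\cong\mathrm{Map}(K,\mathrm{Map}(A,B))\cong\mathrm{Map}(A,B^K)$, natural in $A$, $B$ and $K$; and for every cofibration $i\colon A\to B$ and fibration $p\colon X\to Y$ the map $\mathrm{Map}(B,X)\to\mathrm{Map}(A,X)\times_{\mathrm{Map}(A,Y)}\mathrm{Map}(B,Y)$ is a Kan fibration, which is a weak homotopy equivalence if $i$ or $p$ is a weak equivalence. 3. The model category is combinatorial, i.e. cofibrantly generated, and locally presentable as a category. 4. The fibrations are exactly the marked isofibrations. 5. Every object is fibrant and cofibrant. -/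

import Mathlib

open CategoryTheory Category Limits Opposite Simplicial MonoidalCategory HomotopicalAlgebra

universe u

namespace MarkedModel

/-! ### Marked categories, pre-additive categories, marked pre-additive categories -/

/-- A marking on a category: a wide subgroupoid of its groupoid of isomorphisms,
given as the class of marked morphisms. -/
structure Marking (C : Type u) [Category.{u} C] where
  /-- the marked morphisms -/
  marked : MorphismProperty C
  isIso_of_marked : ∀ {X Y : C} (f : X ⟶ Y), marked f → IsIso f
  id_mem : ∀ X : C, marked (𝟙 X)
  comp_mem : ∀ {X Y Z : C} (f : X ⟶ Y) (g : Y ⟶ Z), marked f → marked g → marked (f ≫ g)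
  inv_mem : ∀ {X Y : C} (e : X ≅ Y), marked e.hom → marked e.inv

/-- The maximal marking: every isomorphism is marked. -/
def Marking.max (C : Type u) [Category.{u} C] : Marking C where
  marked := MorphismProperty.isomorphisms C
  isIso_of_marked _ hf := hf
  id_mem X := MorphismProperty.isomorphisms.infer_property (𝟙 X)
  comp_mem f g hf hg := (MorphismProperty.isomorphisms C).comp_mem f g hf hg
  inv_mem e _ := MorphismProperty.isomorphisms.infer_property e.inv

/-- The type of small marked categories. -/
structure MarkedCat : Type (u + 1) where
  /-- the objects -/
  carrier : Type u
  [category : Category.{u} carrier]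
  /-- the marking -/
  marking : Marking carrier

attribute [instance] MarkedCat.category

namespace MarkedCat

/-- A morphism of marked categories: a functor which preserves marked morphisms. -/
@[ext]
structure Hom (A B : MarkedCat.{u}) where
  /-- the underlying functor -/
  toFunctor : A.carrier ⥤ B.carrier
  map_marked : ∀ {X Y : A.carrier} (f : X ⟶ Y),
    A.marking.marked f → B.marking.marked (toFunctor.map f)

/-- The category `Cat⁺` of small marked categories. -/
instance : Category.{u} MarkedCat.{u} where
  Hom A B := Hom A B
  id A := ⟨𝟭 A.carrier, fun _ hf => hf⟩
  comp F G := ⟨F.toFunctor ⋙ G.toFunctor, fun f hf => G.map_marked _ (F.map_marked f hf)⟩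

end MarkedCat

/-- The type of small pre-additive categories. -/
structure PreAddCat : Type (u + 1) where
  /-- the objects -/
  carrier : Type u
  [category : Category.{u} carrier]
  [preadditive : Preadditive carrier]

attribute [instance] PreAddCat.category PreAddCat.preadditive

namespace PreAddCat

/-- A morphism of pre-additive categories: an additive functor. -/
@[ext]
structure Hom (A B : PreAddCat.{u}) where
  /-- the underlying functor -/
  toFunctor : A.carrier ⥤ B.carrier
  additive : toFunctor.Additive

/-- The category `preAdd` of small pre-additive categories. -/
instance : Category.{u} PreAddCat.{u} where
  Hom A B := Hom A B
  id A := ⟨𝟭 A.carrier, inferInstance⟩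
  comp F G := ⟨F.toFunctor ⋙ G.toFunctor,
    letI := F.additive
    letI := G.additive
    inferInstance⟩

end PreAddCat

/-- The type of small marked pre-additive categories. -/
structure MarkedPreAddCat : Type (u + 1) where
  /-- the objects -/
  carrier : Type u
  [category : Category.{u} carrier]
  [preadditive : Preadditive carrier]
  /-- the marking of the underlying category -/
  marking : Marking carrier

attribute [instance] MarkedPreAddCat.category MarkedPreAddCat.preadditive

namespace MarkedPreAddCat

/-- A morphism of marked pre-additive categories: an additive functor which preserves
marked morphisms. -/
@[ext]
structure Hom (A B : MarkedPreAddCat.{u}) where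
  /-- the underlying functor -/
  toFunctor : A.carrier ⥤ B.carrier
  additive : toFunctor.Additive
  map_marked : ∀ {X Y : A.carrier} (f : X ⟶ Y),
    A.marking.marked f → B.marking.marked (toFunctor.map f)

/-- The category `preAdd⁺` of small marked pre-additive categories. -/
instance : Category.{u} MarkedPreAddCat.{u} where
  Hom A B := Hom A B
  id A := ⟨𝟭 A.carrier, inferInstance, fun _ hf => hf⟩
  comp F G := ⟨F.toFunctor ⋙ G.toFunctor,
    letI := F.additive
    letI := G.additive
    inferInstance, fun f hf => G.map_marked _ (F.map_marked f hf)⟩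

end MarkedPreAddCat

/-! ### The underlying marked category

The four categories are treated uniformly through the functor to `Cat⁺` which forgets
enrichments and, in the unmarked cases, marks all isomorphisms. -/

/-- A category whose objects have underlying marked categories. -/
class HasMarked (C : Type (u + 1)) [Category.{u} C] where
  /-- the underlying marked category -/
  und : C ⥤ MarkedCat.{u}

/-- In `Cat`, all isomorphisms are marked. -/
instance : HasMarked Cat.{u, u} where
  und :=
    { obj := fun A => { carrier := A, marking := Marking.max A }
      map := fun F => ⟨F.toFunctor, fun f hf =>
        letI : IsIso f := hf
        (inferInstance : IsIso (F.toFunctor.map f))⟩ }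

instance : HasMarked MarkedCat.{u} where
  und := 𝟭 _

/-- In `preAdd`, all isomorphisms are marked. -/
instance : HasMarked PreAddCat.{u} where
  und :=
    { obj := fun A => { carrier := A.carrier, marking := Marking.max A.carrier }
      map := fun F => ⟨F.toFunctor, fun f hf =>
        letI : IsIso f := hf
        (inferInstance : IsIso (F.toFunctor.map f))⟩ }

instance : HasMarked MarkedPreAddCat.{u} where
  und :=
    { obj := fun A => { carrier := A.carrier, marking := A.marking }
      map := fun F => ⟨F.toFunctor, F.map_marked⟩ }

section

variable {C : Type (u + 1)} [Category.{u} C] [HasMarked C]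

/-- The underlying category of an object. -/
abbrev Und (A : C) : Type u := (HasMarked.und.obj A).carrier

/-- The marked morphisms of the underlying category. -/
abbrev IsMarked (A : C) : MorphismProperty (Und A) := (HasMarked.und.obj A).marking.marked

/-- The functor underlying a morphism. -/
abbrev fn {A B : C} (f : A ⟶ B) : Und A ⥤ Und B := (HasMarked.und.map f).toFunctor

lemma fn_id (A : C) : fn (𝟙 A) = 𝟭 (Und A) :=
  congrArg MarkedCat.Hom.toFunctor (HasMarked.und.map_id A)

lemma fn_comp {A B D : C} (f : A ⟶ B) (g : B ⟶ D) : fn (f ≫ g) = fn f ⋙ fn g :=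
  congrArg MarkedCat.Hom.toFunctor (HasMarked.und.map_comp f g)

/-! ### The simplicial enrichment -/

/-- The objects of the mapping groupoid from `A` to `B`: the morphisms `A ⟶ B`. -/
@[ext]
structure MapGpd (A B : C) : Type u where
  /-- the morphism -/
  hom : A ⟶ B

namespace MapGpd

/-- The morphisms of the mapping groupoid: natural transformations all of whose components
are marked (in particular, natural isomorphisms). -/
@[ext]
structure Hom {A B : C} (f g : MapGpd A B) : Type u where
  /-- the natural transformation -/
  trans : fn f.hom ⟶ fn g.hom
  marked : ∀ a : Und A, IsMarked B (trans.app a)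

instance (A B : C) : Category.{u} (MapGpd A B) where
  Hom f g := Hom f g
  id f := ⟨𝟙 _, fun _ => Marking.id_mem _ _⟩
  comp α β := ⟨α.trans ≫ β.trans, fun a => Marking.comp_mem _ _ _ (α.marked a) (β.marked a)⟩

@[ext]
lemma hom_ext {A B : C} {f g : MapGpd A B} {α β : f ⟶ g} (h : α.trans = β.trans) : α = β :=
  Hom.ext h

@[simp] lemma id_trans {A B : C} (f : MapGpd A B) : Hom.trans (𝟙 f) = 𝟙 _ := rfl

@[simp] lemma comp_trans {A B : C} {f g h : MapGpd A B} (α : f ⟶ g) (β : g ⟶ h) :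
    (α ≫ β).trans = α.trans ≫ β.trans := rfl

@[simp] lemma eqToHom_trans {A B : C} {f g : MapGpd A B} (h : f = g) :
    (eqToHom h).trans = eqToHom (by rw [h]) := by
  subst h
  rfl

lemma isIso_trans {A B : C} {f g : MapGpd A B} (α : f ⟶ g) : IsIso α.trans :=
  letI : ∀ a, IsIso (α.trans.app a) := fun a => Marking.isIso_of_marked _ _ (α.marked a)
  NatIso.isIso_of_isIso_app _

/-- The mapping category is a groupoid. -/
noncomputable instance (A B : C) : Groupoid (MapGpd A B) where
  inv {f g} α :=
    letI := isIso_trans α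
    ⟨inv α.trans, fun a => by
      rw [NatIso.isIso_inv_app]
      exact Marking.inv_mem _ (asIso (α.trans.app a)) (α.marked a)⟩
  inv_comp α := by
    have := isIso_trans α
    ext1
    exact IsIso.inv_hom_id _
  comp_inv α := by
    have := isIso_trans α
    ext1
    exact IsIso.hom_inv_id _

end MapGpd

/-- Horizontal composition of natural transformations, where the composite functors are
given up to equality. -/
def hcomp {A B D : Type u} [Category.{u} A] [Category.{u} B] [Category.{u} D]
    {F F' : A ⥤ B} {G G' : B ⥤ D} {K K' : A ⥤ D} (e : K = F ⋙ G) (e' : K' = F' ⋙ G')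
    (α : F ⟶ F') (β : G ⟶ G') : K ⟶ K' :=
  eqToHom e ≫ (α ◫ β) ≫ eqToHom e'.symm

section

variable {A B D E : Type u} [Category.{u} A] [Category.{u} B] [Category.{u} D] [Category.{u} E]

lemma hcomp_id {F : A ⥤ B} {G : B ⥤ D} {K : A ⥤ D} (e e' : K = F ⋙ G) :
    hcomp e e' (𝟙 F) (𝟙 G) = 𝟙 K := by
  subst e
  ext a
  simp [hcomp]

lemma hcomp_comp {F F' F'' : A ⥤ B} {G G' G'' : B ⥤ D} {K K' K'' : A ⥤ D}
    (e : K = F ⋙ G) (e' : K' = F' ⋙ G') (e'' : K'' = F'' ⋙ G'')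
    (α : F ⟶ F') (α' : F' ⟶ F'') (β : G ⟶ G') (β' : G' ⟶ G'') :
    hcomp e e'' (α ≫ α') (β ≫ β') = hcomp e e' α β ≫ hcomp e' e'' α' β' := by
  subst e e' e''
  ext a
  simp [hcomp]

lemma hcomp_assoc {F F' : A ⥤ B} {G G' : B ⥤ D} {H H' : D ⥤ E}
    {FG FG' : A ⥤ D} {GH GH' : B ⥤ E} {K K' L L' : A ⥤ E}
    (e₁ : FG = F ⋙ G) (e₁' : FG' = F' ⋙ G') (e₂ : GH = G ⋙ H) (e₂' : GH' = G' ⋙ H')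
    (e₃ : K = FG ⋙ H) (e₃' : K' = FG' ⋙ H') (e₄ : L = F ⋙ GH) (e₄' : L' = F' ⋙ GH')
    (h : K = L) (h' : L' = K') (α : F ⟶ F') (β : G ⟶ G') (γ : H ⟶ H') :
    hcomp e₃ e₃' (hcomp e₁ e₁' α β) γ =
      eqToHom h ≫ hcomp e₄ e₄' α (hcomp e₂ e₂' β γ) ≫ eqToHom h' := by
  subst e₁ e₁' e₂ e₂' e₃ e₃' e₄ e₄'
  ext a
  simp [hcomp]

lemma hcomp_id_left {I : A ⥤ A} {F F' : A ⥤ B} {K K' : A ⥤ B}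
    (e₁ : I = 𝟭 A) (e : K = I ⋙ F) (e' : K' = I ⋙ F') (h : K = F) (h' : F' = K')
    (α : F ⟶ F') :
    hcomp e e' (𝟙 I) α = eqToHom h ≫ α ≫ eqToHom h' := by
  subst e₁ e e'
  ext a
  simp [hcomp]

lemma hcomp_id_right {I : B ⥤ B} {F F' : A ⥤ B} {K K' : A ⥤ B}
    (e₁ : I = 𝟭 B) (e : K = F ⋙ I) (e' : K' = F' ⋙ I) (h : K = F) (h' : F' = K')
    (α : F ⟶ F') :
    hcomp e e' α (𝟙 I) = eqToHom h ≫ α ≫ eqToHom h' := by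
  subst e₁ e e'
  ext a
  simp [hcomp]

lemma hcomp_marked {F F' : A ⥤ B} {G G' : B ⥤ D} {K K' : A ⥤ D}
    (e : K = F ⋙ G) (e' : K' = F' ⋙ G') (α : F ⟶ F') (β : G ⟶ G') (M : Marking D)
    (hα : ∀ a, M.marked (G'.map (α.app a))) (hβ : ∀ b, M.marked (β.app b)) (a : A) :
    M.marked ((hcomp e e' α β).app a) := by
  subst e e'
  simpa [hcomp] using M.comp_mem _ _ (hβ (F.obj a)) (hα a)

end

/-- Composition of morphisms, as a functor on mapping groupoids: composition of morphisms of `C`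
and horizontal composition of natural transformations. -/
def compFunctor (A B D : C) : MapGpd A B × MapGpd B D ⥤ MapGpd A D where
  obj x := ⟨x.1.hom ≫ x.2.hom⟩
  map {_ y} α := ⟨hcomp (fn_comp _ _) (fn_comp _ _) α.1.trans α.2.trans,
    hcomp_marked _ _ _ _ _
      (fun a => (HasMarked.und.map y.2.hom).map_marked _ (α.1.marked a)) α.2.marked⟩
  map_id _ := MapGpd.hom_ext (hcomp_id (fn_comp _ _) (fn_comp _ _))
  map_comp _ _ := MapGpd.hom_ext
    (hcomp_comp (fn_comp _ _) (fn_comp _ _) (fn_comp _ _) _ _ _ _)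

section

variable {J : Type} [Category.{0} J]

lemma id_compFunctor {A B : C} (x : J ⥤ MapGpd A B) :
    Functor.prod' ((Functor.const J).obj ⟨𝟙 A⟩) x ⋙ compFunctor A A B = x := by
  refine CategoryTheory.Functor.ext (fun j => MapGpd.ext (Category.id_comp _))
    (fun j k φ => MapGpd.hom_ext ?_)
  rw [MapGpd.comp_trans, MapGpd.comp_trans, MapGpd.eqToHom_trans, MapGpd.eqToHom_trans]
  exact hcomp_id_left (fn_id A) (fn_comp _ _) (fn_comp _ _) _ _ _

lemma compFunctor_id {A B : C} (x : J ⥤ MapGpd A B) :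
    Functor.prod' x ((Functor.const J).obj ⟨𝟙 B⟩) ⋙ compFunctor A B B = x := by
  refine CategoryTheory.Functor.ext (fun j => MapGpd.ext (Category.comp_id _))
    (fun j k φ => MapGpd.hom_ext ?_)
  rw [MapGpd.comp_trans, MapGpd.comp_trans, MapGpd.eqToHom_trans, MapGpd.eqToHom_trans]
  exact hcomp_id_right (fn_id B) (fn_comp _ _) (fn_comp _ _) _ _ _

lemma compFunctor_assoc {A B D E : C} (x : J ⥤ MapGpd A B) (y : J ⥤ MapGpd B D)
    (z : J ⥤ MapGpd D E) :
    Functor.prod' (Functor.prod' x y ⋙ compFunctor A B D) z ⋙ compFunctor A D E =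
      Functor.prod' x (Functor.prod' y z ⋙ compFunctor B D E) ⋙ compFunctor A B E := by
  refine CategoryTheory.Functor.ext (fun j => MapGpd.ext (Category.assoc _ _ _))
    (fun j k φ => MapGpd.hom_ext ?_)
  rw [MapGpd.comp_trans, MapGpd.comp_trans, MapGpd.eqToHom_trans, MapGpd.eqToHom_trans]
  exact hcomp_assoc (fn_comp _ _) (fn_comp _ _) (fn_comp _ _) (fn_comp _ _)
    (fn_comp _ _) (fn_comp _ _) (fn_comp _ _) (fn_comp _ _) _ _ _ _ _

lemma compFunctor_const {A B D : C} (f : A ⟶ B) (g : B ⟶ D) :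
    Functor.prod' ((Functor.const J).obj ⟨f⟩) ((Functor.const J).obj ⟨g⟩) ⋙ compFunctor A B D =
      (Functor.const J).obj ⟨f ≫ g⟩ := by
  refine CategoryTheory.Functor.ext (fun j => MapGpd.ext rfl) (fun j k φ => MapGpd.hom_ext ?_)
  rw [MapGpd.comp_trans, MapGpd.comp_trans, MapGpd.eqToHom_trans, MapGpd.eqToHom_trans]
  exact (hcomp_id (fn_comp f g) (fn_comp f g)).trans (by simp; rfl)

end

/-- The simplicial mapping space from `A` to `B`: the nerve of the groupoid of morphisms
`A ⟶ B` and marked natural isomorphisms. -/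
abbrev mapSpace (A B : C) : SSet.{u} := nerve (MapGpd A B)

/-- Composition of mapping spaces, induced by `compFunctor`. -/
def mapSpaceComp (A B D : C) : mapSpace A B ⊗ mapSpace B D ⟶ mapSpace A D where
  app _ := ↾fun x => Functor.prod' x.1 x.2 ⋙ compFunctor A B D

/-- The point of `mapSpace A B` given by a morphism. -/
def mapSpacePoint {A B : C} (f : A ⟶ B) : 𝟙_ SSet.{u} ⟶ mapSpace A B where
  app _ := ↾fun _ => (Functor.const _).obj ⟨f⟩

/-- The simplicial enrichment. -/
instance : SimplicialCategory C where
  Hom A B := mapSpace A B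
  id A := mapSpacePoint (𝟙 A)
  comp A B D := mapSpaceComp A B D
  id_comp A B := by
    ext Δ x
    exact id_compFunctor x
  comp_id A B := by
    ext Δ x
    exact compFunctor_id x
  assoc A B D E := by
    ext Δ x
    exact compFunctor_assoc x.1 x.2.1 x.2.2
  homEquiv {A B} :=
    { toFun := mapSpacePoint
      invFun := fun φ => ((φ.app (op ⦋0⦌) PUnit.unit).obj 0).hom
      left_inv := fun f => rfl
      right_inv := fun φ => by
        apply (SSet.unitHomEquiv _).injective
        exact ComposableArrows.ext₀ rfl }
  homEquiv_id A := rfl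
  homEquiv_comp f g := by
    ext Δ x
    exact (compFunctor_const f g).symm

/-! ### Weak equivalences, cofibrations and fibrations -/

/-- A morphism is a weak equivalence if it admits an inverse up to marked natural isomorphisms. -/
instance : CategoryWithWeakEquivalences C where
  weakEquivalences A B f := ∃ g : B ⟶ A,
    Nonempty ((⟨f ≫ g⟩ : MapGpd A A) ⟶ ⟨𝟙 A⟩) ∧ Nonempty ((⟨g ≫ f⟩ : MapGpd B B) ⟶ ⟨𝟙 B⟩)

/-- A morphism is a cofibration if it is injective on objects. -/
instance : CategoryWithCofibrations C where
  cofibrations _ _ f := Function.Injective (fn f).obj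

/-- A morphism is a fibration if it has the right lifting property with respect to trivial
cofibrations. -/
instance : CategoryWithFibrations C where
  fibrations := (trivialCofibrations C).rlp

/-- Marked isofibrations: marked isomorphisms `a(c) ⟶ d` lift to marked isomorphisms
with source `c`. -/
def markedIsofibrations (C : Type (u + 1)) [Category.{u} C] [HasMarked C] :
    MorphismProperty C :=
  fun A B f => ∀ (c : Und A) (d : Und B) (w : (fn f).obj c ⟶ d), IsMarked B w →
    ∃ (c' : Und A) (v : c ⟶ c') (h : (fn f).obj c' = d),
      IsMarked A v ∧ (fn f).map v ≫ eqToHom h = w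

end

/-! ### Simplicial and combinatorial model categories -/

/-- Weak homotopy equivalences of simplicial sets: morphisms `f : X ⟶ Y` such that for every Kan
complex `Z`, precomposition with `f` induces a bijection from homotopy classes of morphisms
`Y ⟶ Z` to homotopy classes of morphisms `X ⟶ Z`. -/
def IsWeakHomotopyEquivalence {X Y : SSet.{u}} (f : X ⟶ Y) : Prop :=
  ∀ (Z : SSet.{u}) [SSet.KanComplex Z],
    Function.Bijective (SSet.mapπ₀ ((MonoidalClosed.pre f).app Z))

section

variable (C : Type (u + 1)) [Category.{u} C] [SimplicialCategory C]

open SimplicialCategory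

/-- The structure of a tensored and cotensored simplicial category: isomorphisms
`Map(A ⊗ K, B) ≅ Map(K, Map(A, B)) ≅ Map(A, B ^ K)` of simplicial sets which are natural
in `A`, `B` and `K`. -/
structure TensorCotensor where
  /-- the tensor `A ⊗ K` -/
  tensor : C ⥤ SSet.{u} ⥤ C
  /-- the cotensor `B ^ K` -/
  cotensor : SSet.{u}ᵒᵖ ⥤ C ⥤ C
  /-- the isomorphism for tensors -/
  tensorIso (A : C) (K : SSet.{u}) (B : C) :
    sHom ((tensor.obj A).obj K) B ≅ (ihom K).obj (sHom A B)
  tensorIso_left {A A' : C} (f : A ⟶ A') (K : SSet.{u}) (B : C) :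
    eHomWhiskerRight SSet ((tensor.map f).app K) B ≫ (tensorIso A K B).hom =
      (tensorIso A' K B).hom ≫ (ihom K).map (eHomWhiskerRight SSet f B)
  tensorIso_middle (A : C) {K K' : SSet.{u}} (φ : K ⟶ K') (B : C) :
    eHomWhiskerRight SSet ((tensor.obj A).map φ) B ≫ (tensorIso A K B).hom =
      (tensorIso A K' B).hom ≫ (MonoidalClosed.pre φ).app (sHom A B)
  tensorIso_right (A : C) (K : SSet.{u}) {B B' : C} (g : B ⟶ B') :
    eHomWhiskerLeft SSet ((tensor.obj A).obj K) g ≫ (tensorIso A K B').hom =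
      (tensorIso A K B).hom ≫ (ihom K).map (eHomWhiskerLeft SSet A g)
  /-- the isomorphism for cotensors -/
  cotensorIso (A : C) (K : SSet.{u}) (B : C) :
    sHom A ((cotensor.obj (op K)).obj B) ≅ (ihom K).obj (sHom A B)
  cotensorIso_left {A A' : C} (f : A ⟶ A') (K : SSet.{u}) (B : C) :
    eHomWhiskerRight SSet f ((cotensor.obj (op K)).obj B) ≫ (cotensorIso A K B).hom =
      (cotensorIso A' K B).hom ≫ (ihom K).map (eHomWhiskerRight SSet f B)
  cotensorIso_middle (A : C) {K K' : SSet.{u}} (φ : K ⟶ K') (B : C) :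
    eHomWhiskerLeft SSet A ((cotensor.map φ.op).app B) ≫ (cotensorIso A K B).hom =
      (cotensorIso A K' B).hom ≫ (MonoidalClosed.pre φ).app (sHom A B)
  cotensorIso_right (A : C) (K : SSet.{u}) {B B' : C} (g : B ⟶ B') :
    eHomWhiskerLeft SSet A ((cotensor.obj (op K)).map g) ≫ (cotensorIso A K B').hom =
      (cotensorIso A K B).hom ≫ (ihom K).map (eHomWhiskerLeft SSet A g)

variable {C} in
/-- The morphism `Map(B, X) ⟶ Map(A, X) ×_{Map(A, Y)} Map(B, Y)` induced by `i : A ⟶ B` and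
`p : X ⟶ Y`. -/
noncomputable def pullbackMap {A B X Y : C} (i : A ⟶ B) (p : X ⟶ Y) :
    sHom B X ⟶ pullback (eHomWhiskerLeft SSet.{u} A p) (eHomWhiskerRight SSet.{u} i Y) :=
  pullback.lift (eHomWhiskerRight SSet.{u} i X) (eHomWhiskerLeft SSet.{u} B p)
    (eHom_whisker_exchange SSet.{u} i p).symm

variable [CategoryWithWeakEquivalences C] [CategoryWithCofibrations C]
  [CategoryWithFibrations C]

/-- The given classes of weak equivalences, cofibrations and fibrations form a model category
structure. On top of Mathlib's axioms, all small limits and colimits and functorial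
factorizations are required. -/
structure IsModelCategory : Prop where
  modelCategory : ∃ M : ModelCategory C,
    M.categoryWithWeakEquivalences = ‹CategoryWithWeakEquivalences C› ∧
    M.categoryWithCofibrations = ‹CategoryWithCofibrations C› ∧
    M.categoryWithFibrations = ‹CategoryWithFibrations C›
  hasLimits : HasLimitsOfSize.{u, u} C
  hasColimits : HasColimitsOfSize.{u, u} C
  factorization_trivialCofibrations :
    MorphismProperty.HasFunctorialFactorization (trivialCofibrations C) (fibrations C)
  factorization_trivialFibrations :
    MorphismProperty.HasFunctorialFactorization (cofibrations C) (trivialFibrations C)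

open SSet.modelCategoryQuillen in
/-- The axioms which relate a model category structure to a simplicial enrichment: tensors and
cotensors exist, and for a cofibration `i` and a fibration `p`, the morphism `pullbackMap i p` is
a Kan fibration, which is a weak homotopy equivalence if `i` or `p` is a weak equivalence. -/
structure IsSimplicialModelCategory : Prop extends IsModelCategory C where
  tensorCotensor : Nonempty (TensorCotensor C)
  fibration_pullbackMap {A B X Y : C} (i : A ⟶ B) (p : X ⟶ Y) :
    cofibrations C i → fibrations C p → fibrations SSet.{u} (pullbackMap i p)
  weakEquivalence_pullbackMap {A B X Y : C} (i : A ⟶ B) (p : X ⟶ Y) :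
    cofibrations C i → fibrations C p → (weakEquivalences C i ∨ weakEquivalences C p) →
      IsWeakHomotopyEquivalence (pullbackMap i p)

end

section

variable (C : Type (u + 1)) [Category.{u} C]
  [CategoryWithWeakEquivalences C] [CategoryWithCofibrations C] [CategoryWithFibrations C]

/-- Cofibrantly generated: there are sets `I` and `J` of morphisms which permit the small object
argument, such that the trivial fibrations are the morphisms with the right lifting property with
respect to `I` and the fibrations are those with the right lifting property with respect
to `J`. -/
def IsCofibrantlyGenerated : Prop :=
  ∃ I J : MorphismProperty C,
    I.HasSmallObjectArgument.{u} ∧ J.HasSmallObjectArgument.{u} ∧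
    trivialFibrations C = I.rlp ∧ fibrations C = J.rlp

/-- Combinatorial: cofibrantly generated and locally presentable. -/
def IsCombinatorial : Prop :=
  IsCofibrantlyGenerated C ∧ IsLocallyPresentable.{u} C

/-- Every object is fibrant and cofibrant. -/
def AllBifibrant : Prop :=
  (∃ _ : HasTerminal C, ∀ X : C, IsFibrant X) ∧ (∃ _ : HasInitial C, ∀ X : C, IsCofibrant X)

end

end MarkedModel

namespace MarkedModel

/-! ### Preliminaries on functors and markings -/

section

variable {A B D E : Type*} [Category A] [Category B] [Category D] [Category E]

/-! All four cases are deduced from the functor `HasMarked.und` to marked categories and a few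
properties of it, collected in `MarkedTheory`: morphisms are determined by their functors, they lift
along faithful functors that reflect markings, they may be moved along marked natural isomorphisms,
and for every map of sets `S → Ob A` there is an object with object set `S` and with the morphisms
and markings of `A`. Every auxiliary object (mapping cylinder, mapping path space, tensor and
cotensor with a simplex) is such an induced object, and every auxiliary morphism comes from choosing
values on objects and then transporting.

Model structure: weak equivalences are the morphisms that become invertible modulo marked natural
isomorphism, which gives two-out-of-three and retracts. They are also the fully faithful,
marking-reflecting, essentially surjective morphisms (`weakEquivalences_iff`), and trivial
fibrations are the fully faithful ones that reflect markings and are surjective on objects. A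
trivial cofibration is a strong deformation retract, so it lifts against marked isofibrations; the
converse comparison `fibrations_eq` is a retract argument with the mapping path space. The cylinder
and the path space give the functorial factorizations.

Simplicial structure: the pullback-hom map is, up to isomorphism, the nerve of a functor from a
groupoid to a strict pullback of groupoids. This functor is an isofibration, and a surjective
equivalence if one of the two morphisms is a weak equivalence; so its nerve is a Kan fibration,
respectively a weak homotopy equivalence. Tensors and cotensors with simplices are explicit. General
ones exist as adjoints because a simplicial set is a colimit of simplices, and their universal
property is upgraded to mapping spaces by testing it against cotensors and tensors with simplices.

Combinatoriality: `HasMarked.und` is a right adjoint and preserves filtered colimits. The walking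
arrow and the walking marked isomorphism are finitely presentable marked categories, by an explicit
construction of filtered colimits, and their images under the left adjoint form a strong generator.
Generating cofibrations and trivial cofibrations are images under the left adjoint of four morphisms
and of one morphism of marked categories. In the marked pre-additive case the left adjoint and the
colimits are quotients of free pre-additive categories; `Cat` is reflective in marked categories and
`preAdd` in marked pre-additive categories. -/

lemma functor_eq_of_comp_faithful {F G : A ⥤ B} (P : B ⥤ D) [P.Faithful] (h : F ⋙ P = G ⋙ P)
    (ho : ∀ a, F.obj a = G.obj a) : F = G := by
  refine CategoryTheory.Functor.ext ho fun X Y f => P.map_injective ?_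
  have := Functor.congr_hom h f
  dsimp at this
  rw [this]
  simp [eqToHom_map]

/-- The lift of a functor along a fully faithful functor, with prescribed values on objects. -/
noncomputable def liftFunctor (P : E ⥤ A) [P.Full] [P.Faithful] (G : D ⥤ A) (t : D → E)
    (ht : ∀ d, P.obj (t d) = G.obj d) : D ⥤ E where
  obj := t
  map f := P.preimage (eqToHom (ht _) ≫ G.map f ≫ eqToHom (ht _).symm)
  map_id d := P.map_injective (by simp)
  map_comp f g := P.map_injective (by simp)

lemma liftFunctor_comp (P : E ⥤ A) [P.Full] [P.Faithful] (G : D ⥤ A) (t : D → E)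
    (ht : ∀ d, P.obj (t d) = G.obj d) : liftFunctor P G t ht ⋙ P = G :=
  CategoryTheory.Functor.ext ht (fun X Y f => by simp [liftFunctor])

end

namespace Marking

variable {A : Type u} [Category.{u} A] (M : Marking A) {X Y Z : A}

lemma inv_marked (f : X ⟶ Y) [IsIso f] (h : M.marked f) : M.marked (inv f) :=
  M.inv_mem (asIso f) h

lemma marked_eqToHom (h : X = Y) : M.marked (eqToHom h) := by
  subst h
  exact M.id_mem _

lemma of_comp_left (f : X ⟶ Y) (g : Y ⟶ Z) (hf : M.marked f) (hfg : M.marked (f ≫ g)) :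
    M.marked g := by
  have := M.isIso_of_marked _ hf
  simpa using M.comp_mem _ _ (M.inv_marked f hf) hfg

/-- The isomorphism given by a marked morphism. -/
@[simps! hom]
noncomputable def toIso (f : X ⟶ Y) (h : M.marked f) : X ≅ Y :=
  have := M.isIso_of_marked _ h
  asIso f

lemma toIso_inv_marked (f : X ⟶ Y) (h : M.marked f) : M.marked (M.toIso f h).inv :=
  M.inv_mem _ h

lemma marked_conj_iff {X' Y' : A} (h : X' = X) (f : X ⟶ Y) (h' : Y = Y') :
    M.marked (eqToHom h ≫ f ≫ eqToHom h') ↔ M.marked f := by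
  subst h h'
  simp

end Marking

section

variable {C : Type (u + 1)} [Category.{u} C] [HasMarked C]

lemma fn_map_marked {A B : C} (f : A ⟶ B) {X Y : Und A} (v : X ⟶ Y) (hv : IsMarked A v) :
    IsMarked B ((fn f).map v) :=
  (HasMarked.und.map f).map_marked v hv

/-- Morphisms which are fully faithful and reflect marked morphisms. -/
structure IsFullyFaithful {A B : C} (f : A ⟶ B) : Prop where
  full : (fn f).Full
  faithful : (fn f).Faithful
  reflects : ∀ {X Y : Und A} (v : X ⟶ Y), IsMarked B ((fn f).map v) → IsMarked A v

/-- The properties of the functor to marked categories on which the construction of the model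
category structure is based. -/
class MarkedTheory (C : Type (u + 1)) [Category.{u} C] [HasMarked C] : Prop where
  fn_injective : ∀ {A B : C} (f g : A ⟶ B), fn f = fn g → f = g
  -- Additivity and preservation of markings can be tested after a faithful morphism that reflects
  -- markings.
  exists_of_comp_faithful : ∀ {D E A : C} (π : E ⟶ A) (g : D ⟶ A) (F : Und D ⥤ Und E),
    (fn π).Faithful → (∀ {X Y : Und E} (v : X ⟶ Y), IsMarked A ((fn π).map v) → IsMarked E v) →
      F ⋙ fn π = fn g → ∃ g' : D ⟶ E, fn g' = F
  -- This allows the values of a morphism on objects to be changed along marked isomorphisms.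
  exists_of_marked_trans : ∀ {A B : C} (f : A ⟶ B) (F : Und A ⥤ Und B) (α : fn f ⟶ F),
    (∀ a, IsMarked B (α.app a)) → ∃ f' : A ⟶ B, fn f' = F
  -- The only construction of objects that the model structure needs. The bijection `e` replaces an
  -- equality of types.
  exists_induced : ∀ (A : C) {S : Type u} (T : S → Und A), ∃ (E : C) (π : E ⟶ A) (e : S ≃ Und E),
    IsFullyFaithful π ∧ ∀ s, (fn π).obj (e s) = T s

lemma fn_comp_obj {A B D : C} (f : A ⟶ B) (g : B ⟶ D) (a : Und A) :
    (fn (f ≫ g)).obj a = (fn g).obj ((fn f).obj a) :=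
  Functor.congr_obj (fn_comp f g) a

lemma fn_id_obj {A : C} (a : Und A) : (fn (𝟙 A)).obj a = a :=
  Functor.congr_obj (fn_id A) a

lemma fn_comp_map {A B D : C} (f : A ⟶ B) (g : B ⟶ D) {a b : Und A} (v : a ⟶ b) :
    (fn (f ≫ g)).map v = eqToHom (fn_comp_obj f g a) ≫ (fn g).map ((fn f).map v) ≫
      eqToHom (fn_comp_obj f g b).symm :=
  Functor.congr_hom (fn_comp f g) v

lemma fn_id_map {A : C} {a b : Und A} (v : a ⟶ b) :
    (fn (𝟙 A)).map v = eqToHom (fn_id_obj a) ≫ v ≫ eqToHom (fn_id_obj b).symm :=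
  Functor.congr_hom (fn_id A) v

section

variable [MarkedTheory C]

lemma hom_ext_of_faithful {D E A : C} {g g' : D ⟶ E} (π : E ⟶ A) (hπ : (fn π).Faithful)
    (h : g ≫ π = g' ≫ π) (ho : ∀ d, (fn g).obj d = (fn g').obj d) : g = g' := by
  refine MarkedTheory.fn_injective _ _ (functor_eq_of_comp_faithful (fn π) ?_ ho)
  rw [← fn_comp, ← fn_comp, h]

/-- Morphism sets of `E` are those of `A`, so a lift amounts to a choice of objects over the values
of `g`. -/
lemma IsFullyFaithful.exists_lift {D E A : C} {π : E ⟶ A} (hπ : IsFullyFaithful π) (g : D ⟶ A)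
    (t : Und D → Und E) (ht : ∀ d, (fn π).obj (t d) = (fn g).obj d) :
    ∃ g' : D ⟶ E, g' ≫ π = g ∧ ∀ d, (fn g').obj d = t d := by
  have := hπ.full
  have := hπ.faithful
  obtain ⟨g', hg'⟩ := MarkedTheory.exists_of_comp_faithful π g (liftFunctor (fn π) (fn g) t ht)
    hπ.faithful hπ.reflects (liftFunctor_comp _ _ _ _)
  refine ⟨g', MarkedTheory.fn_injective _ _ ?_, fun d => by rw [hg']; rfl⟩
  rw [fn_comp, hg', liftFunctor_comp]

lemma exists_copyObj {A B : C} (f : A ⟶ B) (x : Und A → Und B)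
    (w : ∀ a, (fn f).obj a ≅ x a) (hw : ∀ a, IsMarked B (w a).hom) :
    ∃ f' : A ⟶ B, fn f' = (fn f).copyObj x w :=
  MarkedTheory.exists_of_marked_trans f _ ((fn f).isoCopyObj x w).hom hw

end

/-! ### Composition on mapping groupoids -/

namespace MapGpd

/-- Postcomposition with a morphism, as a functor on mapping groupoids. -/
@[simps obj]
def postcomp (A : C) {B D : C} (g : B ⟶ D) : MapGpd A B ⥤ MapGpd A D where
  obj x := ⟨x.hom ≫ g⟩
  map {x y} α := (compFunctor A B D).map (X := (x, ⟨g⟩)) (Y := (y, ⟨g⟩)) (α, 𝟙 _)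
  map_id x := (compFunctor A B D).map_id (x, ⟨g⟩)
  map_comp {x y z} _ _ := MapGpd.hom_ext ((congrArg _ (Category.comp_id (𝟙 (fn g))).symm).trans
    (hcomp_comp (fn_comp x.hom g) (fn_comp y.hom g) (fn_comp z.hom g) _ _ _ _))

/-- Precomposition with a morphism, as a functor on mapping groupoids. -/
@[simps obj]
def precomp {A B : C} (f : A ⟶ B) (D : C) : MapGpd B D ⥤ MapGpd A D where
  obj x := ⟨f ≫ x.hom⟩
  map {x y} α := (compFunctor A B D).map (X := (⟨f⟩, x)) (Y := (⟨f⟩, y)) (𝟙 _, α)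
  map_id x := (compFunctor A B D).map_id (⟨f⟩, x)
  map_comp {x y z} _ _ := MapGpd.hom_ext
    ((congrArg (fun t => hcomp _ _ t _) (Category.comp_id (𝟙 (fn f))).symm).trans
      (hcomp_comp (fn_comp f x.hom) (fn_comp f y.hom) (fn_comp f z.hom) _ _ _ _))

end MapGpd

/-- Components are lifted through the full functor `P`, and naturality is tested after `P`.
Composites enter through equations because `fn` respects composition only up to propositional
equality. -/
lemma exists_hcomp_id_eq {A B D : Type u} [Category.{u} A] [Category.{u} B] [Category.{u} D]
    {F F' : D ⥤ A} {P : A ⥤ B} [P.Full] [P.Faithful] {K K' : D ⥤ B} (e : K = F ⋙ P)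
    (e' : K' = F' ⋙ P) (γ : K ⟶ K') (M : Marking B) (hγ : ∀ d, M.marked (γ.app d)) :
    ∃ δ : F ⟶ F', hcomp e e' δ (𝟙 P) = γ ∧ ∀ d, M.marked (P.map (δ.app d)) := by
  subst e e'
  refine ⟨{ app := fun d => P.preimage (γ.app d), naturality := fun d d' f => ?_ }, ?_, ?_⟩
  · exact P.map_injective (by simpa using γ.naturality f)
  · ext d
    simp [hcomp]
  · intro d
    simpa using hγ d

lemma hcomp_id_injective {A B D : Type u} [Category.{u} A] [Category.{u} B] [Category.{u} D]
    {F F' : D ⥤ A} {P : A ⥤ B} [P.Faithful] {K K' : D ⥤ B} (e : K = F ⋙ P)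
    (e' : K' = F' ⋙ P) {δ δ' : F ⟶ F'} (h : hcomp e e' δ (𝟙 P) = hcomp e e' δ' (𝟙 P)) :
    δ = δ' := by
  subst e e'
  ext d
  exact P.map_injective (by simpa [hcomp] using NatTrans.congr_app h d)

lemma IsFullyFaithful.exists_postcomp_map_eq {A B D : C} {f : A ⟶ B} (hf : IsFullyFaithful f)
    {x y : MapGpd D A} (γ : (MapGpd.postcomp D f).obj x ⟶ (MapGpd.postcomp D f).obj y) :
    ∃ δ : x ⟶ y, (MapGpd.postcomp D f).map δ = γ := by
  have := hf.full
  have := hf.faithful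
  obtain ⟨δ, hδ, hδ'⟩ := exists_hcomp_id_eq (fn_comp x.hom f) (fn_comp y.hom f) γ.trans _ γ.marked
  exact ⟨⟨δ, fun d => hf.reflects _ (hδ' d)⟩, MapGpd.hom_ext hδ⟩

lemma postcomp_map_injective {A B D : C} {f : A ⟶ B} (hf : (fn f).Faithful)
    {x y : MapGpd D A} {δ δ' : x ⟶ y}
    (h : (MapGpd.postcomp D f).map δ = (MapGpd.postcomp D f).map δ') : δ = δ' :=
  MapGpd.hom_ext (hcomp_id_injective (fn_comp x.hom f) (fn_comp y.hom f)
    (congrArg MapGpd.Hom.trans h))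

/-! ### Weak equivalences -/

/-- The homotopy relation on morphisms: the existence of a marked natural isomorphism. -/
def homotopyRel (C : Type (u + 1)) [Category.{u} C] [HasMarked C] : HomRel C :=
  fun A B f g => Nonempty ((⟨f⟩ : MapGpd A B) ⟶ ⟨g⟩)

instance : Congruence (homotopyRel C) where
  equivalence :=
    { refl := fun _ => ⟨𝟙 _⟩
      symm := fun ⟨α⟩ => ⟨inv α⟩
      trans := fun ⟨α⟩ ⟨β⟩ => ⟨α ≫ β⟩ }
  comp_left {A B D} f _ _ := fun ⟨α⟩ =>
    ⟨(compFunctor A B D).map (X := (⟨f⟩, _)) (Y := (⟨f⟩, _)) (𝟙 _, α)⟩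
  comp_right {A B D} _ _ g := fun ⟨α⟩ =>
    ⟨(compFunctor A B D).map (X := (_, ⟨g⟩)) (Y := (_, ⟨g⟩)) (α, 𝟙 _)⟩

/-- A homotopy inverse is an inverse in the quotient by the homotopy relation. Two-out-of-three and
stability under retracts are thereby inherited from isomorphisms. -/
lemma weakEquivalences_eq : weakEquivalences C =
    (MorphismProperty.isomorphisms _).inverseImage (Quotient.functor (homotopyRel C)) := by
  ext A B f
  constructor
  · rintro ⟨g, h₁, h₂⟩
    refine ⟨(Quotient.functor _).map g, ?_, ?_⟩
    · rw [← Functor.map_comp, ← CategoryTheory.Functor.map_id]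
      exact (Quotient.functor_map_eq_iff _ _ _).2 h₁
    · rw [← Functor.map_comp, ← CategoryTheory.Functor.map_id]
      exact (Quotient.functor_map_eq_iff _ _ _).2 h₂
  · rintro ⟨g, h₁, h₂⟩
    obtain ⟨g, rfl⟩ := (Quotient.functor (homotopyRel C)).map_surjective g
    refine ⟨g, ?_, ?_⟩
    · rw [← Functor.map_comp, ← CategoryTheory.Functor.map_id] at h₁
      exact (Quotient.functor_map_eq_iff _ _ _).1 h₁
    · rw [← Functor.map_comp, ← CategoryTheory.Functor.map_id] at h₂
      exact (Quotient.functor_map_eq_iff _ _ _).1 h₂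

instance : (weakEquivalences C).HasTwoOutOfThreeProperty := by
  rw [weakEquivalences_eq]
  infer_instance

instance : (weakEquivalences C).IsStableUnderRetracts := by
  rw [weakEquivalences_eq]
  infer_instance

/-- Morphisms for which each object of the target receives a marked isomorphism from an object
of the image. -/
def IsMarkedEssSurj {A B : C} (f : A ⟶ B) : Prop :=
  ∀ b : Und B, ∃ (a : Und A) (w : (fn f).obj a ⟶ b), IsMarked B w

lemma isEquivalence_of_weakEquivalences {A B : C} {f : A ⟶ B} (hf : weakEquivalences C f) :
    (fn f).IsEquivalence := by
  obtain ⟨g, ⟨α⟩, ⟨β⟩⟩ := hf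
  have := MapGpd.isIso_trans α
  have := MapGpd.isIso_trans β
  exact (CategoryTheory.Equivalence.mk (fn f) (fn g)
    (eqToIso (fn_id A).symm ≪≫ (asIso α.trans).symm ≪≫ eqToIso (fn_comp f g))
    (eqToIso (fn_comp g f).symm ≪≫ asIso β.trans ≪≫ eqToIso (fn_id B))).isEquivalence_functor

/-- For the reflection of markings: if the image of `v` under `f` is marked, so is its image under
`f ≫ g`, and the marked natural isomorphism to the identity carries this back to `v`. -/
lemma isFullyFaithful_of_weakEquivalences {A B : C} {f : A ⟶ B} (hf : weakEquivalences C f) :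
    IsFullyFaithful f := by
  have := isEquivalence_of_weakEquivalences hf
  refine ⟨inferInstance, inferInstance, fun {X Y} v hv => ?_⟩
  obtain ⟨g, ⟨α⟩, -⟩ := hf
  have h₁ := fn_map_marked g _ hv
  have h₂ : IsMarked A ((fn (f ≫ g)).map v) := by
    rw [fn_comp_map]
    exact (Marking.marked_conj_iff _ _ _ _).2 h₁
  have h₃ : IsMarked A ((fn (𝟙 A)).map v) := by
    refine Marking.of_comp_left _ (α.trans.app X) _ (α.marked X) ?_
    dsimp only
    rw [← α.trans.naturality]
    exact Marking.comp_mem _ _ _ h₂ (α.marked Y)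
  rw [fn_id_map] at h₃
  exact (Marking.marked_conj_iff _ _ _ _).1 h₃

lemma isMarkedEssSurj_of_weakEquivalences {A B : C} {f : A ⟶ B} (hf : weakEquivalences C f) :
    IsMarkedEssSurj f := by
  obtain ⟨g, -, ⟨β⟩⟩ := hf
  intro b
  refine ⟨(fn g).obj b, eqToHom (fn_comp_obj g f b).symm ≫ β.trans.app b ≫ eqToHom (fn_id_obj b),
    (Marking.marked_conj_iff _ _ _ _).2 (β.marked b)⟩

variable [MarkedTheory C]

/-- A fully faithful morphism has a homotopy inverse with prescribed values on objects. -/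
lemma IsFullyFaithful.exists_homotopyInverse {A B : C} {f : A ⟶ B} (hf : IsFullyFaithful f)
    (s : Und B → Und A) (w : ∀ b, (fn f).obj (s b) ⟶ b) (hw : ∀ b, IsMarked B (w b)) :
    ∃ (g : B ⟶ A) (β : (⟨g ≫ f⟩ : MapGpd B B) ⟶ ⟨𝟙 B⟩) (hs : ∀ b, (fn g).obj b = s b),
      (∀ b, β.trans.app b = eqToHom ((fn_comp_obj g f b).trans (by rw [hs])) ≫ w b ≫
        eqToHom (fn_id_obj b).symm) ∧ Nonempty ((⟨f ≫ g⟩ : MapGpd A A) ⟶ ⟨𝟙 A⟩) := by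
  let w' (b : Und B) : (fn (𝟙 B)).obj b ≅ (fn f).obj (s b) :=
    eqToIso (fn_id_obj b) ≪≫ (Marking.toIso _ (w b) (hw b)).symm
  have hw' (b : Und B) : IsMarked B (w' b).hom :=
    Marking.comp_mem _ _ _ (Marking.marked_eqToHom _ (fn_id_obj b))
      (Marking.toIso_inv_marked _ (w b) (hw b))
  -- The identity of `B` is moved to a morphism with values `f (s b)` on objects; being in the image
  -- of `f` on objects, it factors through the fully faithful `f`.
  obtain ⟨h, hh⟩ := exists_copyObj (𝟙 B) _ w' hw'
  obtain ⟨g, hg, hs⟩ := hf.exists_lift h s (fun b => (Functor.congr_obj hh b).symm)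
  have e : fn (g ≫ f) = (fn (𝟙 B)).copyObj _ w' := by rw [hg, hh]
  let β : (⟨g ≫ f⟩ : MapGpd B B) ⟶ ⟨𝟙 B⟩ :=
    ⟨eqToHom e ≫ ((fn (𝟙 B)).isoCopyObj _ w').inv, fun b => by
      rw [NatTrans.comp_app, eqToHom_app]
      exact Marking.comp_mem _ _ _ (Marking.marked_eqToHom _ _) (Marking.inv_mem _ (w' b) (hw' b))⟩
  have hβ (b : Und B) : β.trans.app b = eqToHom ((fn_comp_obj g f b).trans (by rw [hs])) ≫ w b ≫
        eqToHom (fn_id_obj b).symm := by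
    dsimp [β]
    rw [eqToHom_app]
    simp [w']
    rfl
  refine ⟨g, β, hs, hβ, ?_⟩
  -- Whiskering `β` with `f` gives the second homotopy after composition with `f`, and full
  -- faithfulness of `f` removes this composition.
  let γ : (⟨(f ≫ g) ≫ f⟩ : MapGpd A B) ⟶ ⟨𝟙 A ≫ f⟩ :=
    eqToHom (by simp) ≫ (MapGpd.precomp f B).map β ≫ eqToHom (by simp)
  obtain ⟨δ, -⟩ := hf.exists_postcomp_map_eq (x := ⟨f ≫ g⟩) (y := ⟨𝟙 A⟩) γ
  exact ⟨δ⟩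

lemma weakEquivalences_iff {A B : C} (f : A ⟶ B) :
    weakEquivalences C f ↔ IsFullyFaithful f ∧ IsMarkedEssSurj f := by
  refine ⟨fun h => ⟨isFullyFaithful_of_weakEquivalences h, isMarkedEssSurj_of_weakEquivalences h⟩,
    fun ⟨h₁, h₂⟩ => ?_⟩
  choose s w hw using h₂
  obtain ⟨g, β, -, -, ⟨α⟩⟩ := h₁.exists_homotopyInverse s w hw
  exact ⟨g, ⟨α⟩, ⟨β⟩⟩

end

end MarkedModel

namespace MarkedModel

/-! ### Arrows -/

section

variable {A B D : Type*} [Category A] [Category B] [Category D]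

/-- Morphisms whose endpoints agree only propositionally are compared below as objects of the arrow
category, where every `eqToHom` disappears and functors, composition and inverses respect equality.
-/
lemma arrow_mk_conj {X Y X' Y' : A} (h : X' = X) (f : X ⟶ Y) (h' : Y = Y') :
    Arrow.mk (eqToHom h ≫ f ≫ eqToHom h') = Arrow.mk f := by
  subst h h'
  simp

lemma arrow_mk_comp_congr {X Y Z X' Y' Z' : A} {f : X ⟶ Y} {g : Y ⟶ Z} {f' : X' ⟶ Y'}
    {g' : Y' ⟶ Z'} (hf : Arrow.mk f = Arrow.mk f') (hg : Arrow.mk g = Arrow.mk g') :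
    Arrow.mk (f ≫ g) = Arrow.mk (f' ≫ g') := by
  cases hf
  cases hg
  rfl

lemma arrow_mk_map_congr (F : A ⥤ B) {X Y X' Y' : A} {f : X ⟶ Y} {f' : X' ⟶ Y'}
    (hf : Arrow.mk f = Arrow.mk f') : Arrow.mk (F.map f) = Arrow.mk (F.map f') := by
  cases hf
  rfl

lemma arrow_mk_functor_congr {F G : A ⥤ B} (h : F = G) {X Y : A} (f : X ⟶ Y) :
    Arrow.mk (F.map f) = Arrow.mk (G.map f) := by
  rw [h]

lemma arrow_mk_id_congr {X Y : A} (h : X = Y) : Arrow.mk (𝟙 X) = Arrow.mk (𝟙 Y) := by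
  rw [h]

lemma arrow_mk_inv_congr {X Y X' Y' : A} {f : X ⟶ Y} {f' : X' ⟶ Y'} [IsIso f] [IsIso f']
    (hf : Arrow.mk f = Arrow.mk f') : Arrow.mk (inv f) = Arrow.mk (inv f') := by
  cases hf
  rfl

/-- Functors which are targets of the same natural isomorphism are equal. -/
lemma functor_eq_of_arrow_mk_app {F G G' : A ⥤ B} (α : F ⟶ G) (α' : F ⟶ G')
    (hα : ∀ a, IsIso (α.app a)) (h : ∀ a, Arrow.mk (α.app a) = Arrow.mk (α'.app a)) : G = G' := by
  have ho (a : A) : G.obj a = G'.obj a := congrArg (fun m => m.right) (h a)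
  have hα' (a : A) : α.app a ≫ eqToHom (ho a) = α'.app a :=
    Arrow.mk_injective _ _ (by simpa using h a)
  refine CategoryTheory.Functor.ext ho fun a b f => ?_
  have := hα a
  rw [← cancel_epi (α.app a), ← α.naturality, ← cancel_mono (eqToHom (ho b))]
  simp only [Category.assoc, eqToHom_trans, eqToHom_refl, Category.comp_id]
  rw [hα', α'.naturality, ← hα', Category.assoc]

/-- Functors which are sources of the same natural isomorphism are equal. -/
lemma functor_eq_of_arrow_mk_app' {F G G' : A ⥤ B} (α : G ⟶ F) (α' : G' ⟶ F)
    (hα : ∀ a, IsIso (α'.app a)) (h : ∀ a, Arrow.mk (α.app a) = Arrow.mk (α'.app a)) : G = G' := by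
  have ho (a : A) : G.obj a = G'.obj a := congrArg (fun m => m.left) (h a)
  have hα' (a : A) : α.app a = eqToHom (ho a) ≫ α'.app a :=
    Arrow.mk_injective _ _ (by simpa using h a)
  refine CategoryTheory.Functor.ext ho fun a b f => ?_
  have := hα b
  rw [← cancel_mono (eqToHom (ho b)), ← cancel_mono (α'.app b)]
  simp only [Category.assoc, eqToHom_trans, eqToHom_refl, Category.id_comp]
  rw [← hα', α.naturality, hα', α'.naturality, Category.assoc]

lemma arrow_mk_app_congr {F G : A ⥤ B} (α : F ⟶ G) {a b : A} (h : a = b) :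
    Arrow.mk (α.app a) = Arrow.mk (α.app b) := by
  subst h
  rfl

end

lemma Marking.marked_congr {A : Type u} [Category.{u} A] (M : Marking A) {X Y X' Y' : A}
    {f : X ⟶ Y} {f' : X' ⟶ Y'} (hf : Arrow.mk f = Arrow.mk f') (h : M.marked f) :
    M.marked f' := by
  cases hf
  exact h

section

variable {C : Type (u + 1)} [Category.{u} C] [HasMarked C]

lemma arrow_mk_fn_comp_map {A B D : C} (f : A ⟶ B) (g : B ⟶ D) {a b : Und A} (v : a ⟶ b) :
    Arrow.mk ((fn (f ≫ g)).map v) = Arrow.mk ((fn g).map ((fn f).map v)) :=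
  arrow_mk_functor_congr (fn_comp f g) v

lemma arrow_mk_fn_id_map {A : C} {a b : Und A} (v : a ⟶ b) :
    Arrow.mk ((fn (𝟙 A)).map v) = Arrow.mk v :=
  arrow_mk_functor_congr (fn_id A) v

lemma fn_comp_mapArrow {A B D : C} (f : A ⟶ B) (g : B ⟶ D) (m : Arrow (Und A)) :
    (fn (f ≫ g)).mapArrow.obj m = (fn g).mapArrow.obj ((fn f).mapArrow.obj m) :=
  arrow_mk_fn_comp_map f g m.hom

lemma fn_id_mapArrow {A : C} (m : Arrow (Und A)) : (fn (𝟙 A)).mapArrow.obj m = m :=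
  arrow_mk_fn_id_map m.hom

namespace MapGpd

lemma isIso_trans_app {A B : C} {x y : MapGpd A B} (α : x ⟶ y) (a : Und A) :
    IsIso (α.trans.app a) :=
  Marking.isIso_of_marked _ _ (α.marked a)

lemma arrow_mk_precomp_map_app {A B D : C} (f : A ⟶ B) {x y : MapGpd B D} (α : x ⟶ y) (a : Und A) :
    Arrow.mk (((precomp f D).map α).trans.app a) = Arrow.mk (α.trans.app ((fn f).obj a)) := by
  have (F : Und A ⥤ Und B) {K K' : Und A ⥤ Und D} (e : K = F ⋙ fn x.hom)
      (e' : K' = F ⋙ fn y.hom) : Arrow.mk ((hcomp e e' (𝟙 F) α.trans).app a) =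
        Arrow.mk (α.trans.app (F.obj a)) := by
    subst e e'
    simp [hcomp]
  exact this _ (fn_comp f x.hom) (fn_comp f y.hom)

lemma arrow_mk_postcomp_map_app {A B D : C} (g : B ⟶ D) {x y : MapGpd A B} (α : x ⟶ y)
    (a : Und A) :
    Arrow.mk (((postcomp A g).map α).trans.app a) = Arrow.mk ((fn g).map (α.trans.app a)) := by
  have (G : Und B ⥤ Und D) {K K' : Und A ⥤ Und D} (e : K = fn x.hom ⋙ G)
      (e' : K' = fn y.hom ⋙ G) : Arrow.mk ((hcomp e e' α.trans (𝟙 G)).app a) =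
        Arrow.mk (G.map (α.trans.app a)) := by
    subst e e'
    simp [hcomp]
  exact this _ (fn_comp x.hom g) (fn_comp y.hom g)

lemma arrow_mk_eqToHom_comp_app {A B : C} {x' x y : MapGpd A B} (h : x' = x) (α : x ⟶ y)
    (a : Und A) : Arrow.mk ((eqToHom h ≫ α).trans.app a) = Arrow.mk (α.trans.app a) := by
  subst h
  rw [eqToHom_refl, Category.id_comp]

lemma arrow_mk_comp_eqToHom_app {A B : C} {x y y' : MapGpd A B} (α : x ⟶ y) (h : y = y')
    (a : Und A) : Arrow.mk ((α ≫ eqToHom h).trans.app a) = Arrow.mk (α.trans.app a) := by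
  subst h
  rw [eqToHom_refl, Category.comp_id]

lemma arrow_mk_eqToHom_app {A B : C} {x y : MapGpd A B} (h : x = y) (a : Und A) :
    Arrow.mk ((eqToHom h).trans.app a) = Arrow.mk (𝟙 ((fn x.hom).obj a)) := by
  subst h
  rfl

lemma hom_ext_arrow {A B : C} {x y : MapGpd A B} {α β : x ⟶ y}
    (h : ∀ a, Arrow.mk (α.trans.app a) = Arrow.mk (β.trans.app a)) : α = β :=
  hom_ext (NatTrans.ext (funext fun a => Arrow.mk_injective _ _ (h a)))

lemma eq_of_arrow_mk_app [MarkedTheory C] {A B : C} {x y y' : MapGpd A B} (α : x ⟶ y)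
    (α' : x ⟶ y') (h : ∀ a, Arrow.mk (α.trans.app a) = Arrow.mk (α'.trans.app a)) : y = y' :=
  MapGpd.ext (MarkedTheory.fn_injective _ _
    (functor_eq_of_arrow_mk_app α.trans α'.trans (isIso_trans_app α) h))

lemma eq_of_arrow_mk_app' [MarkedTheory C] {A B : C} {x x' y : MapGpd A B} (α : x ⟶ y)
    (α' : x' ⟶ y) (h : ∀ a, Arrow.mk (α.trans.app a) = Arrow.mk (α'.trans.app a)) : x = x' :=
  MapGpd.ext (MarkedTheory.fn_injective _ _
    (functor_eq_of_arrow_mk_app' α.trans α'.trans (isIso_trans_app α') h))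

end MapGpd

lemma markedIsofibrations_iff {A B : C} (f : A ⟶ B) : markedIsofibrations C f ↔
    ∀ (c : Und A) (d : Und B) (w : (fn f).obj c ⟶ d), IsMarked B w →
      ∃ (c' : Und A) (v : c ⟶ c'), IsMarked A v ∧ Arrow.mk ((fn f).map v) = Arrow.mk w := by
  refine forall₄_congr fun c d w hw => exists_congr fun c' => exists_congr fun v => ?_
  constructor
  · rintro ⟨h, hv, rfl⟩
    exact ⟨hv, (Arrow.arrow_mk_comp_eqToHom _ _).symm⟩
  · rintro ⟨hv, h⟩
    have h' := congrArg (fun m => m.right) h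
    exact ⟨h', hv, Arrow.mk_injective _ _ ((Arrow.arrow_mk_comp_eqToHom _ _).trans h)⟩

variable [MarkedTheory C]

/-- A morphism may be replaced by one with prescribed marked isomorphisms to its values. -/
lemma exists_homotopy_of_family {B X : C} (h₀ : B ⟶ X) (x : Und B → Und X)
    (w : ∀ b, (fn h₀).obj b ⟶ x b) (hw : ∀ b, IsMarked X (w b)) :
    ∃ (h : B ⟶ X) (η : (⟨h₀⟩ : MapGpd B X) ⟶ ⟨h⟩),
      (∀ b, (fn h).obj b = x b) ∧ ∀ b, Arrow.mk (η.trans.app b) = Arrow.mk (w b) := by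
  let w' (b : Und B) := Marking.toIso _ (w b) (hw b)
  obtain ⟨h, hh⟩ := exists_copyObj h₀ x w' hw
  have hη (b : Und B) : Arrow.mk ((((fn h₀).isoCopyObj x w').hom ≫ eqToHom hh.symm).app b) =
      Arrow.mk (w b) := by
    rw [NatTrans.comp_app, eqToHom_app, Arrow.arrow_mk_comp_eqToHom]
    rfl
  exact ⟨h, ⟨((fn h₀).isoCopyObj x w').hom ≫ eqToHom hh.symm,
    fun b => Marking.marked_congr _ (hη b).symm (hw b)⟩, fun b => Functor.congr_obj hh b, hη⟩

/-- The source of all strict lifts: `h₀` is moved along `w` to `h`. The morphisms `h ≫ p` and `v`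
are then targets of natural isomorphisms with the same source and the same components, hence equal.
-/
lemma exists_lift_of_family {B X Y : C} (p : X ⟶ Y) (h₀ : B ⟶ X) (v : B ⟶ Y)
    (β : (⟨h₀ ≫ p⟩ : MapGpd B Y) ⟶ ⟨v⟩) (x : Und B → Und X)
    (w : ∀ b, (fn h₀).obj b ⟶ x b) (hw : ∀ b, IsMarked X (w b))
    (hwβ : ∀ b, Arrow.mk ((fn p).map (w b)) = Arrow.mk (β.trans.app b)) :
    ∃ (h : B ⟶ X) (η : (⟨h₀⟩ : MapGpd B X) ⟶ ⟨h⟩), h ≫ p = v ∧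
      ∀ b, Arrow.mk (η.trans.app b) = Arrow.mk (w b) := by
  obtain ⟨h, η, -, hη⟩ := exists_homotopy_of_family h₀ x w hw
  refine ⟨h, η, congrArg MapGpd.hom
    (MapGpd.eq_of_arrow_mk_app ((MapGpd.postcomp B p).map η) β fun b => ?_), hη⟩
  exact (MapGpd.arrow_mk_postcomp_map_app p η b).trans
    ((arrow_mk_map_congr _ (hη b)).trans (hwβ b))

/-! ### Liftings -/

/-- A trivial cofibration is a strong deformation retract. -/
lemma exists_deformationRetraction {A B : C} {i : A ⟶ B} (hi : trivialCofibrations C i) :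
    ∃ (g : B ⟶ A) (β : (⟨g ≫ i⟩ : MapGpd B B) ⟶ ⟨𝟙 B⟩), i ≫ g = 𝟙 A ∧
      ∀ a, Arrow.mk (β.trans.app ((fn i).obj a)) = Arrow.mk (𝟙 ((fn i).obj a)) := by
  have hinj : Function.Injective (fn i).obj := hi.1
  obtain ⟨hff, hs⟩ := (weakEquivalences_iff i).1 hi.2
  -- On the image of `i` the chosen isomorphism is an identity, which makes the homotopy inverse a
  -- strict retraction and the homotopy constant along `i`; injectivity of `i` makes the choice
  -- consistent.
  have hs' (b : Und B) : ∃ (a : Und A) (w : (fn i).obj a ⟶ b), IsMarked B w ∧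
      ∀ a', (fn i).obj a' = b → a = a' ∧ Arrow.mk w = Arrow.mk (𝟙 b) := by
    by_cases hb : ∃ a, (fn i).obj a = b
    · obtain ⟨a, rfl⟩ := hb
      exact ⟨a, 𝟙 _, Marking.id_mem _ _, fun a' h => ⟨hinj h.symm, rfl⟩⟩
    · obtain ⟨a, w, hw⟩ := hs b
      exact ⟨a, w, hw, fun a' h => (hb ⟨a', h⟩).elim⟩
  choose s w hw hw' using hs'
  obtain ⟨g, β, hg, hβ, -⟩ := hff.exists_homotopyInverse s w hw
  have hβ' (a : Und A) :
      Arrow.mk (β.trans.app ((fn i).obj a)) = Arrow.mk (𝟙 ((fn i).obj a)) := by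
    rw [hβ, arrow_mk_conj]
    exact (hw' _ a rfl).2
  refine ⟨g, β, ?_, hβ'⟩
  refine hom_ext_of_faithful i hff.faithful ?_ fun a => ?_
  -- Along `i` the homotopy `β` has identity components, so its source and target agree there.
  · have := congrArg MapGpd.hom (MapGpd.eq_of_arrow_mk_app' ((MapGpd.precomp i B).map β)
      (eqToHom (by simp) : (⟨i⟩ : MapGpd A B) ⟶ _) fun a =>
        (MapGpd.arrow_mk_precomp_map_app i β a).trans
          ((hβ' a).trans (MapGpd.arrow_mk_eqToHom_app _ a).symm))
    simpa using this
  · rw [fn_comp_obj, fn_id_obj, hg, (hw' _ a rfl).1]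

/-- The candidate `g ≫ t`, with `g` a deformation retraction, lies over `v` only up to the homotopy
induced by `β`. The isofibration lifts this homotopy object by object, and it is lifted by
identities on the image of `i`, so that the corrected morphism still restricts to `t`. -/
lemma exists_lift_of_markedIsofibrations {A B X Y : C} {i : A ⟶ B} {p : X ⟶ Y}
    (hi : trivialCofibrations C i) (hp : markedIsofibrations C p) (t : A ⟶ X) (v : B ⟶ Y)
    (sq : t ≫ p = i ≫ v) : ∃ h : B ⟶ X, i ≫ h = t ∧ h ≫ p = v := by
  obtain ⟨g, β, hg, hβ⟩ := exists_deformationRetraction hi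
  let β' : (⟨(g ≫ t) ≫ p⟩ : MapGpd B Y) ⟶ ⟨v⟩ :=
    eqToHom (by simp [sq]) ≫ (MapGpd.postcomp B v).map β ≫ eqToHom (by simp)
  have hβ' (b : Und B) : Arrow.mk (β'.trans.app b) = Arrow.mk ((fn v).map (β.trans.app b)) := by
    rw [MapGpd.arrow_mk_eqToHom_comp_app, MapGpd.arrow_mk_comp_eqToHom_app,
      MapGpd.arrow_mk_postcomp_map_app]
  rw [markedIsofibrations_iff] at hp
  have key (b : Und B) : ∃ (x : Und X) (w : (fn (g ≫ t)).obj b ⟶ x), IsMarked X w ∧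
      Arrow.mk ((fn p).map w) = Arrow.mk (β'.trans.app b) ∧
      ((∃ a, (fn i).obj a = b) → Arrow.mk w = Arrow.mk (𝟙 ((fn (g ≫ t)).obj b))) := by
    by_cases hb : ∃ a, (fn i).obj a = b
    · obtain ⟨a, rfl⟩ := hb
      refine ⟨_, 𝟙 _, Marking.id_mem _ _, ?_, fun _ => rfl⟩
      rw [hβ', CategoryTheory.Functor.map_id]
      refine ((arrow_mk_map_congr (fn v) (hβ a)).trans ?_).symm
      rw [CategoryTheory.Functor.map_id]
      apply arrow_mk_id_congr
      rw [← fn_comp_obj, ← fn_comp_obj, ← fn_comp_obj, ← sq, ← Category.assoc, reassoc_of% hg]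
    · obtain ⟨x, w, hw, h⟩ := hp _ _ (eqToHom (fn_comp_obj (g ≫ t) p b).symm ≫ β'.trans.app b)
        (Marking.comp_mem _ _ _ (Marking.marked_eqToHom _ _) (β'.marked b))
      exact ⟨x, w, hw, by rw [h, Arrow.arrow_mk_eqToHom_comp], fun h => (hb h).elim⟩
  choose x w hw hwβ hw' using key
  obtain ⟨h, η, hh, hη⟩ := exists_lift_of_family p (g ≫ t) v β' x w hw hwβ
  have e : (MapGpd.precomp i X).obj ⟨g ≫ t⟩ = ⟨t⟩ := by simp [reassoc_of% hg]
  refine ⟨h, congrArg MapGpd.hom (MapGpd.eq_of_arrow_mk_app ((MapGpd.precomp i X).map η)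
    (eqToHom e) fun a => ?_), hh⟩
  refine (MapGpd.arrow_mk_precomp_map_app i η a).trans ((hη _).trans ((hw' _ ⟨a, rfl⟩).trans
    (Eq.trans ?_ (MapGpd.arrow_mk_eqToHom_app _ a).symm)))
  exact arrow_mk_id_congr (fn_comp_obj _ _ _).symm

end

end MarkedModel

namespace MarkedModel

/-! ### Surjective fully faithful morphisms and their lifting property -/

section

variable {C : Type (u + 1)} [Category.{u} C] [HasMarked C]

lemma markedIsofibrations_of_isFullyFaithful {A B : C} {f : A ⟶ B} (hf : IsFullyFaithful f)
    (hs : Function.Surjective (fn f).obj) : markedIsofibrations C f := by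
  rw [markedIsofibrations_iff]
  rintro c d w hw
  obtain ⟨c', rfl⟩ := hs d
  have := hf.full
  obtain ⟨v, rfl⟩ := (fn f).map_surjective w
  exact ⟨c', v, hf.reflects _ hw, rfl⟩

namespace cylinder

/-- The objects of the mapping cylinder. -/
def T (f : Arrow C) : Und f.left ⊕ Und f.right → Und f.right :=
  Sum.elim (fn f.hom).obj id

/-- The functoriality of the mapping cylinder on objects. -/
def mapObj {f g : Arrow C} (φ : f ⟶ g) : Und f.left ⊕ Und f.right → Und g.left ⊕ Und g.right :=
  Sum.map (fn φ.left).obj (fn φ.right).obj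

lemma T_mapObj {f g : Arrow C} (φ : f ⟶ g) (s : Und f.left ⊕ Und f.right) :
    T g (mapObj φ s) = (fn φ.right).obj (T f s) := by
  obtain a | b := s
  · exact (fn_comp_obj _ _ _).symm.trans
      ((by rw [φ.w] : (fn (φ.left ≫ g.hom)).obj a = (fn (f.hom ≫ φ.right)).obj a).trans
        (fn_comp_obj _ _ _))
  · rfl

end cylinder

variable [MarkedTheory C]

lemma markedIsofibrations_le_fibrations : markedIsofibrations C ≤ fibrations C := by
  intro X Y p hp A B i hi
  refine ⟨fun {t v} sq => ?_⟩
  obtain ⟨h, h₁, h₂⟩ := exists_lift_of_markedIsofibrations hi hp t v sq.w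
  exact ⟨⟨⟨h, h₁, h₂⟩⟩⟩

/-- Only values on objects have to be chosen: those of `t` on the image of `i`, any preimages under
`p` elsewhere. -/
lemma exists_lift_of_isFullyFaithful {A B X Y : C} {i : A ⟶ B} {p : X ⟶ Y}
    (hi : cofibrations C i) (hp : IsFullyFaithful p) (hp' : Function.Surjective (fn p).obj)
    (t : A ⟶ X) (v : B ⟶ Y) (sq : t ≫ p = i ≫ v) : ∃ h : B ⟶ X, i ≫ h = t ∧ h ≫ p = v := by
  have key (b : Und B) : ∃ x : Und X, (fn p).obj x = (fn v).obj b ∧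
      ∀ a, (fn i).obj a = b → x = (fn t).obj a := by
    by_cases hb : ∃ a, (fn i).obj a = b
    · obtain ⟨a, rfl⟩ := hb
      refine ⟨(fn t).obj a, ?_, fun a' ha' => by rw [hi ha']⟩
      rw [← fn_comp_obj, ← fn_comp_obj, sq]
    · obtain ⟨x, hx⟩ := hp' ((fn v).obj b)
      exact ⟨x, hx, fun a ha => (hb ⟨a, ha⟩).elim⟩
  choose x hx hx' using key
  obtain ⟨h, hh, ho⟩ := hp.exists_lift v x hx
  refine ⟨h, hom_ext_of_faithful p hp.faithful ?_ fun a => ?_, hh⟩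
  · rw [Category.assoc, hh, sq]
  · rw [fn_comp_obj, ho, hx' _ a rfl]

lemma trivialFibrations_of_isFullyFaithful {A B : C} {f : A ⟶ B} (hf : IsFullyFaithful f)
    (hs : Function.Surjective (fn f).obj) : trivialFibrations C f := by
  refine ⟨markedIsofibrations_le_fibrations _ (markedIsofibrations_of_isFullyFaithful hf hs),
    (weakEquivalences_iff f).2 ⟨hf, fun b => ?_⟩⟩
  obtain ⟨a, rfl⟩ := hs b
  exact ⟨a, 𝟙 _, Marking.id_mem _ _⟩

/-! ### Induced objects -/

/-- The object with a given set of objects `S` over the objects of `A`, and with the morphisms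
of `A`. -/
noncomputable def ind (A : C) {S : Type u} (T : S → Und A) : C :=
  (MarkedTheory.exists_induced A T).choose

namespace ind

variable {A D : C} {S : Type u} (T : S → Und A)

/-- The canonical morphism from an induced object. -/
noncomputable def π : ind A T ⟶ A :=
  (MarkedTheory.exists_induced A T).choose_spec.choose

/-- The objects of an induced object. -/
noncomputable def e : S ≃ Und (ind A T) :=
  (MarkedTheory.exists_induced A T).choose_spec.choose_spec.choose

lemma isFullyFaithful : IsFullyFaithful (π T) :=
  (MarkedTheory.exists_induced A T).choose_spec.choose_spec.choose_spec.1

instance : (fn (π T)).Full := (isFullyFaithful T).full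

lemma π_obj (s : S) : (fn (π T)).obj (e T s) = T s :=
  (MarkedTheory.exists_induced A T).choose_spec.choose_spec.choose_spec.2 s

lemma π_obj' (s : Und (ind A T)) : (fn (π T)).obj s = T ((e T).symm s) := by
  rw [← π_obj T, Equiv.apply_symm_apply]

variable {T}

lemma hom_ext {g g' : D ⟶ ind A T} (h : g ≫ π T = g' ≫ π T)
    (ho : ∀ d, (fn g).obj d = (fn g').obj d) : g = g' :=
  hom_ext_of_faithful (π T) (isFullyFaithful T).faithful h ho

lemma exists_lift (g : D ⟶ A) (t : Und D → S) (ht : ∀ d, T (t d) = (fn g).obj d) :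
    ∃ h : D ⟶ ind A T, h ≫ π T = g ∧ ∀ d, (fn h).obj d = e T (t d) :=
  (isFullyFaithful T).exists_lift g (fun d => e T (t d)) (fun d => by rw [π_obj, ht])

/-- The morphism to an induced object given by a morphism and by the values on objects. -/
noncomputable def lift (g : D ⟶ A) (t : Und D → S) (ht : ∀ d, T (t d) = (fn g).obj d) :
    D ⟶ ind A T :=
  (exists_lift g t ht).choose

@[simp]
lemma lift_π (g : D ⟶ A) (t : Und D → S) (ht : ∀ d, T (t d) = (fn g).obj d) :
    lift g t ht ≫ π T = g :=
  (exists_lift g t ht).choose_spec.1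

lemma lift_obj (g : D ⟶ A) (t : Und D → S) (ht : ∀ d, T (t d) = (fn g).obj d) (d : Und D) :
    (fn (lift g t ht)).obj d = e T (t d) :=
  (exists_lift g t ht).choose_spec.2 d

end ind

/-! ### Factorization into a cofibration and a trivial fibration -/

namespace cylinder

/-- The mapping cylinder of a morphism. -/
noncomputable abbrev Z (f : Arrow C) : C := ind f.right (T f)

/-- The functoriality of the mapping cylinder. -/
noncomputable def map {f g : Arrow C} (φ : f ⟶ g) : Z f ⟶ Z g :=
  ind.lift (ind.π (T f) ≫ φ.right) (fun s => mapObj φ ((ind.e (T f)).symm s)) (fun d => by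
    rw [T_mapObj, fn_comp_obj, ind.π_obj'])

lemma map_obj {f g : Arrow C} (φ : f ⟶ g) (s : Und f.left ⊕ Und f.right) :
    (fn (map φ)).obj (ind.e (T f) s) = ind.e (T g) (mapObj φ s) := by
  rw [map, ind.lift_obj, Equiv.symm_apply_apply]

@[simp]
lemma map_π {f g : Arrow C} (φ : f ⟶ g) : map φ ≫ ind.π (T g) = ind.π (T f) ≫ φ.right :=
  ind.lift_π _ _ _

@[simp]
lemma map_π_assoc {f g : Arrow C} (φ : f ⟶ g) {E : C} (k : g.right ⟶ E) :
    map φ ≫ ind.π (T g) ≫ k = ind.π (T f) ≫ φ.right ≫ k := by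
  rw [← Category.assoc, map_π, Category.assoc]

/-- The inclusion of the source into the mapping cylinder. -/
noncomputable def i (f : Arrow C) : f.left ⟶ Z f := ind.lift f.hom Sum.inl (fun _ => rfl)

lemma i_obj (f : Arrow C) (a : Und f.left) : (fn (i f)).obj a = ind.e (T f) (Sum.inl a) :=
  ind.lift_obj _ _ _ _

@[simp]
lemma i_π (f : Arrow C) : i f ≫ ind.π (T f) = f.hom := ind.lift_π _ _ _

@[simp]
lemma i_π_assoc (f : Arrow C) {E : C} (k : f.right ⟶ E) :
    i f ≫ ind.π (T f) ≫ k = f.hom ≫ k := by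
  rw [← Category.assoc, i_π]

lemma i_naturality {f g : Arrow C} (φ : f ⟶ g) : φ.left ≫ i g = i f ≫ map φ :=
  ind.hom_ext (by simp) fun a => by
    rw [fn_comp_obj, fn_comp_obj, i_obj, i_obj, map_obj]
    rfl

lemma cofibrations_i (f : Arrow C) : cofibrations C (i f) := by
  intro a b h
  rw [i_obj, i_obj] at h
  simpa using h

/-- The functorial factorization given by mapping cylinders. -/
noncomputable def data :
    MorphismProperty.FunctorialFactorizationData (cofibrations C) (trivialFibrations C) where
  Z :=
    { obj := Z
      map := map
      map_id f := ind.hom_ext (by simp) fun d => by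
        obtain ⟨s, rfl⟩ := (ind.e (T f)).surjective d
        refine (map_obj _ s).trans ?_
        rw [fn_id_obj]
        obtain a | b := s
        · exact congrArg (fun t => ind.e (T f) (Sum.inl t)) (fn_id_obj a)
        · exact congrArg (fun t => ind.e (T f) (Sum.inr t)) (fn_id_obj b)
      map_comp {f g h} φ ψ := ind.hom_ext (by simp) fun d => by
        obtain ⟨s, rfl⟩ := (ind.e (T f)).surjective d
        refine (map_obj _ s).trans ?_
        rw [fn_comp_obj, map_obj, map_obj]
        obtain a | b := s
        · exact congrArg (fun t => ind.e (T h) (Sum.inl t)) (fn_comp_obj _ _ a)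
        · exact congrArg (fun t => ind.e (T h) (Sum.inr t)) (fn_comp_obj _ _ b) }
  i :=
    { app f := i f
      naturality _ _ φ := i_naturality φ }
  p :=
    { app f := ind.π (T f)
      naturality _ _ φ := map_π φ }
  fac := by ext f; exact i_π f
  hi f := cofibrations_i f
  hp f := trivialFibrations_of_isFullyFaithful (ind.isFullyFaithful _)
    fun b => ⟨ind.e (T f) (Sum.inr b), ind.π_obj _ _⟩

end cylinder

/-! ### Factorization into a trivial cofibration and a fibration -/

namespace pathSpace

/-- The objects of the mapping path space. -/
abbrev S (f : Arrow C) : Type u :=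
  -- Keeping the path as an object of the arrow category makes its image under a functor simply
  -- `mapArrow`, without transports.
  { x : Und f.left × Arrow (Und f.right) //
    x.2.left = (fn f.hom).obj x.1 ∧ IsMarked f.right x.2.hom }

/-- The projection on objects. -/
def T (f : Arrow C) (s : S f) : Und f.left := s.1.1

/-- The mapping path space of a morphism. -/
noncomputable abbrev Z (f : Arrow C) : C := ind f.left (T f)

/-- The functoriality of the mapping path space on objects. -/
def mapObj {f g : Arrow C} (φ : f ⟶ g) (s : S f) : S g :=
  ⟨((fn φ.left).obj s.1.1, (fn φ.right).mapArrow.obj s.1.2), by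
    refine (congrArg (fn φ.right).obj s.2.1).trans ((fn_comp_obj _ _ _).symm.trans (Eq.trans ?_
      (fn_comp_obj _ _ _)))
    rw [φ.w], fn_map_marked _ _ s.2.2⟩

/-- The functoriality of the mapping path space. -/
noncomputable def map {f g : Arrow C} (φ : f ⟶ g) : Z f ⟶ Z g :=
  ind.lift (ind.π (T f) ≫ φ.left) (fun s => mapObj φ ((ind.e (T f)).symm s)) (fun d => by
    rw [fn_comp_obj, ind.π_obj']
    rfl)

lemma map_obj {f g : Arrow C} (φ : f ⟶ g) (s : S f) :
    (fn (map φ)).obj (ind.e (T f) s) = ind.e (T g) (mapObj φ s) := by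
  rw [map, ind.lift_obj, Equiv.symm_apply_apply]

/-- The value of the projection of the mapping path space, with a homotopy. -/
lemma exists_p (f : Arrow C) : ∃ (p : Z f ⟶ f.right)
    (η : (⟨ind.π (T f) ≫ f.hom⟩ : MapGpd (Z f) f.right) ⟶ ⟨p⟩),
      ∀ s, Arrow.mk (η.trans.app (ind.e (T f) s)) = s.1.2 := by
  have h (z : Und (Z f)) : (fn (ind.π (T f) ≫ f.hom)).obj z =
      ((ind.e (T f)).symm z).1.2.left := by
    rw [fn_comp_obj, ind.π_obj', ((ind.e (T f)).symm z).2.1]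
    rfl
  -- The composite to the source and then along `f` is moved, at each object, along the path which
  -- the object carries.
  obtain ⟨p, η, -, hη⟩ := exists_homotopy_of_family (ind.π (T f) ≫ f.hom)
    (fun z => ((ind.e (T f)).symm z).1.2.right)
    (fun z => eqToHom (h z) ≫ ((ind.e (T f)).symm z).1.2.hom)
    (fun z => Marking.comp_mem _ _ _ (Marking.marked_eqToHom _ _) ((ind.e (T f)).symm z).2.2)
  refine ⟨p, η, fun s => (hη _).trans ?_⟩
  rw [Arrow.arrow_mk_eqToHom_comp, Equiv.symm_apply_apply]
  rfl

/-- The projection of the mapping path space to the target. -/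
noncomputable def p (f : Arrow C) : Z f ⟶ f.right := (exists_p f).choose

/-- The canonical homotopy to the projection. -/
noncomputable def η (f : Arrow C) :
    (⟨ind.π (T f) ≫ f.hom⟩ : MapGpd (Z f) f.right) ⟶ ⟨p f⟩ :=
  (exists_p f).choose_spec.choose

lemma arrow_mk_η_app (f : Arrow C) (s : S f) :
    Arrow.mk ((η f).trans.app (ind.e (T f) s)) = s.1.2 :=
  (exists_p f).choose_spec.choose_spec s

/-- The object of the mapping path space given by a constant path. -/
def const (f : Arrow C) (a : Und f.left) : S f :=
  ⟨(a, Arrow.mk (𝟙 ((fn f.hom).obj a))), rfl, Marking.id_mem _ _⟩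

/-- The inclusion into the mapping path space. -/
noncomputable def i (f : Arrow C) : f.left ⟶ Z f :=
  ind.lift (𝟙 _) (const f) (fun a => (fn_id_obj a).symm)

lemma i_obj (f : Arrow C) (a : Und f.left) : (fn (i f)).obj a = ind.e (T f) (const f a) :=
  ind.lift_obj _ _ _ _

@[simp]
lemma i_π (f : Arrow C) : i f ≫ ind.π (T f) = 𝟙 _ := ind.lift_π _ _ _

@[simp]
lemma i_π_assoc (f : Arrow C) {E : C} (k : f.left ⟶ E) : i f ≫ ind.π (T f) ≫ k = k := by
  rw [← Category.assoc, i_π, Category.id_comp]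

@[simp]
lemma map_π {f g : Arrow C} (φ : f ⟶ g) : map φ ≫ ind.π (T g) = ind.π (T f) ≫ φ.left :=
  ind.lift_π _ _ _

@[simp]
lemma map_π_assoc {f g : Arrow C} (φ : f ⟶ g) {E : C} (k : g.left ⟶ E) :
    map φ ≫ ind.π (T g) ≫ k = ind.π (T f) ≫ φ.left ≫ k := by
  rw [← Category.assoc, map_π, Category.assoc]

lemma i_naturality {f g : Arrow C} (φ : f ⟶ g) : φ.left ≫ i g = i f ≫ map φ :=
  ind.hom_ext (by simp) fun a => by
    refine (fn_comp_obj _ _ _).trans (Eq.trans ?_ (fn_comp_obj _ _ _).symm)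
    refine (i_obj _ _).trans (Eq.trans ?_ (congrArg _ (i_obj _ _)).symm)
    refine Eq.trans ?_ (map_obj φ _).symm
    refine congrArg (ind.e (T g)) (Subtype.ext (Prod.ext rfl ?_))
    refine Eq.trans ?_ (congrArg Arrow.mk (CategoryTheory.Functor.map_id _ _).symm)
    exact arrow_mk_id_congr ((mapObj φ (const f a)).2.1).symm

/-- On constant paths the homotopy `η` has identity components, so its two ends coincide there. -/
lemma i_p (f : Arrow C) : i f ≫ p f = f.hom := by
  have e : (MapGpd.precomp (i f) f.right).obj ⟨ind.π (T f) ≫ f.hom⟩ = ⟨f.hom⟩ := by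
    simp
  refine congrArg MapGpd.hom (MapGpd.eq_of_arrow_mk_app ((MapGpd.precomp (i f) _).map (η f))
    (eqToHom e) fun a => ?_)
  refine (MapGpd.arrow_mk_precomp_map_app _ _ _).trans ((arrow_mk_app_congr _ (i_obj f a)).trans
    ((arrow_mk_η_app f _).trans (Eq.trans ?_ (MapGpd.arrow_mk_eqToHom_app _ a).symm)))
  refine arrow_mk_id_congr ?_
  rw [e]

/-- Both composites are targets of natural isomorphisms from the same morphism, with the image of
the given path as component. -/
lemma map_p {f g : Arrow C} (φ : f ⟶ g) : map φ ≫ p g = p f ≫ φ.right := by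
  have e : (MapGpd.precomp (map φ) g.right).obj ⟨ind.π (T g) ≫ g.hom⟩ =
      (MapGpd.postcomp (Z f) φ.right).obj ⟨ind.π (T f) ≫ f.hom⟩ := by
    simp
  refine congrArg MapGpd.hom (MapGpd.eq_of_arrow_mk_app ((MapGpd.precomp (map φ) _).map (η g))
    (eqToHom e ≫ (MapGpd.postcomp _ φ.right).map (η f)) fun z => ?_)
  obtain ⟨s, rfl⟩ := (ind.e (T f)).surjective z
  refine (MapGpd.arrow_mk_precomp_map_app _ _ _).trans ((arrow_mk_app_congr _ (map_obj φ s)).trans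
    ((arrow_mk_η_app g _).trans (Eq.trans ?_ (MapGpd.arrow_mk_eqToHom_comp_app _ _ _).symm)))
  refine Eq.trans ?_ (MapGpd.arrow_mk_postcomp_map_app _ _ _).symm
  exact (congrArg (fn φ.right).mapArrow.obj (arrow_mk_η_app f s)).symm

/-- `i f` is a section of the trivial fibration `ind.π (T f)`; two-out-of-three applies. -/
lemma trivialCofibrations_i (f : Arrow C) : trivialCofibrations C (i f) := by
  constructor
  · intro a b h
    rw [i_obj, i_obj] at h
    exact congrArg (fun s => s.1.1) ((ind.e (T f)).injective h)
  · have h : weakEquivalences C (ind.π (T f)) :=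
      (trivialFibrations_of_isFullyFaithful (ind.isFullyFaithful _)
        fun a => ⟨ind.e (T f) (const f a), ind.π_obj _ _⟩).2
    exact (weakEquivalences C).of_postcomp (i f) (ind.π (T f)) h (by
      rw [i_π, weakEquivalences_eq]
      exact MorphismProperty.id_mem _ _)

/-- The extension of a path in the mapping path space by a marked isomorphism. -/
lemma exists_marked (f : Arrow C) (z : Und (Z f)) (d : Und f.right) (w : (fn (p f)).obj z ⟶ d)
    (hw : IsMarked f.right w) : ∃ (z' : Und (Z f)) (v : z ⟶ z'), IsMarked (Z f) v ∧
      Arrow.mk ((fn (p f)).map v) = Arrow.mk w := by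
  obtain ⟨s, rfl⟩ := (ind.e (T f)).surjective z
  have hs := arrow_mk_η_app f s
  have h₁ : (fn (ind.π (T f) ≫ f.hom)).obj (ind.e (T f) s) = (fn f.hom).obj s.1.1 := by
    rw [fn_comp_obj, ind.π_obj]
    rfl
  -- The path of `s` prolonged by `w`, over the same object of the source.
  let s' : S f := ⟨(s.1.1, Arrow.mk ((η f).trans.app (ind.e (T f) s) ≫ w)), h₁,
    Marking.comp_mem _ _ _ ((η f).marked _) hw⟩
  have h₂ : (fn (ind.π (T f))).obj (ind.e (T f) s) = (fn (ind.π (T f))).obj (ind.e (T f) s') := by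
    rw [ind.π_obj, ind.π_obj]
    rfl
  -- `v` lies over an identity. Naturality of `η` expresses its image under `p` as the inverse of
  -- the old path followed by the new one, which is `w`.
  obtain ⟨v, hv⟩ := (fn (ind.π (T f))).map_surjective (eqToHom h₂)
  refine ⟨_, v, (ind.isFullyFaithful _).reflects _ (by rw [hv]; exact Marking.marked_eqToHom _ _),
    ?_⟩
  have h₃ := (η f).trans.naturality v
  have h₄ : (fn (ind.π (T f) ≫ f.hom)).map v = eqToHom (by rw [fn_comp_obj, h₂, fn_comp_obj]) := by
    rw [fn_comp_map, hv, eqToHom_map, eqToHom_trans, eqToHom_trans]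
  have := MapGpd.isIso_trans_app (η f) (ind.e (T f) s)
  have h₅ := arrow_mk_η_app f s'
  have h₆ : (fn (p f)).map v = inv ((η f).trans.app (ind.e (T f) s)) ≫
      (fn (ind.π (T f) ≫ f.hom)).map v ≫ (η f).trans.app (ind.e (T f) s') := by
    rw [h₃, IsIso.inv_hom_id_assoc]
  rw [h₆, h₄]
  refine (arrow_mk_comp_congr rfl ((Arrow.arrow_mk_eqToHom_comp _ _).trans h₅)).trans ?_
  exact congrArg Arrow.mk (IsIso.inv_hom_id_assoc _ _)

lemma markedIsofibrations_p (f : Arrow C) : markedIsofibrations C (p f) :=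
  (markedIsofibrations_iff _).2 (exists_marked f)

/-- The functorial factorization given by mapping path spaces. -/
noncomputable def data :
    MorphismProperty.FunctorialFactorizationData (trivialCofibrations C) (fibrations C) where
  Z :=
    { obj := Z
      map := map
      map_id f := ind.hom_ext (by simp) fun d => by
        obtain ⟨s, rfl⟩ := (ind.e (T f)).surjective d
        refine (map_obj _ s).trans ?_
        rw [fn_id_obj]
        exact congrArg (ind.e (T f)) (Subtype.ext (Prod.ext (fn_id_obj _) (fn_id_mapArrow _)))
      map_comp {f g h} φ ψ := ind.hom_ext (by simp) fun d => by
        obtain ⟨s, rfl⟩ := (ind.e (T f)).surjective d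
        refine (map_obj _ s).trans ?_
        rw [fn_comp_obj, map_obj, map_obj]
        exact congrArg (ind.e (T h))
          (Subtype.ext (Prod.ext (fn_comp_obj _ _ _) (fn_comp_mapArrow _ _ _))) }
  i :=
    { app f := i f
      naturality _ _ φ := i_naturality φ }
  p :=
    { app f := p f
      naturality _ _ φ := map_p φ }
  fac := by ext f; exact i_p f
  hi f := trivialCofibrations_i f
  hp f := markedIsofibrations_le_fibrations _ (markedIsofibrations_p f)

end pathSpace

end

end MarkedModel

namespace MarkedModel

/-! ### The model category structure -/

section

variable {C : Type (u + 1)} [Category.{u} C] [HasMarked C]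

lemma fn_obj_injective_of_comp_eq_id {A B : C} {i : A ⟶ B} {r : B ⟶ A} (h : i ≫ r = 𝟙 A) :
    Function.Injective (fn i).obj := fun a b hab => by
  have := congrArg (fn r).obj hab
  rwa [← fn_comp_obj, ← fn_comp_obj, h, fn_id_obj, fn_id_obj] at this

lemma hasLiftingProperty_of_trivialCofibrations {A B X Y : C} {i : A ⟶ B} {p : X ⟶ Y}
    (hi : trivialCofibrations C i) (hp : fibrations C p) : HasLiftingProperty i p :=
  hp i hi

variable [MarkedTheory C]

/-- Retract argument: lifting against the inclusion into the mapping path space exhibits `f` as a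
retract of the projection `pathSpace.p`, and the marked isomorphisms lifted there are carried back
by the retraction. -/
lemma fibrations_le_markedIsofibrations : fibrations C ≤ markedIsofibrations C := by
  intro X Y f hf
  rw [markedIsofibrations_iff]
  intro c d w hw
  have := hf _ (pathSpace.trivialCofibrations_i (Arrow.mk f))
  have sq : CommSq (𝟙 X) (pathSpace.i (Arrow.mk f)) f (pathSpace.p (Arrow.mk f)) :=
    ⟨(Category.id_comp _).trans (pathSpace.i_p (Arrow.mk f)).symm⟩
  have e : (fn (pathSpace.p (Arrow.mk f))).obj ((fn (pathSpace.i (Arrow.mk f))).obj c) =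
      (fn f).obj c :=
    (fn_comp_obj _ _ _).symm.trans (congrArg (fun k => (fn k).obj c) (pathSpace.i_p (Arrow.mk f)))
  obtain ⟨z, v, hv, hv'⟩ := pathSpace.exists_marked (Arrow.mk f)
    ((fn (pathSpace.i (Arrow.mk f))).obj c) d (eqToHom e ≫ w)
    (Marking.comp_mem _ _ _ (Marking.marked_eqToHom _ _) hw)
  have e' : c = (fn sq.lift).obj ((fn (pathSpace.i (Arrow.mk f))).obj c) :=
    (fn_id_obj c).symm.trans ((congrArg (fun k => (fn k).obj c) sq.fac_left.symm).trans
      (fn_comp_obj _ _ _))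
  refine ⟨_, eqToHom e' ≫ (fn sq.lift).map v,
    Marking.comp_mem _ _ _ (Marking.marked_eqToHom _ _) (fn_map_marked _ _ hv), ?_⟩
  refine (arrow_mk_map_congr _ (Arrow.arrow_mk_eqToHom_comp _ _)).trans
    ((arrow_mk_fn_comp_map _ _ _).symm.trans ?_)
  refine (arrow_mk_functor_congr (congrArg fn sq.fac_right) v).trans (hv'.trans ?_)
  exact Arrow.arrow_mk_eqToHom_comp _ _

lemma fibrations_eq : fibrations C = markedIsofibrations C :=
  le_antisymm fibrations_le_markedIsofibrations markedIsofibrations_le_fibrations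

/-- For strict surjectivity: essential surjectivity supplies a marked isomorphism from the image to
`b`, and the target of its lift is a preimage of `b`. -/
lemma trivialFibrations_iff {A B : C} (f : A ⟶ B) :
    trivialFibrations C f ↔ IsFullyFaithful f ∧ Function.Surjective (fn f).obj := by
  refine ⟨fun ⟨h₁, h₂⟩ => ?_, fun h => trivialFibrations_of_isFullyFaithful h.1 h.2⟩
  rw [fibrations_eq, markedIsofibrations_iff] at h₁
  obtain ⟨h₃, h₄⟩ := (weakEquivalences_iff f).1 h₂
  refine ⟨h₃, fun b => ?_⟩
  obtain ⟨a, w, hw⟩ := h₄ b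
  obtain ⟨a', v, -, hv⟩ := h₁ a b w hw
  exact ⟨a', congrArg (fun m => m.right) hv⟩

instance : (fibrations C).IsStableUnderRetracts :=
  inferInstanceAs ((trivialCofibrations C).rlp.IsStableUnderRetracts)

instance : (cofibrations C).IsStableUnderRetracts where
  of_retract {A B X Y f g} h hg := by
    have h₁ : Function.Injective (fn (h.i.left ≫ g)).obj := by
      intro a b hab
      rw [fn_comp_obj, fn_comp_obj] at hab
      exact fn_obj_injective_of_comp_eq_id h.retract_left (hg hab)
    have h₂ : f ≫ h.i.right = h.i.left ≫ g := h.i.w.symm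
    rw [← h₂] at h₁
    intro a b hab
    apply h₁
    rw [fn_comp_obj, fn_comp_obj, hab]

lemma hasFunctorialFactorization_trivialCofibrations :
    MorphismProperty.HasFunctorialFactorization (trivialCofibrations C) (fibrations C) :=
  ⟨⟨pathSpace.data⟩⟩

lemma hasFunctorialFactorization_trivialFibrations :
    MorphismProperty.HasFunctorialFactorization (cofibrations C) (trivialFibrations C) :=
  ⟨⟨cylinder.data⟩⟩

variable (C) in
lemma isModelCategory [HasLimitsOfSize.{u, u} C] [HasColimitsOfSize.{u, u} C] :
    IsModelCategory C where
  hasLimits := inferInstance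
  hasColimits := inferInstance
  factorization_trivialCofibrations := hasFunctorialFactorization_trivialCofibrations
  factorization_trivialFibrations := hasFunctorialFactorization_trivialFibrations
  modelCategory := by
    have := hasFunctorialFactorization_trivialCofibrations (C := C)
    have := hasFunctorialFactorization_trivialFibrations (C := C)
    have := hasFiniteLimits_of_hasLimitsOfSize.{u, u} C
    have := hasFiniteColimits_of_hasColimitsOfSize.{u, u} C
    exact ⟨{
      cm1a := inferInstance
      cm1b := inferInstance
      cm4a i p hi hi' hp := 
        hasLiftingProperty_of_trivialCofibrations ⟨hi.mem, hi'.mem⟩ hp.mem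
      cm4b {A B X Y} i p hi hp hp' := by
        obtain ⟨h₁, h₂⟩ := (trivialFibrations_iff p).1 ⟨hp.mem, hp'.mem⟩
        refine ⟨fun {t v} sq => ?_⟩
        obtain ⟨h, h₃, h₄⟩ := exists_lift_of_isFullyFaithful hi.mem h₁ h₂ t v sq.w
        exact ⟨⟨⟨h, h₃, h₄⟩⟩⟩ }, rfl, rfl, rfl⟩

variable (C) in
lemma allBifibrant [HasTerminal C] [HasInitial C] : AllBifibrant C := by
  refine ⟨⟨inferInstance, fun X => ⟨fun A B i hi => ⟨fun {t v} sq => ?_⟩⟩⟩,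
    ⟨inferInstance, fun X => ⟨fun a => ?_⟩⟩⟩
  -- A retraction of the trivial cofibration extends every morphism defined on its source.
  · obtain ⟨g, -, hg, -⟩ := exists_deformationRetraction hi
    exact ⟨⟨⟨g ≫ t, by rw [← Category.assoc, hg, Category.id_comp], Subsingleton.elim _ _⟩⟩⟩
  -- The initial object maps to an object without objects, so it has none itself.
  · have f : ⊥_ C ⟶ ind X (PEmpty.elim : PEmpty → Und X) := initial.to _
    exact ((ind.e _).symm ((fn f).obj a)).elim

end

end MarkedModel

namespace MarkedModel

/-! ### Horns in nerves of groupoids -/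

section

lemma functor_eq_of_arrow_mk {A B : Type*} [Category A] [Category B] {F G : A ⥤ B}
    (h : ∀ {a b : A} (f : a ⟶ b), Arrow.mk (F.map f) = Arrow.mk (G.map f)) : F = G := by
  have ho (a : A) : F.obj a = G.obj a := congrArg (fun m => m.left) (h (𝟙 a))
  refine CategoryTheory.Functor.ext ho fun a b f => Arrow.mk_injective _ _ ?_
  rw [h f, arrow_mk_conj]

variable {G : Type u} [Groupoid.{u} G]

/-- The morphism between two values of a functor from a linear order to a groupoid. -/
def conn {J : Type*} [LinearOrder J] (x : J ⥤ G) (k l : J) : x.obj k ⟶ x.obj l :=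
  if h : k ≤ l then x.map (homOfLE h) else Groupoid.inv (x.map (homOfLE (not_le.1 h).le))

lemma conn_comp_map {J : Type*} [LinearOrder J] (x : J ⥤ G) (k : J) {l m : J} (f : l ⟶ m) :
    conn x k l ≫ x.map f = conn x k m := by
  have hf := leOfHom f
  unfold conn
  split_ifs with h₁ h₂ h₂
  · rw [← x.map_comp]
    rfl
  · exact (h₂ (h₁.trans hf)).elim
  · rw [Groupoid.inv_eq_inv, IsIso.inv_comp_eq, ← x.map_comp]
    rfl
  · rw [Groupoid.inv_eq_inv, Groupoid.inv_eq_inv, IsIso.inv_comp_eq, ← IsIso.comp_inv_eq,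
      IsIso.inv_inv, ← x.map_comp]
    rfl

/-- The comparison of two arrows with the same source in a groupoid. -/
lemma arrow_mk_inv_comp_congr {u v u' v' : Arrow G} (h : u.left = v.left) (hu : u = u')
    (hv : v = v') : Arrow.mk (inv u.hom ≫ eqToHom h ≫ v.hom) =
      Arrow.mk (inv u'.hom ≫ eqToHom (by rw [← hu, ← hv, h]) ≫ v'.hom) := by
  subst hu hv
  rfl

/-- A simplex of the nerve of a groupoid is determined by its edges at one vertex `k`; this governs
existence and uniqueness of horn extensions. -/
lemma arrow_mk_map_eq_conn {J : Type*} [LinearOrder J] (x : J ⥤ G) (k : J) {l m : J}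
    (f : l ⟶ m) : Arrow.mk (x.map f) =
      Arrow.mk (inv (conn x k l) ≫ eqToHom rfl ≫ conn x k m) := by
  rw [eqToHom_refl, Category.id_comp, ← conn_comp_map x k f, IsIso.inv_hom_id_assoc]

lemma horn_face_map_eq {n m : ℕ} {i j j' : Fin (n + 2)} (h : j ≠ i) (h' : j' ≠ i)
    {θ θ' : ⦋m⦌ ⟶ ⦋n⦌} (hθ : θ ≫ SimplexCategory.δ j = θ' ≫ SimplexCategory.δ j') :
    (Λ[n + 1, i] : SSet.{u}).map θ.op (SSet.horn.face i j h) =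
      (Λ[n + 1, i] : SSet.{u}).map θ'.op (SSet.horn.face i j' h') :=
  Subtype.ext (congrArg SSet.stdSimplex.objEquiv.symm hθ)

lemma horn_ι_app_face {n : ℕ} {i j : Fin (n + 2)} (h : j ≠ i) {X : SSet.{u}}
    (y : X _⦋n + 1⦌) :
    ((Λ[n + 1, i] : (Δ[n + 1] : SSet.{u}).Subcomplex).ι ≫ SSet.yonedaEquiv.symm y).app _
      (SSet.horn.face i j h) = X.map (SimplexCategory.δ j).op y :=
  rfl

lemma arrow_mk_nerve_map_eq {m m' : ℕ} {x : ComposableArrows G m} {x' : ComposableArrows G m'}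
    {k l : Fin (m + 1)} {k' l' : Fin (m' + 1)} (hkl : k ≤ l) (hkl' : k' ≤ l')
    (h : (nerve G).map (SimplexCategory.mkOfLe k l hkl).op x =
      (nerve G).map (SimplexCategory.mkOfLe k' l' hkl').op x') :
    Arrow.mk (x.map (homOfLE hkl)) = Arrow.mk (x'.map (homOfLE hkl')) :=
  arrow_mk_functor_congr (F := (nerve G).map (SimplexCategory.mkOfLe k l hkl).op x)
    (G := (nerve G).map (SimplexCategory.mkOfLe k' l' hkl').op x') h
    (homOfLE (Fin.zero_le 1) : (0 : Fin 2) ⟶ 1)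

lemma mkOfLe_comp_δ_eq {n : ℕ} {j j' : Fin (n + 2)} {k l k' l' : Fin (n + 1)} (hkl : k ≤ l)
    (hkl' : k' ≤ l') (hk : j.succAbove k = j'.succAbove k') (hl : j.succAbove l = j'.succAbove l') :
    SimplexCategory.mkOfLe k l hkl ≫ SimplexCategory.δ j =
      SimplexCategory.mkOfLe k' l' hkl' ≫ SimplexCategory.δ j' := by
  ext t
  fin_cases t
  · exact congrArg Fin.val hk
  · exact congrArg Fin.val hl

section

variable {n : ℕ} {i : Fin (n + 2)} (σ : (Λ[n + 1, i] : SSet.{u}) ⟶ nerve G)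

/-- The face of a horn in the nerve of a groupoid. -/
def hornFace (j : Fin (n + 2)) (h : j ≠ i) : ComposableArrows G n :=
  σ.app _ (SSet.horn.face i j h)

lemma arrow_mk_hornFace_map {j j' : Fin (n + 2)} (h : j ≠ i) (h' : j' ≠ i)
    {k l k' l' : Fin (n + 1)} (hkl : k ≤ l) (hkl' : k' ≤ l')
    (hk : j.succAbove k = j'.succAbove k') (hl : j.succAbove l = j'.succAbove l') :
    Arrow.mk ((hornFace σ j h).map (homOfLE hkl)) =
      Arrow.mk ((hornFace σ j' h').map (homOfLE hkl')) := by
  apply arrow_mk_nerve_map_eq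
  refine (NatTrans.naturality_apply σ _ _).symm.trans (Eq.trans ?_ (NatTrans.naturality_apply σ _ _))
  exact congrArg _ (horn_face_map_eq _ _ (mkOfLe_comp_δ_eq _ _ hk hl))

/-- An edge common to two faces of the horn has one value, in either orientation. -/
lemma arrow_mk_hornFace_conn {j j' : Fin (n + 2)} (h : j ≠ i) (h' : j' ≠ i)
    {k l k' l' : Fin (n + 1)}
    (hk : j.succAbove k = j'.succAbove k') (hl : j.succAbove l = j'.succAbove l') :
    Arrow.mk (conn (hornFace σ j h) k l) = Arrow.mk (conn (hornFace σ j' h') k' l') := by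
  have h₁ : k ≤ l ↔ k' ≤ l' := by
    rw [← Fin.succAbove_le_succAbove_iff (p := j), hk, hl, Fin.succAbove_le_succAbove_iff]
  unfold conn
  split_ifs with h₂ h₃ h₃
  · exact arrow_mk_hornFace_map σ h h' h₂ h₃ hk hl
  · exact (h₃ (h₁.1 h₂)).elim
  · exact (h₂ (h₁.2 h₃)).elim
  · rw [Groupoid.inv_eq_inv, Groupoid.inv_eq_inv]
    exact arrow_mk_inv_congr (arrow_mk_hornFace_map σ h h' _ _ hl hk)

end

lemma arrow_mk_conn_comp {J K : Type*} [LinearOrder J] [LinearOrder K] (x : K ⥤ G) (φ : J ⥤ K)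
    (hφ : ∀ k l, φ.obj k ≤ φ.obj l → k ≤ l) (k l : J) :
    Arrow.mk (conn (φ ⋙ x) k l) = Arrow.mk (conn x (φ.obj k) (φ.obj l)) := by
  unfold conn
  split_ifs with h₂ h₃ h₃
  · rfl
  · exact (h₃ (leOfHom (φ.map (homOfLE h₂)))).elim
  · exact (h₂ (hφ _ _ h₃)).elim
  · rfl

section

variable {n : ℕ} {i : Fin (n + 3)}

/-- In dimension at least two some face of the horn at `i` contains both vertices `i` and `a`: the
one opposite a third vertex `j`. -/
lemma exists_index (i a : Fin (n + 3)) : ∃ j : Fin (n + 3), j ≠ i ∧ j ≠ a := by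
  obtain ⟨j, hj⟩ := Finset.exists_mem_notMem_of_card_lt_card (s := {i, a}) (t := Finset.univ)
    (lt_of_le_of_lt Finset.card_le_two (by simp))
  exact ⟨j, by simpa [not_or] using hj⟩

/-- A map from a horn of dimension at least two to the nerve of a groupoid extends. -/
lemma exists_horn_extension (σ : (Λ[n + 2, i] : SSet.{u}) ⟶ nerve G) :
    ∃ y : ComposableArrows G (n + 2), ∀ (j : Fin (n + 3)) (h : j ≠ i),
      (nerve G).map (SimplexCategory.δ j).op y = hornFace σ j h := by
  choose j hji hja using exists_index i
  choose i' hi' using fun a => Fin.exists_succAbove_eq (hji a).symm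
  choose a' ha' using fun a => Fin.exists_succAbove_eq (hja a).symm
  -- The edge from vertex `i` to vertex `a`. Any two such edges with their common source determine
  -- the edge between their ends.
  let e (a : Fin (n + 3)) : Arrow G := Arrow.mk (conn (hornFace σ (j a) (hji a)) (i' a) (a' a))
  have he (b : Fin (n + 3)) (hb : b ≠ i) (k l : Fin (n + 2)) (hk : b.succAbove k = i) :
      e (b.succAbove l) = Arrow.mk (conn (hornFace σ b hb) k l) :=
    arrow_mk_hornFace_conn σ _ hb ((hi' _).trans hk.symm) (ha' _)
  have hl (a b : Fin (n + 3)) : (e a).left = (e b).left :=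
    congrArg (fun m => m.left) (arrow_mk_hornFace_conn σ (hji a) (hji b)
      (k := i' a) (l := i' a) (k' := i' b) (l' := i' b)
        ((hi' a).trans (hi' b).symm) ((hi' a).trans (hi' b).symm))
  let y : ComposableArrows G (n + 2) :=
    { obj a := (e a).right
      map {a b} _ := inv (e a).hom ≫ eqToHom (hl a b) ≫ (e b).hom
      map_id a := by simp
      map_comp f g := by simp }
  refine ⟨y, fun b hb => functor_eq_of_arrow_mk fun {k l} f => ?_⟩
  obtain ⟨i', hi'⟩ := Fin.exists_succAbove_eq hb.symm
  rw [arrow_mk_map_eq_conn _ i' f]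
  exact arrow_mk_inv_comp_congr (hl _ _) (he b hb i' k hi') (he b hb i' l hi')

/-- Each edge at the vertex `i` lies in a face opposite some `j ≠ i`. -/
lemma horn_extension_unique {y y' : ComposableArrows G (n + 2)}
    (h : ∀ (j : Fin (n + 3)), j ≠ i → (nerve G).map (SimplexCategory.δ j).op y =
      (nerve G).map (SimplexCategory.δ j).op y') : y = y' := by
  have key (a : Fin (n + 3)) : Arrow.mk (conn y i a) = Arrow.mk (conn y' i a) := by
    obtain ⟨j, hji, hja⟩ := exists_index i a
    obtain ⟨i', rfl⟩ := Fin.exists_succAbove_eq hji.symm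
    obtain ⟨a', rfl⟩ := Fin.exists_succAbove_eq hja.symm
    have hj := h j hji
    have h₁ (z : ComposableArrows G (n + 2)) :
        Arrow.mk (conn ((nerve G).map (SimplexCategory.δ j).op z : ComposableArrows G (n + 1))
          i' a') = Arrow.mk (conn z (j.succAbove i') (j.succAbove a')) :=
      arrow_mk_conn_comp z _ (fun k l hkl => Fin.succAbove_le_succAbove_iff.1 hkl) i' a'
    rw [← h₁, ← h₁, hj]
  refine functor_eq_of_arrow_mk fun {a b} f => ?_
  rw [arrow_mk_map_eq_conn _ i f, arrow_mk_map_eq_conn _ i f]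
  exact arrow_mk_inv_comp_congr (u := Arrow.mk (conn y i a)) (v := Arrow.mk (conn y i b)) rfl
    (key a) (key b)

end

variable {H : Type u} [Groupoid.{u} H]

lemma composableArrows_one_eq {x y : ComposableArrows G 1}
    (h : Arrow.mk (x.map (homOfLE (Fin.zero_le 1) : (0 : Fin 2) ⟶ 1)) =
      Arrow.mk (y.map (homOfLE (Fin.zero_le 1) : (0 : Fin 2) ⟶ 1))) : x = y :=
  ComposableArrows.ext₁ (congrArg (fun m => m.left) h) (congrArg (fun m => m.right) h) (by
    apply Arrow.mk_injective
    rw [arrow_mk_conj]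
    exact h)

/-- The nerve of an isofibration of groupoids is a Kan fibration. -/
lemma rlp_nerveMap (Q : G ⥤ H) (hQ : ∀ (g : G) (h : H) (w : Q.obj g ⟶ h),
    ∃ (g' : G) (γ : g ⟶ g'), Arrow.mk (Q.map γ) = Arrow.mk w) :
    SSet.modelCategoryQuillen.J.rlp (nerveMap Q) := by
  intro _ _ i hi
  simp only [SSet.modelCategoryQuillen.J, MorphismProperty.iSup_iff] at hi
  obtain ⟨n, ⟨i⟩⟩ := hi
  refine ⟨fun {t v} sq => ?_⟩
  obtain ⟨v, rfl⟩ := SSet.yonedaEquiv.symm.surjective v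
  have hsq (j : Fin (n + 2)) (h : j ≠ i) :
      (nerve H).map (SimplexCategory.δ j).op v =
        (nerveMap Q).app _ (t.app _ (SSet.horn.face i j h)) :=
    (horn_ι_app_face h v).symm.trans
      (congrArg (fun k => k.app _ (SSet.horn.face i j h)) sq.w).symm
  suffices ∃ y : (nerve G) _⦋n + 1⦌, (∀ (j : Fin (n + 2)) (h : j ≠ i),
      (nerve G).map (SimplexCategory.δ j).op y = t.app _ (SSet.horn.face i j h)) ∧
      (nerveMap Q).app _ y = v by
    obtain ⟨y, h₁, h₂⟩ := this
    exact ⟨⟨⟨SSet.yonedaEquiv.symm y, SSet.horn.hom_ext _ _ h₁, by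
      rw [SSet.yonedaEquiv_symm_comp, h₂]⟩⟩⟩
  -- Only one-dimensional horns use the isofibration property, applied to the inverse edge when the
  -- given vertex is the last one. In higher dimensions the extension in `G` exists, and it lies
  -- over `v` by uniqueness in `H`.
  obtain _ | n := n
  · let v' : v.obj 0 ⟶ v.obj 1 := v.map (homOfLE (Fin.zero_le 1) : (0 : Fin 2) ⟶ 1)
    obtain rfl | rfl : i = 0 ∨ i = 1 := by fin_cases i <;> simp
    · let x : ComposableArrows G 0 := t.app _ (SSet.horn.face 0 1 (by decide))
      have e : Q.obj (x.obj 0) = v.obj 0 :=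
        (Functor.congr_obj (hsq 1 (by decide)) (0 : Fin 1)).symm
      obtain ⟨g', γ, hγ⟩ := hQ _ _ (eqToHom e ≫ v')
      refine ⟨ComposableArrows.mk₁ γ, fun j hj => ?_, composableArrows_one_eq ?_⟩
      · obtain rfl : j = 1 := by fin_cases j <;> simp_all
        exact ComposableArrows.ext₀ rfl
      · exact hγ.trans (Arrow.arrow_mk_eqToHom_comp _ _)
    · let x : ComposableArrows G 0 := t.app _ (SSet.horn.face 1 0 (by decide))
      have e : Q.obj (x.obj 0) = v.obj 1 :=
        (Functor.congr_obj (hsq 0 (by decide)) (0 : Fin 1)).symm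
      obtain ⟨g', γ, hγ⟩ := hQ _ _ (eqToHom e ≫ inv v')
      refine ⟨ComposableArrows.mk₁ (inv γ), fun j hj => ?_, composableArrows_one_eq ?_⟩
      · obtain rfl : j = 0 := by fin_cases j <;> simp_all
        exact ComposableArrows.ext₀ rfl
      · have h₁ : Arrow.mk (Q.map (inv γ)) = Arrow.mk (inv (Q.map γ)) :=
          congrArg Arrow.mk (Q.map_inv γ)
        refine h₁.trans ((arrow_mk_inv_congr (hγ.trans (Arrow.arrow_mk_eqToHom_comp _ _))).trans ?_)
        rw [IsIso.inv_inv]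
  · obtain ⟨y, hy⟩ := exists_horn_extension t
    refine ⟨y, hy, horn_extension_unique (i := i) fun j hj => ?_⟩
    refine Eq.trans ?_ (hsq j hj).symm
    refine (NatTrans.naturality_apply (nerveMap Q) _ _).symm.trans ?_
    exact congrArg _ (hy j hj)

end

end MarkedModel

namespace MarkedModel

/-! ### Weak homotopy equivalences -/

section

variable {X Y Z : SSet.{u}}

/-- The inclusion of an end of a cylinder. -/
def cylEnd (W : SSet.{u}) (ε : Fin 2) : W ⟶ W ⊗ Δ[1] where
  app n := ↾fun w => (w, SSet.stdSimplex.const 1 ε n)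

/-- The action of a homotopy on internal homs. -/
noncomputable def homotopyAct (h : X ⊗ Δ[1] ⟶ X) (Z : SSet.{u}) :
    (ihom X).obj Z ⊗ Δ[1] ⟶ (ihom X).obj Z :=
  MonoidalClosed.curry
    ({ app := fun n => ↾fun x => (h.app n (x.1, x.2.2), x.2.1)
       naturality := fun m n f => by
        ext x
        refine Prod.ext ?_ rfl
        exact NatTrans.naturality_apply h f ((x.1, x.2.2) : X.obj m × (Δ[1] : SSet.{u}).obj m) } ≫ (ihom.ev X).app Z)

lemma cylEnd_homotopyAct (h : X ⊗ Δ[1] ⟶ X) (Z : SSet.{u}) (ε : Fin 2) :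
    cylEnd _ ε ≫ homotopyAct h Z = (MonoidalClosed.pre (cylEnd X ε ≫ h)).app Z := by
  apply MonoidalClosed.uncurry_injective
  rw [homotopyAct, MonoidalClosed.uncurry_natural_left, MonoidalClosed.uncurry_curry,
    MonoidalClosed.uncurry_pre]
  rfl

lemma π₀_mk_eq_of_cylinder {W V : SSet.{u}} (Φ : W ⊗ Δ[1] ⟶ V) (w : W _⦋0⦌) :
    SSet.π₀.mk ((cylEnd W 0 ≫ Φ).app _ w) = SSet.π₀.mk ((cylEnd W 1 ≫ Φ).app _ w) := by
  -- The required edge is the image of the degenerate edge at `w` paired with the nondegenerate edge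
  -- of `Δ[1]`.
  let e : (Δ[1] : SSet.{u}) _⦋1⦌ := SSet.stdSimplex.objEquiv.symm (𝟙 _)
  refine SSet.π₀.sound (SSet.Edge.mk (Φ.app _ ((W.σ 0 w, e) : W _⦋1⦌ × (Δ[1] : SSet.{u}) _⦋1⦌))
    ?_ ?_)
  · refine (NatTrans.naturality_apply Φ (SimplexCategory.δ 1).op _).symm.trans
      (congrArg (Φ.app _) (Prod.ext ?_ ?_))
    · exact SSet.δ_comp_σ_succ_apply (i := 0) w
    · ext k
      fin_cases k
      rfl
  · refine (NatTrans.naturality_apply Φ (SimplexCategory.δ 0).op _).symm.trans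
      (congrArg (Φ.app _) (Prod.ext ?_ ?_))
    · exact SSet.δ_comp_σ_self_apply (i := 0) w
    · ext k
      fin_cases k
      rfl

/-- The homotopy `h` acts on the internal homs out of `X`, so precomposition with `f ≫ s` is the
identity on connected components; the other composite is an identity already. -/
lemma isWeakHomotopyEquivalence_of_homotopy {f : X ⟶ Y} (s : Y ⟶ X) (hs : s ≫ f = 𝟙 Y)
    (h : X ⊗ Δ[1] ⟶ X) (h₀ : cylEnd X 0 ≫ h = f ≫ s) (h₁ : cylEnd X 1 ≫ h = 𝟙 X) :
    IsWeakHomotopyEquivalence f := by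
  intro Z _
  refine Function.bijective_iff_has_inverse.2
    ⟨SSet.mapπ₀ ((MonoidalClosed.pre s).app Z), fun x => ?_, fun x => ?_⟩
  · rw [← SSet.mapπ₀_comp_apply, ← NatTrans.comp_app, ← MonoidalClosed.pre_map, hs,
      MonoidalClosed.pre_id]
    exact SSet.mapπ₀_id_apply x
  · rw [← SSet.mapπ₀_comp_apply, ← NatTrans.comp_app, ← MonoidalClosed.pre_map]
    induction x with
    | mk x =>
      have := π₀_mk_eq_of_cylinder (homotopyAct h Z) x
      rw [cylEnd_homotopyAct, cylEnd_homotopyAct, h₀, h₁, MonoidalClosed.pre_id] at this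
      exact this

lemma IsWeakHomotopyEquivalence.comp_iso {f : X ⟶ Y} (hf : IsWeakHomotopyEquivalence f)
    (e : Y ≅ Z) : IsWeakHomotopyEquivalence (f ≫ e.hom) := by
  intro T _
  rw [MonoidalClosed.pre_map]
  have : SSet.mapπ₀ ((MonoidalClosed.pre e.hom ≫ MonoidalClosed.pre f).app T) =
      SSet.mapπ₀ ((MonoidalClosed.pre f).app T) ∘ SSet.mapπ₀ ((MonoidalClosed.pre e.hom).app T) := by
    ext x
    exact SSet.mapπ₀_comp_apply _ _ _
  rw [this]
  refine (hf T).comp (Function.bijective_iff_has_inverse.2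
    ⟨SSet.mapπ₀ ((MonoidalClosed.pre e.inv).app T), fun x => ?_, fun x => ?_⟩)
  · rw [← SSet.mapπ₀_comp_apply, ← NatTrans.comp_app, ← MonoidalClosed.pre_map, e.inv_hom_id,
      MonoidalClosed.pre_id]
    exact SSet.mapπ₀_id_apply x
  · rw [← SSet.mapπ₀_comp_apply, ← NatTrans.comp_app, ← MonoidalClosed.pre_map, e.hom_inv_id,
      MonoidalClosed.pre_id]
    exact SSet.mapπ₀_id_apply x

end

section

variable {G H : Type u} [Category.{u} G] [Category.{u} H]

/-- The homotopy given by a natural transformation. -/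
def nerveHomotopy {F F' : G ⥤ H} (θ : F ⟶ F') : nerve G ⊗ Δ[1] ⟶ nerve H where
  app n := ↾fun x => Functor.prod' (SSet.stdSimplex.asOrderHom x.2).monotone.functor x.1 ⋙
    Functor.uncurry.obj (ComposableArrows.mk₁ θ)

lemma cylEnd_nerveHomotopy_zero {F F' : G ⥤ H} (θ : F ⟶ F') :
    cylEnd _ 0 ≫ nerveHomotopy θ = nerveMap F := by
  ext n x
  refine functor_eq_of_arrow_mk fun {k l} f => ?_
  have h : ((ComposableArrows.mk₁ θ).map (𝟙 (0 : Fin 2))).app (x.obj k) ≫ F.map (x.map f) =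
      F.map (x.map f) := by
    rw [CategoryTheory.Functor.map_id]
    exact Category.id_comp _
  exact congrArg Arrow.mk h

lemma cylEnd_nerveHomotopy_one {F F' : G ⥤ H} (θ : F ⟶ F') :
    cylEnd _ 1 ≫ nerveHomotopy θ = nerveMap F' := by
  ext n x
  refine functor_eq_of_arrow_mk fun {k l} f => ?_
  have h : ((ComposableArrows.mk₁ θ).map (𝟙 (1 : Fin 2))).app (x.obj k) ≫ F'.map (x.map f) =
      F'.map (x.map f) := by
    rw [CategoryTheory.Functor.map_id]
    exact Category.id_comp _
  exact congrArg Arrow.mk h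

/-- The nerve of a surjective equivalence is a weak homotopy equivalence. -/
lemma isWeakHomotopyEquivalence_nerveMap (Q : G ⥤ H) [Q.Full] [Q.Faithful]
    (hQ : Function.Surjective Q.obj) : IsWeakHomotopyEquivalence (nerveMap Q) := by
  choose s hs using hQ
  let S : H ⥤ G := liftFunctor Q (𝟭 H) s hs
  have hS : S ⋙ Q = 𝟭 H := liftFunctor_comp _ _ _ _
  -- As `S` is a strict section of `Q`, both functors become equal after `Q`; the identification
  -- lifts along the fully faithful `Q`.
  let θ : Q ⋙ S ⟶ 𝟭 G := ((Functor.FullyFaithful.ofFullyFaithful Q).whiskeringRight G).preimage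
    (eqToHom (show (Q ⋙ S) ⋙ Q = 𝟭 G ⋙ Q by rw [Functor.assoc, hS]; rfl))
  refine isWeakHomotopyEquivalence_of_homotopy (nerveMap S) ?_ (nerveHomotopy θ)
    (cylEnd_nerveHomotopy_zero θ) (cylEnd_nerveHomotopy_one θ)
  have : nerveMap S ≫ nerveMap Q = nerveMap (S ⋙ Q) := rfl
  rw [this, hS]
  rfl

end

end MarkedModel

namespace MarkedModel

/-! ### Composition with identities up to equality of endpoints -/

section

variable {A : Type*} [Category A] {X Y Z W : A}

lemma arrow_mk_id_comp {f : X ⟶ Y} {g : Y ⟶ W} (h : Arrow.mk f = Arrow.mk (𝟙 Z)) :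
    Arrow.mk (f ≫ g) = Arrow.mk g := by
  cases h
  rw [Category.id_comp]

lemma arrow_mk_comp_id {f : X ⟶ Y} {g : Y ⟶ W} (h : Arrow.mk g = Arrow.mk (𝟙 Z)) :
    Arrow.mk (f ≫ g) = Arrow.mk f := by
  cases h
  rw [Category.comp_id]

end

/-! ### Strict pullbacks of categories -/

section

variable {G₀ G₁ G₂ : Type u} [Category.{u} G₀] [Category.{u} G₁] [Category.{u} G₂]

/-- The strict pullback of two functors. -/
@[ext]
structure SPull (K₁ : G₁ ⥤ G₀) (K₂ : G₂ ⥤ G₀) : Type u where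
  /-- the first component -/
  fst : G₁
  /-- the second component -/
  snd : G₂
  eq : K₁.obj fst = K₂.obj snd

namespace SPull

variable {K₁ : G₁ ⥤ G₀} {K₂ : G₂ ⥤ G₀}

/-- Morphisms in the strict pullback. -/
@[ext]
structure Hom (x y : SPull K₁ K₂) : Type u where
  /-- the first component -/
  fst : x.fst ⟶ y.fst
  /-- the second component -/
  snd : x.snd ⟶ y.snd
  eq : Arrow.mk (K₁.map fst) = Arrow.mk (K₂.map snd)

instance : Category.{u} (SPull K₁ K₂) where
  Hom x y := Hom x y
  id x := ⟨𝟙 _, 𝟙 _, by simpa using arrow_mk_id_congr x.eq⟩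
  comp f g := ⟨f.fst ≫ g.fst, f.snd ≫ g.snd, by
    simpa using arrow_mk_comp_congr f.eq g.eq⟩

/-- The first projection. -/
def π₁ (K₁ : G₁ ⥤ G₀) (K₂ : G₂ ⥤ G₀) : SPull K₁ K₂ ⥤ G₁ where
  obj x := x.fst
  map f := f.fst

/-- The second projection. -/
def π₂ (K₁ : G₁ ⥤ G₀) (K₂ : G₂ ⥤ G₀) : SPull K₁ K₂ ⥤ G₂ where
  obj x := x.snd
  map f := f.snd

lemma condition (K₁ : G₁ ⥤ G₀) (K₂ : G₂ ⥤ G₀) : π₁ K₁ K₂ ⋙ K₁ = π₂ K₁ K₂ ⋙ K₂ :=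
  functor_eq_of_arrow_mk fun f => f.eq

lemma arrow_mk_eq {x y x' y' : SPull K₁ K₂} (f : x ⟶ y) (f' : x' ⟶ y')
    (h₁ : Arrow.mk f.fst = Arrow.mk f'.fst) (h₂ : Arrow.mk f.snd = Arrow.mk f'.snd) :
    Arrow.mk f = Arrow.mk f' := by
  obtain ⟨x₁, x₂, hx⟩ := x
  obtain ⟨y₁, y₂, hy⟩ := y
  obtain ⟨x₁', x₂', hx'⟩ := x'
  obtain ⟨y₁', y₂', hy'⟩ := y'
  obtain ⟨f₁, f₂, hf⟩ := f
  obtain ⟨f₁', f₂', hf'⟩ := f'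
  dsimp at f₁ f₂ f₁' f₂' h₁ h₂
  cases h₁
  cases h₂
  rfl

variable {J : Type*} [Category J]

/-- The universal property of the strict pullback. -/
def lift (F₁ : J ⥤ G₁) (F₂ : J ⥤ G₂) (h : F₁ ⋙ K₁ = F₂ ⋙ K₂) : J ⥤ SPull K₁ K₂ where
  obj j := ⟨F₁.obj j, F₂.obj j, Functor.congr_obj h j⟩
  map f := ⟨F₁.map f, F₂.map f, arrow_mk_functor_congr h f⟩
  map_id j := Hom.ext (F₁.map_id j) (F₂.map_id j)
  map_comp f g := Hom.ext (F₁.map_comp f g) (F₂.map_comp f g)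

lemma functor_ext {F F' : J ⥤ SPull K₁ K₂} (h₁ : F ⋙ π₁ K₁ K₂ = F' ⋙ π₁ K₁ K₂)
    (h₂ : F ⋙ π₂ K₁ K₂ = F' ⋙ π₂ K₁ K₂) : F = F' :=
  functor_eq_of_arrow_mk fun f =>
    arrow_mk_eq _ _ (arrow_mk_functor_congr h₁ f) (arrow_mk_functor_congr h₂ f)

/-- The nerve of a strict pullback is a pullback. -/
lemma isPullback_nerve (K₁ : G₁ ⥤ G₀) (K₂ : G₂ ⥤ G₀) :
    IsPullback (nerveMap (π₁ K₁ K₂)) (nerveMap (π₂ K₁ K₂)) (nerveMap K₁) (nerveMap K₂) where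
  w := by
    ext n x
    exact congrArg (x ⋙ ·) (condition K₁ K₂)
  isLimit' := ⟨PullbackCone.IsLimit.mk _
    (fun s =>
      { app n := ↾fun w => lift (s.fst.app n w) (s.snd.app n w)
          (congrArg (fun k => k.app n w) s.condition)
        naturality n m f := by
          ext w
          refine functor_ext ?_ ?_
          · exact NatTrans.naturality_apply s.fst f w
          · exact NatTrans.naturality_apply s.snd f w })
    (fun s => rfl) (fun s => rfl)
    (fun s k h₁ h₂ => by
      ext n w
      refine functor_ext ?_ ?_
      · exact congrArg (fun k => k.app n w) h₁
      · exact congrArg (fun k => k.app n w) h₂)⟩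

end SPull

end

section

variable {G₀ G₁ G₂ : Type u} [Groupoid.{u} G₀] [Groupoid.{u} G₁] [Groupoid.{u} G₂]

noncomputable instance (K₁ : G₁ ⥤ G₀) (K₂ : G₂ ⥤ G₀) : Groupoid (SPull K₁ K₂) where
  inv f := ⟨inv f.fst, inv f.snd, by
    simpa using arrow_mk_inv_congr f.eq⟩
  inv_comp f := SPull.Hom.ext (IsIso.inv_hom_id _) (IsIso.inv_hom_id _)
  comp_inv f := SPull.Hom.ext (IsIso.hom_inv_id _) (IsIso.hom_inv_id _)

end

/-! ### The pullback-hom map -/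

section

variable {C : Type (u + 1)} [Category.{u} C] [HasMarked C]

lemma MapGpd.arrow_mk_eq {A B : C} {x y x' y' : MapGpd A B} (hx : x = x') (hy : y = y')
    (α : x ⟶ y) (α' : x' ⟶ y')
    (h : ∀ a, Arrow.mk (α.trans.app a) = Arrow.mk (α'.trans.app a)) :
    Arrow.mk α = Arrow.mk α' := by
  subst hx hy
  exact congrArg Arrow.mk (MapGpd.hom_ext_arrow h)

lemma MapGpd.arrow_mk_app_congr {A B : C} {x y x' y' : MapGpd A B}
    {α : x ⟶ y} {α' : x' ⟶ y'} (h : Arrow.mk α = Arrow.mk α') (a : Und A) :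
    Arrow.mk (α.trans.app a) = Arrow.mk (α'.trans.app a) := by
  cases h
  rfl

lemma eHomWhiskerLeft_eq (A : C) {B D : C} (g : B ⟶ D) :
    eHomWhiskerLeft SSet.{u} A g = nerveMap (MapGpd.postcomp A g) := by
  ext n x
  rfl

lemma eHomWhiskerRight_eq {A B : C} (f : A ⟶ B) (D : C) :
    eHomWhiskerRight SSet.{u} f D = nerveMap (MapGpd.precomp f D) := by
  ext n x
  rfl

lemma precomp_postcomp {A B X Y : C} (i : A ⟶ B) (p : X ⟶ Y) :
    MapGpd.precomp i X ⋙ MapGpd.postcomp A p = MapGpd.postcomp B p ⋙ MapGpd.precomp i Y := by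
  refine functor_eq_of_arrow_mk fun {x y} α => MapGpd.arrow_mk_eq (MapGpd.ext (Category.assoc _ _ _))
    (MapGpd.ext (Category.assoc _ _ _)) _ _ fun a => ?_
  exact (MapGpd.arrow_mk_postcomp_map_app _ _ _).trans
    ((arrow_mk_map_congr _ (MapGpd.arrow_mk_precomp_map_app _ _ _)).trans
    ((MapGpd.arrow_mk_precomp_map_app _ _ _).trans (MapGpd.arrow_mk_postcomp_map_app _ _ _)).symm)

/-- The functor of groupoids which corresponds to the pullback-hom map. -/
abbrev pullbackFunctor {A B X Y : C} (i : A ⟶ B) (p : X ⟶ Y) :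
    MapGpd B X ⥤ SPull (MapGpd.postcomp A p) (MapGpd.precomp i Y) :=
  SPull.lift (MapGpd.precomp i X) (MapGpd.postcomp B p) (precomp_postcomp i p)

/-- The nerve sends strict pullbacks to pullbacks. Statements about `pullbackMap` thereby become
statements about a functor of groupoids. -/
lemma exists_pullbackMap_eq {A B X Y : C} (i : A ⟶ B) (p : X ⟶ Y) :
    ∃ e : nerve (SPull (MapGpd.postcomp A p) (MapGpd.precomp i Y)) ≅
      pullback (eHomWhiskerLeft SSet.{u} A p) (eHomWhiskerRight SSet.{u} i Y),
      pullbackMap i p = nerveMap (pullbackFunctor i p) ≫ e.hom := by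
  have sq : IsPullback (nerveMap (SPull.π₁ (MapGpd.postcomp A p) (MapGpd.precomp i Y)))
      (nerveMap (SPull.π₂ (MapGpd.postcomp A p) (MapGpd.precomp i Y)))
      (eHomWhiskerLeft SSet.{u} A p) (eHomWhiskerRight SSet.{u} i Y) := by
    rw [eHomWhiskerLeft_eq, eHomWhiskerRight_eq]
    exact SPull.isPullback_nerve _ _
  refine ⟨sq.isoPullback, pullback.hom_ext ?_ ?_⟩
  · rw [Category.assoc, sq.isoPullback_hom_fst, pullbackMap, pullback.lift_fst,
      eHomWhiskerRight_eq]
    rfl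
  · rw [Category.assoc, sq.isoPullback_hom_snd, pullbackMap, pullback.lift_snd,
      eHomWhiskerLeft_eq]
    rfl

/-- Naturality along a marked isomorphism from the image of `i` to `b` determines the component at
`b`. -/
lemma MapGpd.hom_ext_of_isMarkedEssSurj {A B Y : C} {i : A ⟶ B} (hi : IsMarkedEssSurj i)
    {x y : MapGpd B Y} {γ γ' : x ⟶ y}
    (h : ∀ a, γ.trans.app ((fn i).obj a) = γ'.trans.app ((fn i).obj a)) : γ = γ' := by
  refine MapGpd.hom_ext (NatTrans.ext (funext fun b => ?_))
  obtain ⟨a, w, hw⟩ := hi b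
  have := Marking.isIso_of_marked _ _ (fn_map_marked x.hom _ hw)
  rw [← cancel_epi ((fn x.hom).map w), γ.trans.naturality, γ'.trans.naturality, h]

/-- Objects of the strict pullback are commutative squares from `i` to `p`, and their preimages are
the diagonal lifts. -/
lemma pullbackFunctor_surjective {A B X Y : C} {i : A ⟶ B} {p : X ⟶ Y}
    (h : HasLiftingProperty i p) : Function.Surjective (pullbackFunctor i p).obj := by
  rintro ⟨⟨x⟩, ⟨v⟩, e⟩
  have sq : CommSq x i p v := ⟨congrArg MapGpd.hom e⟩
  exact ⟨⟨sq.lift⟩, SPull.ext (MapGpd.ext sq.fac_left) (MapGpd.ext sq.fac_right)⟩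

lemma pullbackFunctor_full_of_right {A B X Y : C} (i : A ⟶ B) {p : X ⟶ Y}
    (hp : IsFullyFaithful p) :
    (pullbackFunctor i p).Full ∧ (pullbackFunctor i p).Faithful := by
  refine ⟨⟨fun {x y} ⟨α, β, hαβ⟩ => ?_⟩, ⟨fun {x y f g} hfg => ?_⟩⟩
  · obtain ⟨η, hη⟩ := hp.exists_postcomp_map_eq β
    refine ⟨η, SPull.Hom.ext (postcomp_map_injective hp.faithful ?_) hη⟩
    have := arrow_mk_functor_congr (precomp_postcomp i p) η
    refine Arrow.mk_injective _ _ (this.trans (Eq.trans ?_ hαβ.symm))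
    exact congrArg (fun t => Arrow.mk ((MapGpd.precomp i Y).map t)) hη
  · exact postcomp_map_injective hp.faithful (congrArg SPull.Hom.snd hfg)

lemma MapGpd.eq_of_precomp_map_eq {A B Y : C} {i : A ⟶ B} (hi : IsMarkedEssSurj i)
    {x y : MapGpd B Y} {γ γ' : x ⟶ y}
    (h : (MapGpd.precomp i Y).map γ = (MapGpd.precomp i Y).map γ') : γ = γ' := by
  refine MapGpd.hom_ext_of_isMarkedEssSurj hi fun a => Arrow.mk_injective _ _ ?_
  rw [← MapGpd.arrow_mk_precomp_map_app, ← MapGpd.arrow_mk_precomp_map_app, h]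

variable [MarkedTheory C]

/-- The homotopy is prescribed by `α` on the image of `i`, unambiguously because `i` is injective on
objects; elsewhere the components of `β` are lifted along `p`. -/
lemma pullbackFunctor_isofibration {A B X Y : C} {i : A ⟶ B} {p : X ⟶ Y} (hi : cofibrations C i)
    (hp : markedIsofibrations C p) (g : MapGpd B X)
    (h : SPull (MapGpd.postcomp A p) (MapGpd.precomp i Y)) (w : (pullbackFunctor i p).obj g ⟶ h) :
    ∃ (g' : MapGpd B X) (γ : g ⟶ g'), Arrow.mk ((pullbackFunctor i p).map γ) = Arrow.mk w := by
  obtain ⟨x, ⟨v⟩, e⟩ := h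
  obtain ⟨α, β, hαβ⟩ := w
  dsimp only at α β
  rw [markedIsofibrations_iff] at hp
  have hαβ' (a : Und A) : Arrow.mk ((fn p).map (α.trans.app a)) =
      Arrow.mk (β.trans.app ((fn i).obj a)) :=
    (MapGpd.arrow_mk_postcomp_map_app _ _ _).symm.trans
      ((MapGpd.arrow_mk_app_congr hαβ a).trans (MapGpd.arrow_mk_precomp_map_app _ _ _))
  have key (b : Und B) : ∃ (x : Und X) (w : (fn g.hom).obj b ⟶ x), IsMarked X w ∧
      Arrow.mk ((fn p).map w) = Arrow.mk (β.trans.app b) ∧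
      ∀ a, (fn i).obj a = b → Arrow.mk w = Arrow.mk (α.trans.app a) := by
    by_cases hb : ∃ a, (fn i).obj a = b
    · obtain ⟨a, rfl⟩ := hb
      refine ⟨_, eqToHom (fn_comp_obj i g.hom a).symm ≫ α.trans.app a,
        Marking.comp_mem _ _ _ (Marking.marked_eqToHom _ _) (α.marked a), ?_, fun a' ha' => ?_⟩
      · exact (arrow_mk_map_congr _ (Arrow.arrow_mk_eqToHom_comp _ _)).trans (hαβ' a)
      · obtain rfl := hi ha'
        exact Arrow.arrow_mk_eqToHom_comp _ _
    · obtain ⟨x, w, hw, hw'⟩ := hp _ _ (eqToHom (fn_comp_obj g.hom p b).symm ≫ β.trans.app b)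
        (Marking.comp_mem _ _ _ (Marking.marked_eqToHom _ _) (β.marked b))
      exact ⟨x, w, hw, hw'.trans (Arrow.arrow_mk_eqToHom_comp _ _), fun a ha => (hb ⟨a, ha⟩).elim⟩
  choose y w hw hwβ hwα using key
  obtain ⟨h, η, hh, hη⟩ := exists_lift_of_family p g.hom v β y w hw hwβ
  have h₁ (a : Und A) : Arrow.mk (((MapGpd.precomp i X).map η).trans.app a) =
      Arrow.mk (α.trans.app a) :=
    (MapGpd.arrow_mk_precomp_map_app _ _ _).trans ((hη _).trans (hwα _ a rfl))
  have h₂ (b : Und B) : Arrow.mk (((MapGpd.postcomp B p).map η).trans.app b) =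
      Arrow.mk (β.trans.app b) :=
    (MapGpd.arrow_mk_postcomp_map_app _ _ _).trans ((arrow_mk_map_congr _ (hη _)).trans (hwβ b))
  refine ⟨⟨h⟩, η, SPull.arrow_mk_eq _ _ ?_ ?_⟩
  · exact MapGpd.arrow_mk_eq rfl (MapGpd.eq_of_arrow_mk_app _ _ h₁) _ _ h₁
  · exact MapGpd.arrow_mk_eq rfl (MapGpd.eq_of_arrow_mk_app _ _ h₂) _ _ h₂

lemma fibrations_pullbackMap {A B X Y : C} {i : A ⟶ B} {p : X ⟶ Y} (hi : cofibrations C i)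
    (hp : fibrations C p) : SSet.modelCategoryQuillen.J.rlp (pullbackMap i p) := by
  obtain ⟨e, he⟩ := exists_pullbackMap_eq i p
  rw [he]
  exact MorphismProperty.RespectsIso.postcomp _ _ _
    (rlp_nerveMap _ (pullbackFunctor_isofibration hi (fibrations_le_markedIsofibrations _ hp)))

/-- A homotopy on `A` is pulled back along a deformation retraction `g` and then conjugated by the
homotopies `c`, which are constant on the image of `i`. -/
lemma exists_precomp_map_eq {A B X : C} {i : A ⟶ B} (hi : trivialCofibrations C i)
    {x y : MapGpd B X} (α : (MapGpd.precomp i X).obj x ⟶ (MapGpd.precomp i X).obj y) :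
    ∃ η : x ⟶ y, (MapGpd.precomp i X).map η = α := by
  obtain ⟨g, β, hg, hβ⟩ := exists_deformationRetraction hi
  have e (z : MapGpd B X) : (MapGpd.precomp g X).obj ((MapGpd.precomp i X).obj z) =
      (MapGpd.postcomp B z.hom).obj ⟨g ≫ i⟩ := MapGpd.ext (Category.assoc _ _ _).symm
  have e' (z : MapGpd B X) : (MapGpd.postcomp B z.hom).obj ⟨𝟙 B⟩ = z :=
    MapGpd.ext (Category.id_comp _)
  let c (z : MapGpd B X) : (MapGpd.precomp g X).obj ((MapGpd.precomp i X).obj z) ⟶ z :=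
    eqToHom (e z) ≫ (MapGpd.postcomp B z.hom).map β ≫ eqToHom (e' z)
  have hc (z : MapGpd B X) (a : Und A) : Arrow.mk ((c z).trans.app ((fn i).obj a)) =
      Arrow.mk (𝟙 ((fn z.hom).obj ((fn i).obj a))) := by
    refine (MapGpd.arrow_mk_eqToHom_comp_app _ _ _).trans
      ((MapGpd.arrow_mk_comp_eqToHom_app _ _ _).trans
      ((MapGpd.arrow_mk_postcomp_map_app _ _ _).trans ?_))
    exact (arrow_mk_map_congr _ (hβ a)).trans
      (congrArg Arrow.mk (CategoryTheory.Functor.map_id _ _))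
  have hg' (a : Und A) : (fn g).obj ((fn i).obj a) = a := by
    rw [← fn_comp_obj, hg, fn_id_obj]
  have hη : c x ≫ inv (c x) ≫ (MapGpd.precomp g X).map α ≫ c y =
      (MapGpd.precomp g X).map α ≫ c y := by rw [IsIso.hom_inv_id_assoc]
  refine ⟨inv (c x) ≫ (MapGpd.precomp g X).map α ≫ c y, MapGpd.hom_ext_arrow fun a => ?_⟩
  refine (MapGpd.arrow_mk_precomp_map_app _ _ _).trans ((arrow_mk_id_comp (hc x a)).symm.trans ?_)
  refine (congrArg (fun t => Arrow.mk (t.trans.app ((fn i).obj a))) hη).trans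
    ((arrow_mk_comp_id (hc y a)).trans ?_)
  exact (MapGpd.arrow_mk_precomp_map_app _ _ _).trans (arrow_mk_app_congr _ (hg' a))

lemma pullbackFunctor_full_of_left {A B X Y : C} {i : A ⟶ B} (p : X ⟶ Y)
    (hi : trivialCofibrations C i) :
    (pullbackFunctor i p).Full ∧ (pullbackFunctor i p).Faithful := by
  have hi' := isMarkedEssSurj_of_weakEquivalences hi.2
  refine ⟨⟨fun {x y} ⟨α, β, hαβ⟩ => ?_⟩, ⟨fun {x y f g} hfg => ?_⟩⟩
  · obtain ⟨η, hη⟩ := exists_precomp_map_eq hi α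
    refine ⟨η, SPull.Hom.ext hη (MapGpd.eq_of_precomp_map_eq hi' ?_)⟩
    have := arrow_mk_functor_congr (precomp_postcomp i p) η
    refine Arrow.mk_injective _ _ (this.symm.trans (Eq.trans ?_ hαβ))
    exact congrArg (fun t => Arrow.mk ((MapGpd.postcomp A p).map t)) hη
  · exact MapGpd.eq_of_precomp_map_eq hi' (congrArg SPull.Hom.fst hfg)

lemma isWeakHomotopyEquivalence_pullbackMap {A B X Y : C} {i : A ⟶ B} {p : X ⟶ Y}
    (hi : cofibrations C i) (hp : fibrations C p)
    (h : weakEquivalences C i ∨ weakEquivalences C p) :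
    IsWeakHomotopyEquivalence (pullbackMap i p) := by
  obtain ⟨e, he⟩ := exists_pullbackMap_eq i p
  rw [he]
  apply IsWeakHomotopyEquivalence.comp_iso
  obtain h | h := h
  · obtain ⟨_, _⟩ := pullbackFunctor_full_of_left p ⟨hi, h⟩
    exact isWeakHomotopyEquivalence_nerveMap _ (pullbackFunctor_surjective (hp i ⟨hi, h⟩))
  · obtain ⟨h₁, h₂⟩ := (trivialFibrations_iff p).1 ⟨hp, h⟩
    obtain ⟨_, _⟩ := pullbackFunctor_full_of_right i h₁
    refine isWeakHomotopyEquivalence_nerveMap _ (pullbackFunctor_surjective ⟨fun {t v} sq => ?_⟩)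
    obtain ⟨k, h₃, h₄⟩ := exists_lift_of_isFullyFaithful hi h₁ h₂ t v sq.w
    exact ⟨⟨⟨k, h₃, h₄⟩⟩⟩

end

end MarkedModel

namespace MarkedModel

/-! ### Nerves of functor categories -/

/-- The diagonal of a functor in two variables along a functor. -/
def diag {J K G : Type*} [Category J] [Category K] [Category G] (x : J ⥤ K ⥤ G) (θ : J ⥤ K) :
    J ⥤ G :=
  Functor.prod' (𝟭 J) θ ⋙ Functor.uncurry.obj x

/-- The functor between finite linear orders given by a simplex of a standard simplex. -/
abbrev simplexFunctor {n : ℕ} {m : SimplexCategoryᵒᵖ} (θ : (Δ[n] : SSet.{u}).obj m) :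
    Fin (m.unop.len + 1) ⥤ Fin (n + 1) :=
  (SSet.stdSimplex.asOrderHom θ).monotone.functor

section

variable {G : Type u} [Category.{u} G] {K : SSet.{u}} {n : ℕ}

lemma exists_nerveMap_eq {P : Type u} [Category.{u} P] (φ : nerve P ⟶ nerve G) :
    ∃ F : P ⥤ G, nerveMap F = φ := by
  obtain ⟨F, hF⟩ := nerveFunctor.map_surjective (X := Cat.of P) (Y := Cat.of G) φ
  exact ⟨F.toFunctor, hF⟩

lemma nerveMap_injective {P : Type u} [Category.{u} P] {F F' : P ⥤ G}
    (h : nerveMap F = nerveMap F') : F = F' :=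
  congrArg Cat.Hom.toFunctor
    (nerveFunctor.map_injective (X := Cat.of P) (Y := Cat.of G) (a₁ := F.toCatHom)
      (a₂ := F'.toCatHom) h)

/-- The product of finite linear orders in a universe. -/
abbrev Grid (m n : ℕ) : Type u := ULift.{u} (Fin (m + 1) × Fin (n + 1))

/-- The map from the nerve of a grid which corresponds to a simplex. -/
def gridMap (z : K ⊗ Δ[n] ⟶ nerve G) {m : ℕ} (k : K _⦋m⦌) :
    nerve (Grid.{u} m n) ⟶ nerve G :=
  (SSet.prodStdSimplex.isoNerve m n).inv ≫ SSet.yonedaEquiv.symm k ▷ _ ≫ z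

/-- The functor from a grid which corresponds to a simplex. -/
noncomputable def gridFunctor (z : K ⊗ Δ[n] ⟶ nerve G) {m : ℕ} (k : K _⦋m⦌) :
    Grid.{u} m n ⥤ G :=
  (exists_nerveMap_eq (gridMap z k)).choose

lemma nerveMap_gridFunctor (z : K ⊗ Δ[n] ⟶ nerve G) {m : ℕ} (k : K _⦋m⦌) :
    nerveMap (gridFunctor z k) = gridMap z k :=
  (exists_nerveMap_eq (gridMap z k)).choose_spec

/-- The inclusion of a product of linear orders. -/
def gridIncl (m n : ℕ) : Fin (m + 1) × Fin (n + 1) ⥤ Grid.{u} m n where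
  obj x := ⟨x⟩
  map f := homOfLE ⟨leOfHom f.1, leOfHom f.2⟩

/-- The functoriality of grids. -/
def gridHom {m m' : ℕ} (f : ⦋m'⦌ ⟶ ⦋m⦌) (n : ℕ) : Grid.{u} m' n ⥤ Grid.{u} m n :=
  Monotone.functor (f := fun x => ULift.up (f.toOrderHom x.down.1, x.down.2))
    fun _ _ h => ⟨f.toOrderHom.monotone h.1, h.2⟩

lemma gridFunctor_map (z : K ⊗ Δ[n] ⟶ nerve G) {m m' : ℕ} (f : ⦋m'⦌ ⟶ ⦋m⦌) (k : K _⦋m⦌) :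
    gridFunctor z (K.map f.op k) = gridHom f n ⋙ gridFunctor z k := by
  apply nerveMap_injective
  have : nerveMap (gridHom f n ⋙ gridFunctor z k) =
    nerveMap (gridHom f n) ≫ nerveMap (gridFunctor z k) := rfl
  rw [this, nerveMap_gridFunctor, nerveMap_gridFunctor]
  ext p s
  refine congrArg (z.app p) (Prod.ext ?_ rfl)
  exact (Functor.map_comp_apply K _ _ k).symm

/-- A simplex of `K` restricts `z` to a product of two standard simplices, which is the nerve of a
grid. Fullness of the nerve functor turns the restriction into a functor of two variables, and
faithfulness makes these functors compatible. -/
lemma exists_nerve_curry (z : K ⊗ Δ[n] ⟶ nerve G) :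
    ∃ t : K ⟶ nerve (Fin (n + 1) ⥤ G), ∀ (m : SimplexCategoryᵒᵖ) (k : K.obj m)
      (θ : (Δ[n] : SSet.{u}).obj m), diag (t.app m k) (simplexFunctor θ) = z.app m (k, θ) := by
  refine ⟨{ app m := ↾fun k => Functor.curry.obj (gridIncl.{u} _ n ⋙ gridFunctor z (m := m.unop.len) k)
            naturality m m' f := ?_ }, fun m k θ => ?_⟩
  · ext k
    exact congrArg (fun F => Functor.curry.obj (gridIncl.{u} _ n ⋙ F))
      (gridFunctor_map z (m := m.unop.len) (m' := m'.unop.len) f.unop k)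
  · obtain ⟨⟨m⟩⟩ := m
    let s : (nerve (Grid.{u} m n)).obj (op ⦋m⦌) :=
      Functor.prod' (𝟭 _) (simplexFunctor θ) ⋙ gridIncl m n
    refine (congrArg (Functor.prod' (𝟭 _) (simplexFunctor θ) ⋙ ·)
      (Functor.uncurry_obj_curry_obj _)).trans ?_
    refine (congrArg (fun φ => φ.app (op ⦋m⦌) s) (nerveMap_gridFunctor z (m := m) k)).trans ?_
    refine congrArg (z.app (op ⦋m⦌)) (Prod.ext ?_ ?_)
    · exact Functor.map_id_apply K _ k
    · ext i
      rfl

/-- Each arrow of the product of two linear orders is the diagonal of a pair of edges, one of them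
coming from an edge of `K`. -/
lemma nerve_curry_unique {t t' : K ⟶ nerve (Fin (n + 1) ⥤ G)}
    (h : ∀ (m : SimplexCategoryᵒᵖ) (k : K.obj m) (θ : (Δ[n] : SSet.{u}).obj m),
      diag (t.app m k) (simplexFunctor θ) = diag (t'.app m k) (simplexFunctor θ)) : t = t' := by
  ext m k
  refine Functor.uncurry_obj_injective (functor_eq_of_arrow_mk ?_)
  rintro ⟨l, j⟩ ⟨l', j'⟩ ⟨f, g⟩
  let α : ⦋1⦌ ⟶ m.unop := SimplexCategory.mkOfLe l l' (leOfHom f)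
  let θ : (Δ[n] : SSet.{u}).obj (op ⦋1⦌) := SSet.stdSimplex.objEquiv.symm
    (SimplexCategory.mkOfLe j j' (leOfHom g))
  have := arrow_mk_functor_congr (h _ (K.map α.op k) θ) (homOfLE (Fin.zero_le 1) : (0 : Fin 2) ⟶ 1)
  have h₁ (t : K ⟶ nerve (Fin (n + 1) ⥤ G)) :
      Arrow.mk ((diag (t.app _ (K.map α.op k)) (simplexFunctor θ)).map
        (homOfLE (Fin.zero_le 1) : (0 : Fin 2) ⟶ 1)) =
      Arrow.mk ((Functor.uncurry.obj (t.app m k)).map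
        ((f, g) : ((l, j) : Fin (m.unop.len + 1) × Fin (n + 1)) ⟶ (l', j'))) :=
    arrow_mk_functor_congr (congrArg (diag · (simplexFunctor θ))
      (NatTrans.naturality_apply t α.op k)) _
  exact (h₁ t).symm.trans (this.trans (h₁ t'))

end

/-! ### Isomorphisms of categories -/

section

variable {X G : Type*} [Category X]

/-- A functor to a functor category of a groupoid is fully faithful if this holds after
evaluation at one object to which all objects are connected. -/
lemma full_faithful_of_eval {J : Type*} [Category J] [Groupoid G] (Ψ : X ⥤ J ⥤ G) (j₀ : J)
    (hj : ∀ j, Nonempty (j₀ ⟶ j))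
    (hfull : (Ψ ⋙ (evaluation J G).obj j₀).Full)
    (hfaith : (Ψ ⋙ (evaluation J G).obj j₀).Faithful) : Ψ.Full ∧ Ψ.Faithful := by
  refine ⟨⟨fun {x y} δ => ?_⟩, Functor.Faithful.of_comp Ψ ((evaluation J G).obj j₀)⟩
  obtain ⟨γ, hγ⟩ := (Ψ ⋙ (evaluation J G).obj j₀).map_surjective (δ.app j₀)
  refine ⟨γ, ?_⟩
  ext j
  obtain ⟨f⟩ := hj j
  rw [← cancel_epi ((Ψ.obj x).map f), NatTrans.naturality, NatTrans.naturality]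
  exact congrArg (· ≫ _) hγ

lemma exists_inverse_functor [Category G] (Ψ : X ⥤ G) [Ψ.Full] [Ψ.Faithful]
    (h : Function.Bijective Ψ.obj) : ∃ Θ : G ⥤ X, Θ ⋙ Ψ = 𝟭 G ∧ Ψ ⋙ Θ = 𝟭 X := by
  choose s hs using h.2
  have h₁ : liftFunctor Ψ (𝟭 G) s hs ⋙ Ψ = 𝟭 G := liftFunctor_comp _ _ _ _
  refine ⟨liftFunctor Ψ (𝟭 G) s hs, h₁, functor_eq_of_comp_faithful Ψ ?_ fun x => h.1 (hs _)⟩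
  rw [Functor.assoc, h₁]
  rfl

end

end MarkedModel

namespace MarkedModel

/-! ### Tensors and cotensors with standard simplices -/

section

variable {C : Type (u + 1)} [Category.{u} C] [HasMarked C] {J K : Type} [Category.{0} J]
  [Category.{0} K]

/-- Composition with a diagram of morphisms from the right. -/
def preMap (A : C) {B D : C} (ε : J ⥤ MapGpd D B) : MapGpd A D ⥤ J ⥤ MapGpd A B :=
  Functor.curry.obj (compFunctor A D B) ⋙ (Functor.whiskeringLeft _ _ _).obj ε

/-- Composition with a diagram of morphisms from the left. -/
def postMap {A D : C} (ε : J ⥤ MapGpd A D) (B : C) : MapGpd D B ⥤ J ⥤ MapGpd A B :=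
  (Functor.curry.obj (compFunctor A D B)).flip ⋙ (Functor.whiskeringLeft _ _ _).obj ε

lemma diag_preMap {A B D : C} (ε : J ⥤ MapGpd D B) (x : K ⥤ MapGpd A D) (θ : K ⥤ J) :
    diag (x ⋙ preMap A ε) θ = Functor.prod' x (θ ⋙ ε) ⋙ compFunctor A D B := by
  refine functor_eq_of_arrow_mk fun f => congrArg Arrow.mk ?_
  simp [diag, preMap, ← Functor.map_comp]

lemma diag_postMap {A B D : C} (ε : J ⥤ MapGpd A D) (x : K ⥤ MapGpd D B) (θ : K ⥤ J) :
    diag (x ⋙ postMap ε B) θ = Functor.prod' (θ ⋙ ε) x ⋙ compFunctor A D B := by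
  refine functor_eq_of_arrow_mk fun f => congrArg Arrow.mk ?_
  simp [diag, postMap, ← Functor.map_comp]

lemma preMap_obj_congr_app {A B D : C} {ε : J ⥤ MapGpd D B} {g : MapGpd A D}
    {x : J ⥤ MapGpd A B} (h : (preMap A ε).obj g = x) {j j' : J} (f : j ⟶ j') (a : Und A) :
    Arrow.mk ((ε.map f).trans.app ((fn g.hom).obj a)) = Arrow.mk ((x.map f).trans.app a) :=
  (MapGpd.arrow_mk_precomp_map_app g.hom (ε.map f) a).symm.trans
    (MapGpd.arrow_mk_app_congr (arrow_mk_functor_congr h f) a)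

lemma arrow_mk_eq_of_comp_eq {A : Type*} [Category A] {X Y Z X' Y' Z' : A} {f : X ⟶ Y} [IsIso f]
    {g : Y ⟶ Z} {f' : X' ⟶ Y'} {g' : Y' ⟶ Z'} (h : Arrow.mk f = Arrow.mk f')
    (h' : Arrow.mk (f ≫ g) = Arrow.mk (f' ≫ g')) : Arrow.mk g = Arrow.mk g' := by
  cases h
  obtain rfl : Z = Z' := congrArg (fun m => m.right) h'
  have := Arrow.mk_injective _ _ h'
  rw [cancel_epi] at this
  rw [this]

variable [MarkedTheory C]

/-- The objects of the cotensor with a simplex: diagrams of marked morphisms. -/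
abbrev simplexCotensorObj (B : C) (n : ℕ) : Type u :=
  { F : Fin (n + 1) ⥤ Und B // ∀ {k l : Fin (n + 1)} (f : k ⟶ l), IsMarked B (F.map f) }

/-- The cotensor with `Δ[n]`: its objects are chains `F` of `n` marked morphisms of `B`, and its
morphisms are those of `B` between the initial terms, since a transformation of such chains is
determined by its component at `0`. The diagram `ε` consists of the evaluations. -/
lemma exists_simplex_cotensor (B : C) (n : ℕ) :
    ∃ (D : C) (ε : Fin (n + 1) ⥤ MapGpd D B), ∀ A : C, (preMap A ε).Full ∧
      (preMap A ε).Faithful ∧ Function.Bijective (preMap A ε).obj := by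
  let T (F : simplexCotensorObj B n) : Und B := F.1.obj 0
  -- Evaluation at `k` is the projection moved along the morphisms `F 0 ⟶ F k`.
  have key (k : Fin (n + 1)) : ∃ (g : ind B T ⟶ B) (η : (⟨ind.π T⟩ : MapGpd _ B) ⟶ ⟨g⟩),
      ∀ F, Arrow.mk (η.trans.app (ind.e T F)) = Arrow.mk (F.1.map (homOfLE (Fin.zero_le k))) := by
    obtain ⟨g, η, -, hη⟩ := exists_homotopy_of_family (ind.π T)
      (fun z => ((ind.e T).symm z).1.obj k)
      (fun z => eqToHom (ind.π_obj' T z) ≫ ((ind.e T).symm z).1.map (homOfLE (Fin.zero_le k)))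
      (fun z => Marking.comp_mem _ _ _ (Marking.marked_eqToHom _ _) (((ind.e T).symm z).2 _))
    refine ⟨g, η, fun F => (hη _).trans ?_⟩
    rw [Arrow.arrow_mk_eqToHom_comp, Equiv.symm_apply_apply]
  choose g η hη using key
  let ε : Fin (n + 1) ⥤ MapGpd (ind B T) B :=
    { obj k := ⟨g k⟩
      map {k l} _ := inv (η k) ≫ η l
      map_id k := by simp
      map_comp _ _ := by simp }
  have hηε {k l : Fin (n + 1)} (f : k ⟶ l) : η k ≫ ε.map f = η l := by simp [ε]
  have hε {k l : Fin (n + 1)} (f : k ⟶ l) (F : simplexCotensorObj B n) :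
      Arrow.mk ((ε.map f).trans.app (ind.e T F)) = Arrow.mk (F.1.map f) := by
    have := MapGpd.isIso_trans_app (η k) (ind.e T F)
    refine arrow_mk_eq_of_comp_eq (hη k F) ?_
    have h₁ : (η k).trans.app (ind.e T F) ≫ (ε.map f).trans.app (ind.e T F) =
        (η l).trans.app (ind.e T F) :=
      congrArg (fun t => t.trans.app (ind.e T F)) (hηε f)
    rw [h₁, hη, ← F.1.map_comp]
    rfl
  -- Each evaluation is homotopic to the projection, which is a weak equivalence.
  have hg (k : Fin (n + 1)) : IsFullyFaithful (g k) := by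
    have h₁ : weakEquivalences C (ind.π T) :=
      (trivialFibrations_of_isFullyFaithful (ind.isFullyFaithful T) fun b =>
        ⟨ind.e T ⟨(Functor.const _).obj b, fun _ => Marking.id_mem _ _⟩, ind.π_obj _ _⟩).2
    apply isFullyFaithful_of_weakEquivalences
    rw [weakEquivalences_eq] at h₁ ⊢
    have : (Quotient.functor (homotopyRel C)).map (ind.π T) =
      (Quotient.functor (homotopyRel C)).map (g k) := CategoryTheory.Quotient.sound _ ⟨η k⟩
    rwa [MorphismProperty.inverseImage_iff, ← this]
  have hff (A : C) : (preMap A ε).Full ∧ (preMap A ε).Faithful :=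
    full_faithful_of_eval _ 0 (fun k => ⟨homOfLE (Fin.zero_le k)⟩)
      ⟨fun γ => (hg 0).exists_postcomp_map_eq γ⟩ ⟨fun h => postcomp_map_injective (hg 0).faithful h⟩
  refine ⟨ind B T, ε, fun A => ⟨(hff A).1, (hff A).2, fun x y hxy => ?_, fun x => ?_⟩⟩
  · refine MapGpd.ext (hom_ext_of_faithful (g 0) (hg 0).faithful
      (congrArg MapGpd.hom (Functor.congr_obj hxy 0)) fun a => ?_)
    obtain ⟨F, hF⟩ := (ind.e T).surjective ((fn x.hom).obj a)
    obtain ⟨F', hF'⟩ := (ind.e T).surjective ((fn y.hom).obj a)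
    rw [← hF, ← hF']
    -- The chain `F` is recovered from the components of the diagram `ε` at the corresponding
    -- object.
    refine congrArg _ (Subtype.ext (functor_eq_of_arrow_mk fun f => ?_))
    refine (hε f F).symm.trans (Eq.trans ?_ (hε f F'))
    rw [hF, hF', preMap_obj_congr_app hxy, ← preMap_obj_congr_app rfl]
  · let F (a : Und A) : simplexCotensorObj B n :=
      ⟨{ obj k := (fn (x.obj k).hom).obj a
         map f := (x.map f).trans.app a
         map_id k := by rw [CategoryTheory.Functor.map_id]; rfl
         map_comp f f' := by rw [Functor.map_comp]; rfl }, fun f => (x.map f).marked a⟩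
    let h : A ⟶ ind B T := ind.lift (x.obj 0).hom F fun a => rfl
    have hh (a : Und A) : (fn h).obj a = ind.e T (F a) := ind.lift_obj _ _ _ _
    have e₀ : (MapGpd.precomp h B).obj ⟨ind.π T⟩ = x.obj 0 := MapGpd.ext (ind.lift_π _ _ _)
    have e (k : Fin (n + 1)) : (MapGpd.precomp h B).obj ⟨g k⟩ = x.obj k := by
      refine MapGpd.eq_of_arrow_mk_app ((MapGpd.precomp h B).map (η k))
        (eqToHom e₀ ≫ x.map (homOfLE (Fin.zero_le k))) fun a => ?_
      refine (MapGpd.arrow_mk_precomp_map_app _ _ _).trans ((arrow_mk_app_congr _ (hh a)).trans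
        ((hη k _).trans (MapGpd.arrow_mk_eqToHom_comp_app _ _ _).symm))
    refine ⟨⟨h⟩, functor_eq_of_arrow_mk fun f => ?_⟩
    refine MapGpd.arrow_mk_eq (e _) (e _) _ _ fun a => ?_
    exact (MapGpd.arrow_mk_precomp_map_app _ _ _).trans ((arrow_mk_app_congr _ (hh a)).trans
      (hε f _))

/-- The tensor with `Δ[n]`: objects are pairs of an object of `A` and a vertex, and morphisms are
those of `A` between first components. The diagram `ε` consists of the inclusions `ι k`, all of them
sections of the projection. -/
lemma exists_simplex_tensor (A : C) (n : ℕ) :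
    ∃ (D : C) (ε : Fin (n + 1) ⥤ MapGpd A D), ∀ B : C, (postMap ε B).Full ∧
      (postMap ε B).Faithful ∧ Function.Bijective (postMap ε B).obj := by
  let T : Und A × Fin (n + 1) → Und A := Prod.fst
  have hπ : weakEquivalences C (ind.π T) :=
    (trivialFibrations_of_isFullyFaithful (ind.isFullyFaithful T) fun a =>
      ⟨ind.e T (a, 0), ind.π_obj _ _⟩).2
  let ι (k : Fin (n + 1)) : A ⟶ ind A T := ind.lift (𝟙 A) (fun a => (a, k))
    (fun a => (fn_id_obj a).symm)
  have hι (k : Fin (n + 1)) : ι k ≫ ind.π T = 𝟙 A := ind.lift_π _ _ _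
  have hιo (k : Fin (n + 1)) (a : Und A) : (fn (ι k)).obj a = ind.e T (a, k) :=
    ind.lift_obj _ _ _ _
  have hιt (k : Fin (n + 1)) : trivialCofibrations C (ι k) :=
    ⟨fn_obj_injective_of_comp_eq_id (hι k), (weakEquivalences C).of_postcomp _ _ hπ (by
      rw [hι, weakEquivalences_eq]
      exact MorphismProperty.id_mem _ _)⟩
  have hι' (k l : Fin (n + 1)) : (MapGpd.postcomp A (ind.π T)).obj ⟨ι k⟩ =
      (MapGpd.postcomp A (ind.π T)).obj ⟨ι l⟩ := MapGpd.ext ((hι k).trans (hι l).symm)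
  -- The transition from `ι k` to `ι l` lies over the identity of `A`; faithfulness of the
  -- projection makes these transitions compose.
  choose δ hδ using fun k l => (ind.isFullyFaithful T).exists_postcomp_map_eq (x := ⟨ι k⟩)
    (y := ⟨ι l⟩) (eqToHom (hι' k l))
  let ε : Fin (n + 1) ⥤ MapGpd A (ind A T) :=
    { obj k := ⟨ι k⟩
      map {k l} _ := δ k l
      map_id k := postcomp_map_injective (ind.isFullyFaithful T).faithful (by
        rw [hδ, CategoryTheory.Functor.map_id, eqToHom_refl])
      map_comp _ _ := postcomp_map_injective (ind.isFullyFaithful T).faithful (by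
        rw [hδ, Functor.map_comp, hδ, hδ, eqToHom_trans]) }
  have hff (B : C) : (postMap ε B).Full ∧ (postMap ε B).Faithful :=
    full_faithful_of_eval _ 0 (fun k => ⟨homOfLE (Fin.zero_le k)⟩)
      ⟨fun γ => exists_precomp_map_eq (hιt 0) γ⟩
      ⟨fun h => MapGpd.eq_of_precomp_map_eq (isMarkedEssSurj_of_weakEquivalences (hιt 0).2) h⟩
  refine ⟨ind A T, ε, fun B => ⟨(hff B).1, (hff B).2, fun x y hxy => ?_, fun x => ?_⟩⟩
  · have := (hff B).1
    -- Fullness turns the equality of the diagrams into an isomorphism from `x` to `y`; its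
    -- components at all pairs are identities, whence `x = y`.
    obtain ⟨γ, hγ⟩ := (postMap ε B).map_surjective (eqToHom hxy)
    refine (MapGpd.eq_of_arrow_mk_app γ (𝟙 x) fun d => ?_).symm
    obtain ⟨⟨a, k⟩, rfl⟩ := (ind.e T).surjective d
    have h₁ : (MapGpd.precomp (ι k) B).map γ = eqToHom (Functor.congr_obj hxy k) :=
      (congrArg (fun t => t.app k) hγ).trans (eqToHom_app _ _)
    rw [← hιo, ← MapGpd.arrow_mk_precomp_map_app, h₁]
    exact (MapGpd.arrow_mk_eqToHom_app _ a).trans (arrow_mk_id_congr (fn_comp_obj _ _ _))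
  · have hz (z : Und (ind A T)) : (fn (ind.π T ≫ (x.obj 0).hom)).obj z =
        (fn (x.obj 0).hom).obj ((ind.e T).symm z).1 := by
      rw [fn_comp_obj, ind.π_obj']
    -- The preimage of `x` is the projection followed by `x 0`, moved at `(a, k)` along the
    -- component at `a` of `x 0 ⟶ x k`.
    obtain ⟨f, η, -, hη⟩ := exists_homotopy_of_family (ind.π T ≫ (x.obj 0).hom)
      (fun z => (fn (x.obj ((ind.e T).symm z).2).hom).obj ((ind.e T).symm z).1)
      (fun z => eqToHom (hz z) ≫ (x.map (homOfLE (Fin.zero_le _))).trans.app _)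
      (fun z => Marking.comp_mem _ _ _ (Marking.marked_eqToHom _ _)
        ((x.map (homOfLE (Fin.zero_le _))).marked _))
    have hη' (k : Fin (n + 1)) (a : Und A) :
        Arrow.mk (η.trans.app ((fn (ι k)).obj a)) =
          Arrow.mk ((x.map (homOfLE (Fin.zero_le k))).trans.app a) := by
      rw [hη, Arrow.arrow_mk_eqToHom_comp, hιo, Equiv.symm_apply_apply]
    have e₀ (k : Fin (n + 1)) : (MapGpd.precomp (ι k) B).obj ⟨ind.π T ≫ (x.obj 0).hom⟩ = x.obj 0 :=
      MapGpd.ext ((Category.assoc _ _ _).symm.trans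
        ((congrArg (· ≫ (x.obj 0).hom) (hι k)).trans (Category.id_comp _)))
    have e (k : Fin (n + 1)) : (MapGpd.precomp (ι k) B).obj ⟨f⟩ = x.obj k := by
      refine MapGpd.eq_of_arrow_mk_app ((MapGpd.precomp (ι k) B).map η)
        (eqToHom (e₀ k) ≫ x.map (homOfLE (Fin.zero_le k))) fun a => ?_
      exact (MapGpd.arrow_mk_precomp_map_app _ _ _).trans ((hη' k a).trans
        (MapGpd.arrow_mk_eqToHom_comp_app _ _ _).symm)
    refine ⟨⟨f⟩, functor_eq_of_arrow_mk fun {k l} φ => ?_⟩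
    refine MapGpd.arrow_mk_eq (e _) (e _) _ _ fun a => ?_
    refine (MapGpd.arrow_mk_postcomp_map_app f (δ k l) a).trans ?_
    have := MapGpd.isIso_trans_app η ((fn (ι k)).obj a)
    refine arrow_mk_eq_of_comp_eq (hη' k a) ?_
    have h₁ : Arrow.mk ((fn (ind.π T)).map ((δ k l).trans.app a)) = Arrow.mk (𝟙 a) := by
      rw [← MapGpd.arrow_mk_postcomp_map_app, hδ, MapGpd.arrow_mk_eqToHom_app]
      exact arrow_mk_id_congr ((congrArg (fun t => (fn t).obj a) (hι k)).trans (fn_id_obj a))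
    have h₂ : Arrow.mk ((fn (ind.π T ≫ (x.obj 0).hom)).map ((δ k l).trans.app a)) =
        Arrow.mk (𝟙 ((fn (x.obj 0).hom).obj a)) :=
      (arrow_mk_fn_comp_map _ _ _).trans ((arrow_mk_map_congr _ h₁).trans
        (congrArg Arrow.mk (CategoryTheory.Functor.map_id _ _)))
    have h₃ := η.trans.naturality ((δ k l).trans.app a)
    refine (congrArg Arrow.mk h₃.symm).trans ((arrow_mk_id_comp h₂).trans ((hη' l a).trans ?_))
    refine congrArg Arrow.mk (Eq.trans ?_ (congrArg (fun t => t.trans.app a)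
      (x.map_comp (homOfLE (Fin.zero_le k)) φ)))
    rfl

end

end MarkedModel

namespace MarkedModel

/-! ### Tensors and cotensors -/

section

/-- An `n`-simplex of the internal hom is a map `K ⊗ Δ[n] ⟶ Y`, so the hypothesis is bijectivity of
`Ψ` on `n`-simplices. -/
lemma bijective_of_forall_existsUnique {X Y K : SSet.{u}} (Ψ : X ⟶ (ihom K).obj Y)
    (h : ∀ (n : ℕ) (z : K ⊗ Δ[n] ⟶ Y), ∃! s : X _⦋n⦌, ∀ (m : SimplexCategoryᵒᵖ) (k : K.obj m)
      (θ : (Δ[n] : SSet.{u}).obj m), (MonoidalClosed.uncurry Ψ).app m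
        (k, (SSet.yonedaEquiv.symm s).app m θ) = z.app m (k, θ)) : IsIso Ψ := by
  have key {n : ℕ} (s : X _⦋n⦌) : MonoidalClosed.uncurry (SSet.yonedaEquiv.symm (Ψ.app _ s)) =
      K ◁ SSet.yonedaEquiv.symm s ≫ MonoidalClosed.uncurry Ψ := by
    rw [← SSet.yonedaEquiv_symm_comp, MonoidalClosed.uncurry_natural_left]
  have (n : SimplexCategoryᵒᵖ) : IsIso (Ψ.app n) := by
    obtain ⟨⟨n⟩⟩ := n
    rw [isIso_iff_bijective]
    constructor
    · intro s s' hs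
      refine (h n (K ◁ SSet.yonedaEquiv.symm s ≫ MonoidalClosed.uncurry Ψ)).unique
        (fun m k θ => rfl) fun m k θ => ?_
      have h₁ := (key s').symm.trans
        ((congrArg (fun w => MonoidalClosed.uncurry (SSet.yonedaEquiv.symm w)) hs.symm).trans (key s))
      exact congrArg (fun φ => φ.app m ((k, θ) : K.obj m × (Δ[n] : SSet.{u}).obj m)) h₁
    · intro w
      obtain ⟨s, hs, -⟩ := h n (MonoidalClosed.uncurry (SSet.yonedaEquiv.symm w))
      refine ⟨s, SSet.yonedaEquiv.symm.injective (MonoidalClosed.uncurry_injective ?_)⟩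
      refine (key s).trans ?_
      ext m x
      exact hs m x.1 x.2
  exact NatIso.isIso_of_isIso_app Ψ

variable {C : Type (u + 1)} [Category.{u} C] [HasMarked C]

/-- Composition of diagrams of morphisms. -/
abbrev cmp {J : Type} [Category.{0} J] {A B D : C} (x : J ⥤ MapGpd A B) (y : J ⥤ MapGpd B D) :
    J ⥤ MapGpd A D :=
  Functor.prod' x y ⋙ compFunctor A B D

/-- The constant diagram. -/
abbrev cst (J : Type) [Category.{0} J] {A B : C} (f : A ⟶ B) : J ⥤ MapGpd A B :=
  (Functor.const J).obj ⟨f⟩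

/-- The canonical map which is an isomorphism for a tensor. -/
noncomputable def tensorMap {A T : C} {K : SSet.{u}} (e : K ⟶ mapSpace A T) (B : C) :
    mapSpace T B ⟶ (ihom K).obj (mapSpace A B) :=
  MonoidalClosed.curry (e ▷ _ ≫ mapSpaceComp A T B)

/-- The canonical map which is an isomorphism for a cotensor. -/
noncomputable def cotensorMap {P B : C} {K : SSet.{u}} (e : K ⟶ mapSpace P B) (A : C) :
    mapSpace A P ⟶ (ihom K).obj (mapSpace A B) :=
  MonoidalClosed.curry (e ▷ _ ≫ (β_ _ _).hom ≫ mapSpaceComp A P B)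

lemma uncurry_tensorMap_app {A T : C} {K : SSet.{u}} (e : K ⟶ mapSpace A T) (B : C)
    (m : SimplexCategoryᵒᵖ) (k : K.obj m) (s : (mapSpace T B).obj m) :
    (MonoidalClosed.uncurry (tensorMap e B)).app m (k, s) = cmp (e.app m k) s := by
  rw [tensorMap, MonoidalClosed.uncurry_curry]
  rfl

lemma uncurry_cotensorMap_app {P B : C} {K : SSet.{u}} (e : K ⟶ mapSpace P B) (A : C)
    (m : SimplexCategoryᵒᵖ) (k : K.obj m) (s : (mapSpace A P).obj m) :
    (MonoidalClosed.uncurry (cotensorMap e A)).app m (k, s) = cmp s (e.app m k) := by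
  rw [cotensorMap, MonoidalClosed.uncurry_curry]
  rfl

variable [MarkedTheory C]

/-- Upgrade of an unenriched universal property. With `D` the cotensor of `B` with `Δ[n]`, an
`n`-simplex of `Map(T, B)` is a morphism `T ⟶ D`, hence a map `K ⟶ Map(A, D)`. By currying, this is
a map `K ⊗ Δ[n] ⟶ Map(A, B)`. -/
lemma isIso_tensorMap {A T : C} {K : SSet.{u}} (e : K ⟶ mapSpace A T)
    (he : ∀ (B : C) (t : K ⟶ mapSpace A B), ∃! g : T ⟶ B, e ≫ nerveMap (MapGpd.postcomp A g) = t)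
    (B : C) : IsIso (tensorMap e B) := by
  refine bijective_of_forall_existsUnique _ fun n z => ?_
  obtain ⟨D, ε, hε⟩ := exists_simplex_cotensor B n
  obtain ⟨_, _, hA⟩ := hε A
  obtain ⟨Θ, hΘ₁, hΘ₂⟩ := exists_inverse_functor (preMap A ε) hA
  obtain ⟨t', ht'⟩ := exists_nerve_curry z
  have key (g : T ⟶ D) (m : SimplexCategoryᵒᵖ) (k : K.obj m) (θ : (Δ[n] : SSet.{u}).obj m) :
      (MonoidalClosed.uncurry (tensorMap e B)).app m
        (k, (SSet.yonedaEquiv.symm ((preMap T ε).obj ⟨g⟩ : (mapSpace T B) _⦋n⦌)).app m θ) =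
      diag (((e ≫ nerveMap (MapGpd.postcomp A g)) ≫ nerveMap (preMap A ε)).app m k)
        (simplexFunctor θ) := by
    refine (uncurry_tensorMap_app e B m k _).trans (Eq.trans ?_ (diag_preMap _ _ _).symm)
    exact (compFunctor_assoc (e.app m k) (cst _ g) (simplexFunctor θ ⋙ ε)).symm
  obtain ⟨g, hg, hg'⟩ := he D (t' ≫ nerveMap Θ)
  refine ⟨(preMap T ε).obj ⟨g⟩, fun m k θ => ?_, fun s hs => ?_⟩
  · rw [key, hg, ← ht']
    refine congrArg (diag · _) ?_
    exact (Functor.assoc _ _ _).trans (congrArg (t'.app m k ⋙ ·) hΘ₁)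
  · obtain ⟨⟨g₁⟩, rfl⟩ := (hε T).2.2.2 s
    refine congrArg (fun g => (preMap T ε).obj ⟨g⟩) (hg' g₁ ?_)
    have h₁ : (e ≫ nerveMap (MapGpd.postcomp A g₁)) ≫ nerveMap (preMap A ε) = t' :=
      nerve_curry_unique fun m k θ => (key g₁ m k θ).symm.trans ((hs m k θ).trans (ht' m k θ).symm)
    rw [← h₁]
    ext m k
    exact (congrArg ((e ≫ nerveMap (MapGpd.postcomp A g₁)).app m k ⋙ ·) hΘ₂).symm

/-- Dual argument: here the universal property is tested on the tensor of `A` with `Δ[n]`. -/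
lemma isIso_cotensorMap {P B : C} {K : SSet.{u}} (e : K ⟶ mapSpace P B)
    (he : ∀ (A : C) (t : K ⟶ mapSpace A B), ∃! g : A ⟶ P, e ≫ nerveMap (MapGpd.precomp g B) = t)
    (A : C) : IsIso (cotensorMap e A) := by
  refine bijective_of_forall_existsUnique _ fun n z => ?_
  obtain ⟨D, ε, hε⟩ := exists_simplex_tensor A n
  obtain ⟨_, _, hB⟩ := hε B
  obtain ⟨Θ, hΘ₁, hΘ₂⟩ := exists_inverse_functor (postMap ε B) hB
  obtain ⟨t', ht'⟩ := exists_nerve_curry z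
  have key (g : D ⟶ P) (m : SimplexCategoryᵒᵖ) (k : K.obj m) (θ : (Δ[n] : SSet.{u}).obj m) :
      (MonoidalClosed.uncurry (cotensorMap e A)).app m
        (k, (SSet.yonedaEquiv.symm ((postMap ε P).obj ⟨g⟩ : (mapSpace A P) _⦋n⦌)).app m θ) =
      diag (((e ≫ nerveMap (MapGpd.precomp g B)) ≫ nerveMap (postMap ε B)).app m k)
        (simplexFunctor θ) := by
    refine (uncurry_cotensorMap_app e A m k _).trans (Eq.trans ?_ (diag_postMap _ _ _).symm)
    exact compFunctor_assoc (simplexFunctor θ ⋙ ε) (cst _ g) (e.app m k)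
  obtain ⟨g, hg, hg'⟩ := he D (t' ≫ nerveMap Θ)
  refine ⟨(postMap ε P).obj ⟨g⟩, fun m k θ => ?_, fun s hs => ?_⟩
  · rw [key, hg, ← ht']
    refine congrArg (diag · _) ?_
    exact (Functor.assoc _ _ _).trans (congrArg (t'.app m k ⋙ ·) hΘ₁)
  · obtain ⟨⟨g₁⟩, rfl⟩ := (hε P).2.2.2 s
    refine congrArg (fun g => (postMap ε P).obj ⟨g⟩) (hg' g₁ ?_)
    have h₁ : (e ≫ nerveMap (MapGpd.precomp g₁ B)) ≫ nerveMap (postMap ε B) = t' :=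
      nerve_curry_unique fun m k θ => (key g₁ m k θ).symm.trans ((hs m k θ).trans (ht' m k θ).symm)
    rw [← h₁]
    ext m k
    exact (congrArg ((e ≫ nerveMap (MapGpd.precomp g₁ B)).app m k ⋙ ·) hΘ₂).symm

end

end MarkedModel

namespace MarkedModel

/-! ### Existence of tensors and cotensors -/

section

variable {D : Type (u + 1)} [Category.{u} D]

lemma leftAdjointObjIsDefined_stdSimplex (F : D ⥤ SSet.{u}) (n : ℕ) {T : D}
    (s : (F.obj T) _⦋n⦌) (h : ∀ B, Function.Bijective fun g : T ⟶ B => (F.map g).app _ s) :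
    F.leftAdjointObjIsDefined Δ[n] := by
  refine Functor.CorepresentableBy.isCorepresentable (X := T)
    { homEquiv := fun {B} => (Equiv.ofBijective _ (h B)).trans SSet.yonedaEquiv.symm
      homEquiv_comp := fun {B B'} g f => SSet.yonedaEquiv.injective ?_ }
  simp [← SSet.yonedaEquiv_symm_comp]

/-- A left adjoint is defined at all colimits of objects at which it is defined, and every
simplicial set is a colimit of standard simplices. -/
lemma isRightAdjoint_of_simplices [HasColimitsOfSize.{u, u} D] (F : D ⥤ SSet.{u})
    (h : ∀ n : ℕ, ∃ (T : D) (s : (F.obj T) _⦋n⦌),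
      ∀ B, Function.Bijective fun g : T ⟶ B => (F.map g).app _ s) : F.IsRightAdjoint := by
  apply Functor.isRightAdjoint_of_leftAdjointObjIsDefined_eq_top
  ext K
  simp only [Pi.top_apply, Prop.top_eq_true, iff_true]
  have : HasColimitsOfShape (CostructuredArrow uliftYoneda.{u} K) D :=
    hasColimitsOfShape_of_essentiallySmall.{u} _ _
  refine Functor.leftAdjointObjIsDefined_of_isColimit (Presheaf.isColimitTautologicalCocone'.{u} K)
    fun ⟨⟨n⟩, _, _⟩ => ?_
  obtain ⟨T, s, hs⟩ := h n
  exact leftAdjointObjIsDefined_stdSimplex F n s hs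

end

section

variable {C : Type (u + 1)} [Category.{u} C] [HasMarked C]

lemma ihom_hom_ext {X Y K : SSet.{u}} {Ψ Ψ' : X ⟶ (ihom K).obj Y}
    (h : ∀ (m : SimplexCategoryᵒᵖ) (k : K.obj m) (s : X.obj m),
      (MonoidalClosed.uncurry Ψ).app m (k, s) = (MonoidalClosed.uncurry Ψ').app m (k, s)) :
    Ψ = Ψ' := by
  refine MonoidalClosed.uncurry_injective ?_
  ext m x
  exact h m x.1 x.2

lemma uncurry_comp_pre_app {X Y K K' : SSet.{u}} (Ψ : X ⟶ (ihom K').obj Y) (φ : K ⟶ K') :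
    MonoidalClosed.uncurry (Ψ ≫ (MonoidalClosed.pre φ).app Y) =
      φ ▷ X ≫ MonoidalClosed.uncurry Ψ := by
  rw [MonoidalClosed.uncurry_natural_left, MonoidalClosed.uncurry_pre, MonoidalClosed.uncurry_eq,
    whisker_exchange_assoc]

lemma uncurry_comp_pre_app_app {X Y K K' : SSet.{u}} (Ψ : X ⟶ (ihom K').obj Y) (φ : K ⟶ K')
    (m : SimplexCategoryᵒᵖ) (k : K.obj m) (s : X.obj m) :
    (MonoidalClosed.uncurry (Ψ ≫ (MonoidalClosed.pre φ).app Y)).app m (k, s) =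
      (MonoidalClosed.uncurry Ψ).app m (φ.app m k, s) := by
  rw [uncurry_comp_pre_app]
  rfl

lemma uncurry_comp_map_app {X Y Y' K : SSet.{u}} (Ψ : X ⟶ (ihom K).obj Y) (φ : Y ⟶ Y')
    (m : SimplexCategoryᵒᵖ) (k : K.obj m) (s : X.obj m) :
    (MonoidalClosed.uncurry (Ψ ≫ (ihom K).map φ)).app m (k, s) =
      φ.app m ((MonoidalClosed.uncurry Ψ).app m (k, s)) := by
  rw [MonoidalClosed.uncurry_natural_right]
  rfl

lemma uncurry_comp_app {X X' Y K : SSet.{u}} (φ : X' ⟶ X) (Ψ : X ⟶ (ihom K).obj Y)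
    (m : SimplexCategoryᵒᵖ) (k : K.obj m) (s : X'.obj m) :
    (MonoidalClosed.uncurry (φ ≫ Ψ)).app m (k, s) =
      (MonoidalClosed.uncurry Ψ).app m (k, φ.app m s) := by
  rw [MonoidalClosed.uncurry_natural_left]
  rfl

variable [MarkedTheory C]

/-- The tensor is the value at `K` of a left adjoint of `Map(A, -)`, viewed as an ordinary functor
to simplicial sets. -/
lemma exists_tensor [HasColimitsOfSize.{u, u} C] (A : C) (K : SSet.{u}) :
    ∃ (T : C) (e : K ⟶ mapSpace A T), ∀ (B : C) (t : K ⟶ mapSpace A B),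
      ∃! g : T ⟶ B, e ≫ eHomWhiskerLeft SSet.{u} A g = t := by
  have : ((eHomFunctor SSet.{u} C).obj (op A)).IsRightAdjoint := by
    refine isRightAdjoint_of_simplices _ fun n => ?_
    obtain ⟨D, ε, hε⟩ := exists_simplex_tensor A n
    refine ⟨D, ε, fun B => ?_⟩
    exact (hε B).2.2.comp ⟨fun _ _ h => congrArg MapGpd.hom h, fun x => ⟨x.hom, rfl⟩⟩
  let adj := Adjunction.ofIsRightAdjoint ((eHomFunctor SSet.{u} C).obj (op A))
  exact ⟨_, adj.unit.app K, fun B t => (adj.homEquiv K B).bijective.existsUnique t⟩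

/-- The same adjunction argument for `Map(-, B)` on the opposite category, whose colimits are the
limits of `C`. -/
lemma exists_cotensor [HasLimitsOfSize.{u, u} C] (B : C) (K : SSet.{u}) :
    ∃ (P : C) (e : K ⟶ mapSpace P B), ∀ (A : C) (t : K ⟶ mapSpace A B),
      ∃! g : A ⟶ P, e ≫ eHomWhiskerRight SSet.{u} g B = t := by
  have : ((eHomFunctor SSet.{u} C).flip.obj B).IsRightAdjoint := by
    refine isRightAdjoint_of_simplices _ fun n => ?_
    obtain ⟨D, ε, hε⟩ := exists_simplex_cotensor B n
    refine ⟨op D, ε, fun A => ?_⟩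
    exact (hε A.unop).2.2.comp ⟨fun _ _ h => Quiver.Hom.unop_inj (congrArg MapGpd.hom h),
      fun x => ⟨x.hom.op, rfl⟩⟩
  let adj := Adjunction.ofIsRightAdjoint ((eHomFunctor SSet.{u} C).flip.obj B)
  refine ⟨_, adj.unit.app K, fun A t => ?_⟩
  obtain ⟨g, hg, hg'⟩ := (adj.homEquiv K (op A)).bijective.existsUnique t
  exact ⟨g.unop, hg, fun g₁ hg₁ => Quiver.Hom.op_inj (hg' g₁.op hg₁)⟩

end

end MarkedModel

namespace MarkedModel

/-! ### The simplicial model category structure -/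

section

variable {C : Type (u + 1)} [Category.{u} C] [HasMarked C]

section

variable {A A' B B' T T' P P' : C} {K K' : SSet.{u}}

/-- After uncurrying, naturality is associativity of composition together with the compatibility `h`
of the universal families. The other naturality lemmas follow the same pattern. -/
lemma tensorMap_left {e : K ⟶ mapSpace A T} {e' : K ⟶ mapSpace A' T'} (f : A ⟶ A') (g : T ⟶ T')
    (h : e ≫ eHomWhiskerLeft SSet.{u} A g = e' ≫ eHomWhiskerRight SSet.{u} f T') (B : C) :
    eHomWhiskerRight SSet.{u} g B ≫ tensorMap e B =
      tensorMap e' B ≫ (ihom K).map (eHomWhiskerRight SSet.{u} f B) := ihom_hom_ext fun m k s => by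
  refine (uncurry_comp_app _ _ m k s).trans (Eq.trans ?_ (uncurry_comp_map_app _ _ m k s).symm)
  refine (uncurry_tensorMap_app _ _ _ _ _).trans
    (Eq.trans ?_ (congrArg _ (uncurry_tensorMap_app _ _ _ _ _)).symm)
  refine (compFunctor_assoc _ (cst _ _) _).symm.trans (Eq.trans ?_ (compFunctor_assoc _ _ _))
  exact congrArg (fun z => cmp (z.app m k) s) h

lemma tensorMap_middle {e : K ⟶ mapSpace A T} {e' : K' ⟶ mapSpace A T'} (φ : K ⟶ K') (g : T ⟶ T')
    (h : e ≫ eHomWhiskerLeft SSet.{u} A g = φ ≫ e') (B : C) :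
    eHomWhiskerRight SSet.{u} g B ≫ tensorMap e B =
      tensorMap e' B ≫ (MonoidalClosed.pre φ).app (mapSpace A B) := ihom_hom_ext fun m k s => by
  refine (uncurry_comp_app _ _ m k s).trans
    (Eq.trans ?_ (uncurry_comp_pre_app_app _ _ m k s).symm)
  refine (uncurry_tensorMap_app _ _ _ _ _).trans
    (Eq.trans ?_ (uncurry_tensorMap_app _ _ _ _ _).symm)
  refine (compFunctor_assoc _ (cst _ _) _).symm.trans ?_
  exact congrArg (fun z => cmp (z.app m k) s) h

lemma tensorMap_right (e : K ⟶ mapSpace A T) (g : B ⟶ B') :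
    eHomWhiskerLeft SSet.{u} T g ≫ tensorMap e B' =
      tensorMap e B ≫ (ihom K).map (eHomWhiskerLeft SSet.{u} A g) := ihom_hom_ext fun m k s => by
  refine (uncurry_comp_app _ _ m k s).trans (Eq.trans ?_ (uncurry_comp_map_app _ _ m k s).symm)
  refine (uncurry_tensorMap_app _ _ _ _ _).trans
    (Eq.trans ?_ (congrArg _ (uncurry_tensorMap_app _ _ _ _ _)).symm)
  exact (compFunctor_assoc _ _ (cst _ _)).symm

lemma cotensorMap_left (e : K ⟶ mapSpace P B) (f : A ⟶ A') :
    eHomWhiskerRight SSet.{u} f P ≫ cotensorMap e A =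
      cotensorMap e A' ≫ (ihom K).map (eHomWhiskerRight SSet.{u} f B) :=
  ihom_hom_ext fun m k s => by
  refine (uncurry_comp_app _ _ m k s).trans (Eq.trans ?_ (uncurry_comp_map_app _ _ m k s).symm)
  refine (uncurry_cotensorMap_app _ _ _ _ _).trans
    (Eq.trans ?_ (congrArg _ (uncurry_cotensorMap_app _ _ _ _ _)).symm)
  exact compFunctor_assoc (cst _ _) _ _

lemma cotensorMap_middle {e : K ⟶ mapSpace P B} {e' : K' ⟶ mapSpace P' B} (φ : K ⟶ K')
    (g : P' ⟶ P) (h : e ≫ eHomWhiskerRight SSet.{u} g B = φ ≫ e') (A : C) :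
    eHomWhiskerLeft SSet.{u} A g ≫ cotensorMap e A =
      cotensorMap e' A ≫ (MonoidalClosed.pre φ).app (mapSpace A B) :=
  ihom_hom_ext fun m k s => by
  refine (uncurry_comp_app _ _ m k s).trans
    (Eq.trans ?_ (uncurry_comp_pre_app_app _ _ m k s).symm)
  refine (uncurry_cotensorMap_app _ _ _ _ _).trans
    (Eq.trans ?_ (uncurry_cotensorMap_app _ _ _ _ _).symm)
  refine (compFunctor_assoc _ (cst _ _) _).trans ?_
  exact congrArg (fun z => cmp s (z.app m k)) h

lemma cotensorMap_right {e : K ⟶ mapSpace P B} {e' : K ⟶ mapSpace P' B'} (g : B ⟶ B')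
    (q : P ⟶ P') (h : e' ≫ eHomWhiskerRight SSet.{u} q B' = e ≫ eHomWhiskerLeft SSet.{u} P g)
    (A : C) : eHomWhiskerLeft SSet.{u} A q ≫ cotensorMap e' A =
      cotensorMap e A ≫ (ihom K).map (eHomWhiskerLeft SSet.{u} A g) :=
  ihom_hom_ext fun m k s => by
  refine (uncurry_comp_app _ _ m k s).trans (Eq.trans ?_ (uncurry_comp_map_app _ _ m k s).symm)
  refine (uncurry_cotensorMap_app _ _ _ _ _).trans
    (Eq.trans ?_ (congrArg _ (uncurry_cotensorMap_app _ _ _ _ _)).symm)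
  refine (compFunctor_assoc _ (cst _ _) _).trans
    (Eq.trans ?_ (compFunctor_assoc _ _ (cst _ _)).symm)
  exact congrArg (fun z => cmp s (z.app m k)) h

end

variable [MarkedTheory C]

namespace Tensor

variable [HasColimitsOfSize.{u, u} C]

/-- The tensor of an object and a simplicial set. -/
noncomputable def obj (A : C) (K : SSet.{u}) : C := (exists_tensor A K).choose

/-- The universal family of morphisms to the tensor. -/
noncomputable def unit (A : C) (K : SSet.{u}) : K ⟶ mapSpace A (obj A K) :=
  (exists_tensor A K).choose_spec.choose

lemma existsUnique (A : C) (K : SSet.{u}) {B : C} (t : K ⟶ mapSpace A B) :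
    ∃! g : obj A K ⟶ B, unit A K ≫ eHomWhiskerLeft SSet.{u} A g = t :=
  (exists_tensor A K).choose_spec.choose_spec B t

/-- The morphism from the tensor induced by a family of morphisms. -/
noncomputable def desc {A : C} {K : SSet.{u}} {B : C} (t : K ⟶ mapSpace A B) : obj A K ⟶ B :=
  (existsUnique A K t).choose

lemma fac {A : C} {K : SSet.{u}} {B : C} (t : K ⟶ mapSpace A B) :
    unit A K ≫ eHomWhiskerLeft SSet.{u} A (desc t) = t :=
  (existsUnique A K t).choose_spec.1

lemma fac_assoc {A : C} {K : SSet.{u}} {B : C} (t : K ⟶ mapSpace A B) {Z : SSet.{u}}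
    (z : mapSpace A B ⟶ Z) :
    unit A K ≫ eHomWhiskerLeft SSet.{u} A (desc t) ≫ z = t ≫ z := by
  rw [← Category.assoc]
  exact congrArg (· ≫ z) (fac t)

lemma hom_ext {A : C} {K : SSet.{u}} {B : C} {g g' : obj A K ⟶ B}
    (h : unit A K ≫ eHomWhiskerLeft SSet.{u} A g = unit A K ≫ eHomWhiskerLeft SSet.{u} A g') :
    g = g' :=
  (existsUnique A K _).unique h rfl

lemma isIso_tensorMap_unit (A : C) (K : SSet.{u}) (B : C) : IsIso (tensorMap (unit A K) B) :=
  isIso_tensorMap _ (fun B t => by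
    simp_rw [← eHomWhiskerLeft_eq]
    exact existsUnique A K t) B

/-- The isomorphism of mapping spaces for the tensor. -/
noncomputable def iso (A : C) (K : SSet.{u}) (B : C) :
    mapSpace (obj A K) B ≅ (ihom K).obj (mapSpace A B) :=
  @asIso _ _ _ _ _ (isIso_tensorMap_unit A K B)

/-- The tensor as a bifunctor. -/
noncomputable def functor : C ⥤ SSet.{u} ⥤ C where
  obj A :=
    { obj := obj A
      map := fun {K K'} φ => desc (φ ≫ unit A K')
      map_id := fun K => hom_ext (by
        rw [fac, eHomWhiskerLeft_id]
        exact (Category.id_comp _).trans (Category.comp_id _).symm)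
      map_comp := fun φ ψ => hom_ext (by
        rw [fac, eHomWhiskerLeft_comp, fac_assoc, Category.assoc, Category.assoc, fac]) }
  map {A A'} f :=
    { app := fun K => desc (unit A' K ≫ eHomWhiskerRight SSet.{u} f _)
      naturality := fun K K' φ => hom_ext (by
        dsimp only
        rw [eHomWhiskerLeft_comp, eHomWhiskerLeft_comp, fac_assoc, Category.assoc, fac,
          fac_assoc, Category.assoc, ← eHom_whisker_exchange, ← Category.assoc (unit A' K), fac,
          Category.assoc]) }
  map_id A := by
    ext K
    refine hom_ext ?_
    dsimp only
    rw [fac]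
    simp
  map_comp {A A' A''} f g := by
    ext K
    refine hom_ext ?_
    dsimp only [NatTrans.comp_app]
    rw [fac, eHomWhiskerLeft_comp, fac_assoc, Category.assoc, ← eHom_whisker_exchange,
      ← Category.assoc (unit A' K), fac, eHomWhiskerRight_comp, Category.assoc]

end Tensor

namespace Cotensor

variable [HasLimitsOfSize.{u, u} C]

/-- The cotensor of an object and a simplicial set. -/
noncomputable def obj (K : SSet.{u}) (B : C) : C := (exists_cotensor B K).choose

/-- The universal family of morphisms from the cotensor. -/
noncomputable def unit (K : SSet.{u}) (B : C) : K ⟶ mapSpace (obj K B) B :=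
  (exists_cotensor B K).choose_spec.choose

lemma existsUnique {A : C} (K : SSet.{u}) (B : C) (t : K ⟶ mapSpace A B) :
    ∃! g : A ⟶ obj K B, unit K B ≫ eHomWhiskerRight SSet.{u} g B = t :=
  (exists_cotensor B K).choose_spec.choose_spec A t

/-- The morphism to the cotensor induced by a family of morphisms. -/
noncomputable def lift {A : C} {K : SSet.{u}} {B : C} (t : K ⟶ mapSpace A B) : A ⟶ obj K B :=
  (existsUnique K B t).choose

lemma fac {A : C} {K : SSet.{u}} {B : C} (t : K ⟶ mapSpace A B) :
    unit K B ≫ eHomWhiskerRight SSet.{u} (lift t) B = t :=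
  (existsUnique K B t).choose_spec.1

lemma fac_assoc {A : C} {K : SSet.{u}} {B : C} (t : K ⟶ mapSpace A B) {Z : SSet.{u}}
    (z : mapSpace A B ⟶ Z) :
    unit K B ≫ eHomWhiskerRight SSet.{u} (lift t) B ≫ z = t ≫ z := by
  rw [← Category.assoc]
  exact congrArg (· ≫ z) (fac t)

lemma hom_ext {A : C} {K : SSet.{u}} {B : C} {g g' : A ⟶ obj K B}
    (h : unit K B ≫ eHomWhiskerRight SSet.{u} g B = unit K B ≫ eHomWhiskerRight SSet.{u} g' B) :
    g = g' :=
  (existsUnique K B _).unique h rfl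

lemma isIso_cotensorMap_unit (A : C) (K : SSet.{u}) (B : C) : IsIso (cotensorMap (unit K B) A) :=
  isIso_cotensorMap _ (fun B t => by
    simp_rw [← eHomWhiskerRight_eq]
    exact existsUnique K _ t) A

/-- The isomorphism of mapping spaces for the cotensor. -/
noncomputable def iso (A : C) (K : SSet.{u}) (B : C) :
    mapSpace A (obj K B) ≅ (ihom K).obj (mapSpace A B) :=
  @asIso _ _ _ _ _ (isIso_cotensorMap_unit A K B)

/-- The cotensor as a bifunctor. -/
noncomputable def functor : SSet.{u}ᵒᵖ ⥤ C ⥤ C where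
  obj K :=
    { obj := obj K.unop
      map := fun {B B'} g => lift (unit K.unop B ≫ eHomWhiskerLeft SSet.{u} _ g)
      map_id := fun B => hom_ext (by
        rw [fac, eHomWhiskerRight_id, eHomWhiskerLeft_id])
      map_comp := fun {B B' B''} f g => hom_ext (by
        rw [fac, eHomWhiskerRight_comp, fac_assoc, Category.assoc, eHom_whisker_exchange,
          ← Category.assoc (unit _ B'), fac, eHomWhiskerLeft_comp, Category.assoc]) }
  map {K K'} φ :=
    { app := fun B => lift (φ.unop ≫ unit K.unop B)
      naturality := fun B B' g => hom_ext (by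
        dsimp only
        rw [eHomWhiskerRight_comp, eHomWhiskerRight_comp, fac_assoc, fac_assoc, Category.assoc,
          Category.assoc, fac, eHom_whisker_exchange, ← Category.assoc (unit _ B), fac,
          Category.assoc]) }
  map_id K := by
    ext B
    refine hom_ext ?_
    rw [NatTrans.id_app, eHomWhiskerRight_id, fac]
    exact (Category.id_comp _).trans (Category.comp_id _).symm
  map_comp {K K' K''} φ ψ := by
    ext B
    refine hom_ext ?_
    dsimp only [NatTrans.comp_app]
    rw [fac, eHomWhiskerRight_comp, fac_assoc, Category.assoc, fac, unop_comp, Category.assoc]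

end Cotensor

/-- Tensors and cotensors with simplicial sets. -/
noncomputable def tensorCotensor [HasLimitsOfSize.{u, u} C] [HasColimitsOfSize.{u, u} C] :
    TensorCotensor C where
  tensor := Tensor.functor
  cotensor := Cotensor.functor
  tensorIso A K B := Tensor.iso A K B
  tensorIso_left f _ B := tensorMap_left f _ (Tensor.fac _) B
  tensorIso_middle _ _ _ φ B := tensorMap_middle φ _ (Tensor.fac _) B
  tensorIso_right _ _ _ _ g := tensorMap_right _ g
  cotensorIso A K B := Cotensor.iso A K B
  cotensorIso_left f _ _ := cotensorMap_left _ f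
  cotensorIso_middle A _ _ φ _ := cotensorMap_middle φ _ (Cotensor.fac _) A
  cotensorIso_right A _ _ _ g := cotensorMap_right g _ (Cotensor.fac _) A

variable (C) in
lemma isSimplicialModelCategory [HasLimitsOfSize.{u, u} C] [HasColimitsOfSize.{u, u} C] :
    IsSimplicialModelCategory C where
  toIsModelCategory := isModelCategory C
  tensorCotensor := ⟨tensorCotensor⟩
  fibration_pullbackMap i p hi hp := by
    rw [SSet.modelCategoryQuillen.fibrations_eq]
    exact fibrations_pullbackMap hi hp
  weakEquivalence_pullbackMap i p hi hp h := isWeakHomotopyEquivalence_pullbackMap hi hp h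

end

end MarkedModel

namespace MarkedModel

/-! ### Filtered colimits of marked categories -/

/-- The composition of two arrows whose endpoints match up to equality. -/
abbrev acomp {X : Type*} [Category X] (α β : Arrow X) (h : α.right = β.left) : Arrow X :=
  Arrow.mk (α.hom ≫ eqToHom h ≫ β.hom)

section

variable {X Y : Type*} [Category X] [Category Y]

lemma mapArrow_acomp (G : X ⥤ Y) (α β : Arrow X) (h : α.right = β.left) :
    G.mapArrow.obj (acomp α β h) =
      acomp (G.mapArrow.obj α) (G.mapArrow.obj β) (congrArg G.obj h) := by
  simp [Functor.mapArrow, eqToHom_map, acomp]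

lemma acomp_congr {α α' β β' : Arrow X} (hα : α = α') (hβ : β = β') (h : α.right = β.left) :
    acomp α β h = acomp α' β' (by rw [← hα, ← hβ, h]) := by
  subst hα hβ
  rfl

lemma acomp_assoc (α β γ : Arrow X) (h : α.right = β.left) (h' : β.right = γ.left) :
    acomp (acomp α β h) γ h' = acomp α (acomp β γ h') h := by
  simp [acomp]

lemma id_acomp (α : Arrow X) {x : X} (h : x = α.left) : acomp (Arrow.mk (𝟙 x)) α h = α := by
  subst h
  simp [acomp]

lemma acomp_id (α : Arrow X) {x : X} (h : α.right = x) : acomp α (Arrow.mk (𝟙 x)) h = α := by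
  subst h
  simp [acomp]

end

section

variable {J : Type u} [Category.{u} J] [IsFiltered J]

/-- A partially defined natural operation induces a well-defined operation on a filtered
colimit. -/
lemma ιColimitType_op_eq {G : J ⥤ Type u} (R : ∀ {j}, G.obj j → G.obj j → Prop)
    (op : ∀ {j} (x y : G.obj j), R x y → G.obj j)
    (hR : ∀ {j k} (φ : j ⟶ k) {x y : G.obj j}, R x y → R (G.map φ x) (G.map φ y))
    (hop : ∀ {j k} (φ : j ⟶ k) {x y : G.obj j} (h : R x y),
      G.map φ (op x y h) = op (G.map φ x) (G.map φ y) (hR φ h))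
    {j j' : J} {x y : G.obj j} {x' y' : G.obj j'} (h : R x y) (h' : R x' y')
    (hx : G.ιColimitType j x = G.ιColimitType j' x')
    (hy : G.ιColimitType j y = G.ιColimitType j' y') :
    G.ιColimitType j (op x y h) = G.ιColimitType j' (op x' y' h') := by
  rw [Functor.ιColimitType_eq_iff_of_isFiltered] at hx hy
  obtain ⟨k, φ, φ', hφ⟩ := hx
  obtain ⟨l, ψ, ψ', hψ⟩ := hy
  -- A single stage at which both identifications hold, through the same pair of transition maps.
  obtain ⟨s, a, b, h₁, h₂⟩ := IsFiltered.bowtie φ ψ φ' ψ'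
  refine Functor.ιColimitType_eq_of_map_eq_map _ _ _ (φ ≫ a) (φ' ≫ a) ?_
  rw [hop, hop]
  have e₁ : G.map (φ ≫ a) x = G.map (φ' ≫ a) x' := by
    simp [hφ]
  have e₂ : G.map (φ ≫ a) y = G.map (φ' ≫ a) y' := by
    rw [h₁, h₂]
    simp [hψ]
  congr 1

end

namespace FilteredColimit

variable {J : Type u} [Category.{u} J] (F : J ⥤ MarkedCat.{u})

/-- The diagram of sets of objects. -/
def ob : J ⥤ Type u where
  obj j := (F.obj j).carrier
  map φ := ↾(F.map φ).toFunctor.obj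
  map_id j := by rw [F.map_id]; rfl
  map_comp φ ψ := by rw [F.map_comp]; rfl

/-- The diagram of sets of arrows. -/
def ar : J ⥤ Type u where
  obj j := Arrow (F.obj j).carrier
  map φ := ↾(F.map φ).toFunctor.mapArrow.obj
  map_id j := by rw [F.map_id]; rfl
  map_comp φ ψ := by rw [F.map_comp]; rfl

/-- The objects of the colimit. -/
def Obj : Type u := (ob F).ColimitType

variable {F} in
/-- The object of the colimit given by an object of the diagram. -/
def mkOb {j : J} (x : (F.obj j).carrier) : Obj F := (ob F).ιColimitType j x

/-- The arrows of the colimit. -/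
def Arr : Type u := (ar F).ColimitType

variable {F} in
/-- The arrow of the colimit given by an arrow of the diagram. -/
def mkAr {j : J} (α : Arrow (F.obj j).carrier) : Arr F := (ar F).ιColimitType j α

section

variable {F}

/-- The image of an arrow along a transition functor. -/
abbrev push {j k : J} (φ : j ⟶ k) (α : Arrow (F.obj j).carrier) : Arrow (F.obj k).carrier :=
  (F.map φ).toFunctor.mapArrow.obj α

lemma mkOb_map {j k : J} (φ : j ⟶ k) (x : (F.obj j).carrier) :
    mkOb ((F.map φ).toFunctor.obj x) = mkOb x :=
  (ob F).ιColimitType_map φ x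

lemma mkAr_push {j k : J} (φ : j ⟶ k) (α : Arrow (F.obj j).carrier) :
    mkAr (push φ α) = mkAr α :=
  (ar F).ιColimitType_map φ α

lemma marked_push {j k : J} (φ : j ⟶ k) (α : Arrow (F.obj j).carrier)
    (h : (F.obj j).marking.marked α.hom) : (F.obj k).marking.marked (push φ α).hom :=
  (F.map φ).map_marked _ h

lemma cocone_w (s : Cocone F) {j k : J} (φ : j ⟶ k) :
    (F.map φ).toFunctor ⋙ (s.ι.app k).toFunctor = (s.ι.app j).toFunctor :=
  congrArg MarkedCat.Hom.toFunctor (s.w φ)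

lemma exists_mkOb (X : Obj F) : ∃ (j : J) (x : (F.obj j).carrier), mkOb x = X :=
  (ob F).ιColimitType_jointly_surjective X

lemma exists_mkAr (a : Arr F) : ∃ (j : J) (α : Arrow (F.obj j).carrier), mkAr α = a :=
  (ar F).ιColimitType_jointly_surjective a

/-- The source of an arrow. -/
def src : Arr F → Obj F :=
  (ar F).descColimitType
    { pt := Obj F
      ι := fun _ α => mkOb α.left
      ι_naturality := fun φ => funext fun α => mkOb_map φ α.left }

/-- The target of an arrow. -/
def tgt : Arr F → Obj F :=
  (ar F).descColimitType
    { pt := Obj F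
      ι := fun _ α => mkOb α.right
      ι_naturality := fun φ => funext fun α => mkOb_map φ α.right }

/-- The identity of an object. -/
def ident : Obj F → Arr F :=
  (ob F).descColimitType
    { pt := Arr F
      ι := fun j (x : (F.obj j).carrier) => mkAr (Arrow.mk (𝟙 x))
      ι_naturality := fun {j _} φ => funext fun (x : (F.obj j).carrier) => by
        refine Eq.trans ?_ (mkAr_push φ (Arrow.mk (𝟙 x)))
        exact congrArg mkAr (congrArg Arrow.mk (((F.map φ).toFunctor.map_id x).symm)) }

lemma src_ident (X : Obj F) : src (ident X) = X := by
  obtain ⟨j, x, rfl⟩ := exists_mkOb X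
  rfl

lemma tgt_ident (X : Obj F) : tgt (ident X) = X := by
  obtain ⟨j, x, rfl⟩ := exists_mkOb X
  rfl

section

variable (s : Cocone F)

/-- The map on objects induced by a cocone. -/
def descOb : Obj F → s.pt.carrier :=
  (ob F).descColimitType
    { pt := s.pt.carrier
      ι := fun j => (s.ι.app j).toFunctor.obj
      ι_naturality := fun φ => funext fun x => Functor.congr_obj (cocone_w s φ) x }

/-- The map on arrows induced by a cocone. -/
def descAr : Arr F → Arrow s.pt.carrier :=
  (ar F).descColimitType
    { pt := Arrow s.pt.carrier
      ι := fun j => (s.ι.app j).toFunctor.mapArrow.obj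
      ι_naturality := fun φ => funext fun x =>
        congrArg (fun G => G.mapArrow.obj x) (cocone_w s φ) }

lemma descAr_mkAr {j : J} (α : Arrow (F.obj j).carrier) :
    descAr s (mkAr α) = (s.ι.app j).toFunctor.mapArrow.obj α := rfl

lemma descAr_left (a : Arr F) : (descAr s a).left = descOb s (src a) := by
  obtain ⟨j, α, rfl⟩ := exists_mkAr a
  rfl

lemma descAr_right (a : Arr F) : (descAr s a).right = descOb s (tgt a) := by
  obtain ⟨j, α, rfl⟩ := exists_mkAr a
  rfl

end

variable [IsFiltered J]

lemma exists_of_mkOb_eq {j k : J} {x : (F.obj j).carrier} {y : (F.obj k).carrier}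
    (h : mkOb x = mkOb y) : ∃ (l : J) (φ : j ⟶ l) (ψ : k ⟶ l),
      (F.map φ).toFunctor.obj x = (F.map ψ).toFunctor.obj y :=
  ((ob F).ιColimitType_eq_iff_of_isFiltered x y).1 h

lemma exists_of_mkAr_eq {j k : J} {α : Arrow (F.obj j).carrier} {β : Arrow (F.obj k).carrier}
    (h : mkAr α = mkAr β) : ∃ (l : J) (φ : j ⟶ l) (ψ : k ⟶ l), push φ α = push ψ β :=
  ((ar F).ιColimitType_eq_iff_of_isFiltered α β).1 h

/-- Endpoints which agree in the colimit agree at a later stage, so composition can be performed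
there. -/
lemma exists_composable (a b : Arr F) (h : tgt a = src b) :
    ∃ (j : J) (α β : Arrow (F.obj j).carrier), α.right = β.left ∧ mkAr α = a ∧ mkAr β = b := by
  obtain ⟨j, α, rfl⟩ := exists_mkAr a
  obtain ⟨k, β, rfl⟩ := exists_mkAr b
  obtain ⟨l, φ, ψ, e⟩ := exists_of_mkOb_eq h
  exact ⟨l, push φ α, push ψ β, e, mkAr_push _ _, mkAr_push _ _⟩

lemma mkAr_acomp_eq {j j' : J} {α β : Arrow (F.obj j).carrier} {α' β' : Arrow (F.obj j').carrier}
    (h : α.right = β.left) (h' : α'.right = β'.left) (hα : mkAr α = mkAr α')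
    (hβ : mkAr β = mkAr β') : mkAr (acomp α β h) = mkAr (acomp α' β' h') :=
  ιColimitType_op_eq (G := ar F) (fun {j} (α β : Arrow (F.obj j).carrier) => α.right = β.left)
    (fun {j} (α β : Arrow (F.obj j).carrier) h => acomp α β h)
    (fun φ _ _ h => congrArg (F.map φ).toFunctor.obj h) (fun _ _ _ _ => mapArrow_acomp _ _ _ _)
    h h' hα hβ

/-- The composition of arrows. -/
noncomputable def comp (a b : Arr F) (h : tgt a = src b) : Arr F :=
  mkAr (acomp _ _ (exists_composable a b h).choose_spec.choose_spec.choose_spec.1)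

lemma comp_mkAr {j : J} {α β : Arrow (F.obj j).carrier} (h : α.right = β.left)
    (h' : tgt (mkAr α) = src (mkAr β)) : comp (mkAr α) (mkAr β) h' = mkAr (acomp α β h) :=
  mkAr_acomp_eq _ _ (exists_composable _ _ h').choose_spec.choose_spec.choose_spec.2.1
    (exists_composable _ _ h').choose_spec.choose_spec.choose_spec.2.2

lemma src_comp (a b : Arr F) (h : tgt a = src b) : src (comp a b h) = src a := by
  obtain ⟨j, α, β, e, rfl, rfl⟩ := exists_composable a b h
  rw [comp_mkAr e]
  rfl

lemma tgt_comp (a b : Arr F) (h : tgt a = src b) : tgt (comp a b h) = tgt b := by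
  obtain ⟨j, α, β, e, rfl, rfl⟩ := exists_composable a b h
  rw [comp_mkAr e]
  rfl

lemma ident_comp (a : Arr F) {X : Obj F} (hX : src a = X) (h : tgt (ident X) = src a) :
    comp (ident X) a h = a := by
  obtain ⟨j, α, rfl⟩ := exists_mkAr a
  subst hX
  exact (comp_mkAr (α := Arrow.mk (𝟙 α.left)) rfl h).trans (congrArg mkAr (id_acomp α rfl))

lemma comp_ident (a : Arr F) {X : Obj F} (hX : tgt a = X) (h : tgt a = src (ident X)) :
    comp a (ident X) h = a := by
  obtain ⟨j, α, rfl⟩ := exists_mkAr a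
  subst hX
  exact (comp_mkAr (β := Arrow.mk (𝟙 α.right)) rfl h).trans (congrArg mkAr (acomp_id α rfl))

lemma comp_assoc (a b c : Arr F) (h : tgt a = src b) (h' : tgt b = src c)
    (h₁ : tgt (comp a b h) = src c) (h₂ : tgt a = src (comp b c h')) :
    comp (comp a b h) c h₁ = comp a (comp b c h') h₂ := by
  obtain ⟨j, α, β, e, rfl, rfl⟩ := exists_composable a b h
  obtain ⟨k, γ, rfl⟩ := exists_mkAr c
  obtain ⟨l, φ, ψ, e'⟩ := exists_of_mkOb_eq h'
  have e₁ : (push φ α).right = (push φ β).left := congrArg (F.map φ).toFunctor.obj e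
  simp only [← mkAr_push φ α, ← mkAr_push φ β, ← mkAr_push ψ γ]
  simp only [comp_mkAr e₁, comp_mkAr (α := push φ β) (β := push ψ γ) e']
  rw [comp_mkAr (α := acomp (push φ α) (push φ β) e₁) (β := push ψ γ) e',
    comp_mkAr (α := push φ α) (β := acomp (push φ β) (push ψ γ) e') e₁]
  exact congrArg mkAr (acomp_assoc _ _ _ _ _)

end

noncomputable instance [IsFiltered J] : Category.{u} (Obj F) where
  Hom X Y := { a : Arr F // src a = X ∧ tgt a = Y }
  id X := ⟨ident X, src_ident X, tgt_ident X⟩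
  comp f g := ⟨comp f.1 g.1 (f.2.2.trans g.2.1.symm),
    (src_comp _ _ _).trans f.2.1, (tgt_comp _ _ _).trans g.2.2⟩
  id_comp f := Subtype.ext (ident_comp _ f.2.1 ((tgt_ident _).trans f.2.1.symm))
  comp_id f := Subtype.ext (comp_ident _ f.2.2 (f.2.2.trans (src_ident _).symm))
  assoc f g h := Subtype.ext (comp_assoc f.1 g.1 h.1 (f.2.2.trans g.2.1.symm)
    (g.2.2.trans h.2.1.symm) ((tgt_comp _ _ _).trans (g.2.2.trans h.2.1.symm))
    (f.2.2.trans (g.2.1.symm.trans (src_comp _ _ _).symm)))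

variable [IsFiltered J]

/-- The functor from a category of the diagram to the colimit. -/
def incl (j : J) : (F.obj j).carrier ⥤ Obj F where
  obj x := mkOb x
  map f := ⟨mkAr (Arrow.mk f), rfl, rfl⟩
  map_id _ := rfl
  map_comp {x y z} f g := Subtype.ext (by
    refine Eq.trans ?_ (comp_mkAr (α := Arrow.mk f) (β := Arrow.mk g) rfl rfl).symm
    simp [acomp])

variable {F}

lemma arrow_mk_eq_iff {X Y X' Y' : Obj F} (f : X ⟶ Y) (g : X' ⟶ Y') :
    Arrow.mk f = Arrow.mk g ↔ f.1 = g.1 := by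
  constructor
  · intro h
    have (a : Arrow (Obj F)) : a = Arrow.mk f → a.hom.1 = f.1 := by
      rintro rfl
      rfl
    exact (this _ h.symm).symm
  · intro h
    obtain ⟨a, rfl, rfl⟩ := f
    obtain ⟨b, rfl, rfl⟩ := g
    obtain rfl : a = b := h
    rfl

lemma exists_incl_map_eq {X Y : Obj F} (f : X ⟶ Y) :
    ∃ (j : J) (α : Arrow (F.obj j).carrier), Arrow.mk f = (incl F j).mapArrow.obj α := by
  obtain ⟨j, α, hα⟩ := exists_mkAr f.1
  exact ⟨j, α, (arrow_mk_eq_iff f ((incl F j).map α.hom)).2 hα.symm⟩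

lemma map_comp_incl {j k : J} (φ : j ⟶ k) : (F.map φ).toFunctor ⋙ incl F k = incl F j :=
  functor_eq_of_arrow_mk fun f => (arrow_mk_eq_iff _ _).2 (mkAr_push φ (Arrow.mk f))

lemma exists_of_incl_mapArrow_eq {j k : J} {α : Arrow (F.obj j).carrier}
    {β : Arrow (F.obj k).carrier}
    (h : (incl F j).mapArrow.obj α = (incl F k).mapArrow.obj β) :
    ∃ (l : J) (φ : j ⟶ l) (ψ : k ⟶ l), push φ α = push ψ β :=
  exists_of_mkAr_eq ((arrow_mk_eq_iff ((incl F j).map α.hom) ((incl F k).map β.hom)).1 h)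

lemma incl_push {j k : J} (φ : j ⟶ k) (α : Arrow (F.obj j).carrier) :
    (incl F k).mapArrow.obj (push φ α) = (incl F j).mapArrow.obj α := by
  rw [← map_comp_incl φ]
  rfl

/-- The marked morphisms of the colimit. -/
def IsMarkedArr {X Y : Obj F} (f : X ⟶ Y) : Prop :=
  ∃ (j : J) (α : Arrow (F.obj j).carrier), (F.obj j).marking.marked α.hom ∧
    Arrow.mk f = (incl F j).mapArrow.obj α

/-- The motive covers varying endpoints, so a marked morphism may be replaced by the image of a
marked morphism of one stage without transports. -/
lemma isMarkedArr_ind {motive : ∀ {X Y : Obj F}, (X ⟶ Y) → Prop}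
    (h : ∀ (j : J) {x y : (F.obj j).carrier} (v : x ⟶ y), (F.obj j).marking.marked v →
      motive ((incl F j).map v)) {X Y : Obj F} {f : X ⟶ Y} (hf : IsMarkedArr f) : motive f := by
  obtain ⟨j, α, hα, e⟩ := hf
  obtain rfl : X = (incl F j).obj α.left := congrArg (fun a => a.left) e
  obtain rfl : Y = (incl F j).obj α.right := congrArg (fun a => a.right) e
  obtain rfl := Arrow.mk_injective _ _ e
  exact h j α.hom hα

/-- The marking of the colimit. -/
def marking : Marking (Obj F) where
  marked _ _ f := IsMarkedArr f
  isIso_of_marked f hf := isMarkedArr_ind (motive := fun f => IsIso f) (fun j x y v hv => by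
    have := (F.obj j).marking.isIso_of_marked v hv
    infer_instance) hf
  id_mem X := by
    obtain ⟨j, x, rfl⟩ := exists_mkOb X
    exact ⟨j, Arrow.mk (𝟙 x), (F.obj j).marking.id_mem _,
      congrArg Arrow.mk ((incl F j).map_id x).symm⟩
  comp_mem {X Y Z} f g hf hg := by
    obtain ⟨j, α, hα, e⟩ := hf
    obtain ⟨k, β, hβ, e'⟩ := hg
    have h : mkOb α.right = mkOb β.left :=
      (congrArg (fun a => a.right) e).symm.trans (congrArg (fun a => a.left) e')
    obtain ⟨l, φ, ψ, hl⟩ := exists_of_mkOb_eq h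
    refine ⟨l, acomp (push φ α) (push ψ β) hl, ?_, ?_⟩
    · exact (F.obj l).marking.comp_mem _ _ (marked_push φ α hα)
        ((F.obj l).marking.comp_mem _ _ ((F.obj l).marking.marked_eqToHom _) (marked_push ψ β hβ))
    · refine Eq.trans ?_ (mapArrow_acomp _ _ _ _).symm
      refine Eq.trans ?_ (acomp_congr (α := Arrow.mk f) (β := Arrow.mk g) (h := rfl)
        (e.trans (incl_push φ α).symm) (e'.trans (incl_push ψ β).symm))
      simp [acomp]
  inv_mem {X Y} e he := by
    -- The statement is generalized to all right inverses `g`, so that the induction can replace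
    -- `e.hom`.
    refine isMarkedArr_ind (motive := fun f => ∀ g, f ≫ g = 𝟙 _ → IsMarkedArr g)
      (fun j x y v hv g hg => ?_) he _ e.hom_inv_id
    have := (F.obj j).marking.isIso_of_marked v hv
    obtain rfl : (incl F j).map (inv v) = g := by
      rw [Functor.map_inv]
      exact IsIso.inv_eq_of_hom_inv_id hg
    exact ⟨j, Arrow.mk (inv v), (F.obj j).marking.inv_marked v hv, rfl⟩

variable (F)

/-- The colimit cocone. -/
noncomputable def cocone : Cocone F where
  pt := { carrier := Obj F, marking := marking }
  ι :=
    { app := fun j => ⟨incl F j, fun v hv => ⟨j, Arrow.mk v, hv, rfl⟩⟩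
      naturality := fun _ _ φ => MarkedCat.Hom.ext (map_comp_incl φ) }

section

variable {F} (s : Cocone F)

/-- The map on morphisms induced by a cocone. -/
def descMap {X Y : Obj F} (f : X ⟶ Y) : descOb s X ⟶ descOb s Y :=
  eqToHom (by rw [descAr_left, f.2.1]) ≫ (descAr s f.1).hom ≫
    eqToHom (by rw [descAr_right, f.2.2])

lemma arrow_mk_descMap {X Y : Obj F} (f : X ⟶ Y) :
    Arrow.mk (descMap s f) = descAr s f.1 :=
  arrow_mk_conj _ _ _

/-- The functor induced by a cocone. -/
def desc : Obj F ⥤ s.pt.carrier where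
  obj := descOb s
  map := descMap s
  map_id X := Arrow.mk_injective _ _ (by
    rw [arrow_mk_descMap]
    obtain ⟨j, x, rfl⟩ := exists_mkOb X
    exact congrArg Arrow.mk ((s.ι.app j).toFunctor.map_id x))
  map_comp {X Y Z} f g := Arrow.mk_injective _ _ (by
    rw [arrow_mk_descMap]
    obtain ⟨j, α, β, e, hα, hβ⟩ := exists_composable f.1 g.1 (f.2.2.trans g.2.1.symm)
    have h₁ : (f ≫ g).1 = mkAr (acomp α β e) := by
      refine Eq.trans ?_ (comp_mkAr e (by rw [hα, hβ, f.2.2, g.2.1]))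
      show comp f.1 g.1 (f.2.2.trans g.2.1.symm) = _
      congr 1 <;> simp [hα, hβ]
    rw [h₁, descAr_mkAr, mapArrow_acomp]
    refine (Eq.trans ?_ (acomp_congr (α := Arrow.mk (descMap s f)) (β := Arrow.mk (descMap s g))
      (h := rfl) ((arrow_mk_descMap s f).trans (by rw [← hα]; rfl))
      ((arrow_mk_descMap s g).trans (by rw [← hβ]; rfl)))).symm
    simp [acomp])

lemma incl_comp_desc (j : J) : incl F j ⋙ desc s = (s.ι.app j).toFunctor :=
  functor_eq_of_arrow_mk fun f => arrow_mk_descMap s ((incl F j).map f)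

lemma functor_ext {D : Type*} [Category D] {G H : Obj F ⥤ D}
    (h : ∀ j, incl F j ⋙ G = incl F j ⋙ H) : G = H := by
  refine functor_eq_of_arrow_mk fun f => ?_
  obtain ⟨j, α, e⟩ := exists_incl_map_eq f
  have h₁ := congrArg G.mapArrow.obj e
  have h₂ := congrArg H.mapArrow.obj e
  refine h₁.trans (Eq.trans ?_ h₂.symm)
  exact congrArg (fun K => K.mapArrow.obj α) (h j)

end

/-- The cocone is a colimit cocone. -/
noncomputable def isColimit : IsColimit (cocone F) where
  desc s := ⟨desc s, fun {X Y} f hf => by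
    refine isMarkedArr_ind (motive := fun f => s.pt.marking.marked ((desc s).map f))
      (fun j x y v hv => ?_) hf
    have h := (s.ι.app j).map_marked v hv
    have h₁ := Functor.congr_hom (incl_comp_desc s j) v
    dsimp at h₁
    rw [h₁]
    exact (Marking.marked_conj_iff _ _ _ _).2 h⟩
  fac s j := MarkedCat.Hom.ext (incl_comp_desc s j)
  uniq s m hm := MarkedCat.Hom.ext (functor_ext fun j =>
    (congrArg MarkedCat.Hom.toFunctor (hm j)).trans (incl_comp_desc s j).symm)

end FilteredColimit

end MarkedModel

namespace MarkedModel

/-! ### The four categories satisfy the axioms -/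

section

variable {A B D : Type u} [Category.{u} A] [Category.{u} B] [Category.{u} D]

/-- The marking induced on a category along a fully faithful functor. -/
def Marking.comap (M : Marking B) (P : A ⥤ B) [P.Full] [P.Faithful] : Marking A where
  marked _ _ f := M.marked (P.map f)
  isIso_of_marked f hf := by
    have := M.isIso_of_marked _ hf
    exact isIso_of_fully_faithful P f
  id_mem X := by
    rw [P.map_id]
    exact M.id_mem _
  comp_mem f g hf hg := by
    rw [P.map_comp]
    exact M.comp_mem _ _ hf hg
  inv_mem e he := M.inv_mem (P.mapIso e) he

lemma marked_map_of_comp_eq {M : Marking B} {N : Marking D} {F : A ⥤ B} {P : B ⥤ D} {G : A ⥤ D}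
    (h : F ⋙ P = G) (hP : ∀ {X Y : B} (v : X ⟶ Y), N.marked (P.map v) → M.marked v) {X Y : A}
    (v : X ⟶ Y) (hv : N.marked (G.map v)) : M.marked (F.map v) := by
  subst h
  exact hP _ hv

lemma marked_map_of_marked_trans {M : Marking B} {F G : A ⥤ B} (α : F ⟶ G)
    (hα : ∀ a, M.marked (α.app a)) {X Y : A} (v : X ⟶ Y) (hv : M.marked (F.map v)) :
    M.marked (G.map v) := by
  refine M.of_comp_left (α.app X) _ (hα X) ?_
  rw [← α.naturality]
  exact M.comp_mem _ _ hv (hα Y)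

/-- A natural transformation with marked components as an isomorphism. -/
noncomputable def isoOfMarkedTrans {M : Marking B} {F G : A ⥤ B} (α : F ⟶ G)
    (hα : ∀ a, M.marked (α.app a)) : F ≅ G :=
  have : ∀ a, IsIso (α.app a) := fun a => M.isIso_of_marked _ (hα a)
  NatIso.ofComponents (fun a => asIso (α.app a)) (fun f => α.naturality f)

lemma additive_of_comp_eq [Preadditive A] [Preadditive B] [Preadditive D] {F : A ⥤ B} {P : B ⥤ D}
    {G : A ⥤ D} (h : F ⋙ P = G) (hP : P.Additive) (hP' : P.Faithful) (hG : G.Additive) :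
    F.Additive := by
  subst h
  exact Functor.additive_of_comp_faithful F P

end

instance : MarkedTheory Cat.{u, u} where
  fn_injective _ _ h := Cat.Hom.ext h
  exists_of_comp_faithful _ _ F _ _ _ := ⟨F.toCatHom, rfl⟩
  exists_of_marked_trans _ F _ _ := ⟨F.toCatHom, rfl⟩
  exists_induced A _ T := ⟨Cat.of (InducedCategory (Und A) T), (inducedFunctor T).toCatHom,
    Equiv.refl _, ⟨InducedCategory.full T, InducedCategory.faithful T, fun v hv => by
      have : IsIso ((inducedFunctor T).map v) := hv
      exact isIso_of_fully_faithful (inducedFunctor T) v⟩, fun _ => rfl⟩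

instance : MarkedTheory MarkedCat.{u} where
  fn_injective _ _ h := MarkedCat.Hom.ext h
  exists_of_comp_faithful _ g F _ hπ h :=
    ⟨⟨F, fun v hv => marked_map_of_comp_eq h hπ v (g.map_marked v hv)⟩, rfl⟩
  exists_of_marked_trans f F α hα :=
    ⟨⟨F, fun v hv => marked_map_of_marked_trans α hα v (f.map_marked v hv)⟩, rfl⟩
  exists_induced A _ T := ⟨⟨InducedCategory A.carrier T, A.marking.comap (inducedFunctor T)⟩,
    ⟨inducedFunctor T, fun _ hv => hv⟩, Equiv.refl _,
    ⟨InducedCategory.full T, InducedCategory.faithful T, fun _ hv => hv⟩, fun _ => rfl⟩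

/-- Additivity is reflected by faithful additive functors and invariant under natural isomorphism.
Markings are automatic: fully faithful functors reflect isomorphisms. -/
instance : MarkedTheory PreAddCat.{u} where
  fn_injective _ _ h := PreAddCat.Hom.ext h
  exists_of_comp_faithful {D E A} π g F hπ _ h :=
    ⟨⟨F, additive_of_comp_eq (A := D.carrier) (B := E.carrier) (D := A.carrier) h π.additive hπ g.additive⟩, rfl⟩
  exists_of_marked_trans f F α hα :=
    ⟨⟨F, have := f.additive; Functor.additive_of_iso (isoOfMarkedTrans α hα)⟩, rfl⟩
  exists_induced A _ T := ⟨⟨InducedCategory A.carrier T⟩, ⟨inducedFunctor T, inferInstance⟩,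
    Equiv.refl _, ⟨InducedCategory.full T, InducedCategory.faithful T, fun v hv => by
      have : IsIso ((inducedFunctor T).map v) := hv
      exact isIso_of_fully_faithful (inducedFunctor T) v⟩, fun _ => rfl⟩

instance : MarkedTheory MarkedPreAddCat.{u} where
  fn_injective _ _ h := MarkedPreAddCat.Hom.ext h
  exists_of_comp_faithful {D E A} π g F hπ hπ' h :=
    ⟨⟨F, additive_of_comp_eq (A := D.carrier) (B := E.carrier) (D := A.carrier) h π.additive hπ g.additive,
      fun v hv => marked_map_of_comp_eq h hπ' v (g.map_marked v hv)⟩, rfl⟩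
  exists_of_marked_trans f F α hα :=
    ⟨⟨F, have := f.additive; Functor.additive_of_iso (isoOfMarkedTrans α hα),
      fun v hv => marked_map_of_marked_trans α hα v (f.map_marked v hv)⟩, rfl⟩
  exists_induced A _ T :=
    ⟨⟨InducedCategory A.carrier T, A.marking.comap (inducedFunctor T)⟩,
      ⟨inducedFunctor T, inferInstance, fun _ hv => hv⟩, Equiv.refl _,
      ⟨InducedCategory.full T, InducedCategory.faithful T, fun _ hv => hv⟩, fun _ => rfl⟩

end MarkedModel

namespace MarkedModel

/-! ### Limits and colimits of marked categories -/

section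

variable {A B : Type u} [Category.{u} A] [Category.{u} B]

lemma marked_map_of_eq {M : Marking B} {F G : A ⥤ B} (h : F = G) {X Y : A} (v : X ⟶ Y)
    (hv : M.marked (G.map v)) : M.marked (F.map v) := by
  subst h
  exact hv

/-- The marking consisting of the isomorphisms whose images under a family of functors
are marked. -/
def Marking.preimage {ι : Type*} {B : ι → Type u} [∀ i, Category.{u} (B i)]
    (M : ∀ i, Marking (B i)) (P : ∀ i, A ⥤ B i) : Marking A where
  marked _ _ f := IsIso f ∧ ∀ i, (M i).marked ((P i).map f)
  isIso_of_marked _ hf := hf.1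
  id_mem X := ⟨inferInstance, fun i => by
    rw [(P i).map_id]
    exact (M i).id_mem _⟩
  comp_mem f g hf hg := ⟨have := hf.1; have := hg.1; inferInstance, fun i => by
    rw [(P i).map_comp]
    exact (M i).comp_mem _ _ (hf.2 i) (hg.2 i)⟩
  inv_mem e he := ⟨inferInstance, fun i => (M i).inv_mem ((P i).mapIso e) (he.2 i)⟩

/-- The smallest marking which contains a class of isomorphisms. -/
def Marking.generate (W : MorphismProperty A) (hW : W ≤ MorphismProperty.isomorphisms A) :
    Marking A where
  marked _ _ f := ∀ M : Marking A, W ≤ M.marked → M.marked f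
  isIso_of_marked _ hf := hf (Marking.max A) hW
  id_mem X M _ := M.id_mem X
  comp_mem f g hf hg M hM := M.comp_mem f g (hf M hM) (hg M hM)
  inv_mem e he M hM := M.inv_mem e (he M hM)

lemma Marking.marked_of_mem {W : MorphismProperty A} (hW : W ≤ MorphismProperty.isomorphisms A)
    {X Y : A} (f : X ⟶ Y) (hf : W f) : (Marking.generate W hW).marked f :=
  fun _ hM => hM _ hf

/-- The isomorphisms which `G` sends into `M` form a marking that contains `W`. -/
lemma Marking.marked_map_of_generate {W : MorphismProperty A}
    (hW : W ≤ MorphismProperty.isomorphisms A) (G : A ⥤ B) (M : Marking B)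
    (h : ∀ {X Y : A} (f : X ⟶ Y), W f → M.marked (G.map f)) {X Y : A} (f : X ⟶ Y)
    (hf : (Marking.generate W hW).marked f) : M.marked (G.map f) :=
  (hf (Marking.preimage (ι := Unit) (fun _ => M) (fun _ => G))
    fun _ _ f hf => ⟨hW f hf, fun _ => h f hf⟩).2 ()

end

namespace MarkedCat

/-- The functor which forgets the marking. -/
def forget : MarkedCat.{u} ⥤ Cat.{u, u} where
  obj A := Cat.of A.carrier
  map F := F.toFunctor.toCatHom

variable {J : Type u} [Category.{u} J] (F : J ⥤ MarkedCat.{u})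

/-- The limit of the underlying categories. -/
noncomputable abbrev limitCat : Cat.{u, u} := limit (F ⋙ forget)

/-- The projections from the limit of the underlying categories. -/
noncomputable abbrev limitProj (j : J) : limitCat F ⥤ (F.obj j).carrier :=
  (limit.π (F ⋙ forget) j).toFunctor

/-- The limit cone of a diagram of marked categories. -/
noncomputable def limitCone : Cone F where
  pt :=
    { carrier := limitCat F
      marking := Marking.preimage (fun j => (F.obj j).marking) (limitProj F) }
  π :=
    { app := fun j => ⟨limitProj F j, fun _ hf => hf.2 j⟩
      naturality := fun _ _ φ => Hom.ext
        (congrArg Cat.Hom.toFunctor ((limit.cone (F ⋙ forget)).π.naturality φ)) }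

/-- The functor to the limit of the underlying categories induced by a cone. -/
noncomputable abbrev limitLift (s : Cone F) : s.pt.carrier ⥤ limitCat F :=
  (limit.lift (F ⋙ forget) (forget.mapCone s)).toFunctor

lemma limitLift_comp_limitProj (s : Cone F) (j : J) :
    limitLift F s ⋙ limitProj F j = (s.π.app j).toFunctor :=
  congrArg Cat.Hom.toFunctor (limit.lift_π (forget.mapCone s) j)

/-- The limit cone is a limit cone. -/
noncomputable def isLimitLimitCone : IsLimit (limitCone F) where
  lift s := ⟨limitLift F s, fun f hf =>
    ⟨(have := s.pt.marking.isIso_of_marked f hf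
      inferInstanceAs (IsIso ((limitLift F s).map f))), fun j =>
      marked_map_of_eq (limitLift_comp_limitProj F s j) f ((s.π.app j).map_marked f hf)⟩⟩
  fac s j := Hom.ext (limitLift_comp_limitProj F s j)
  uniq s m hm := Hom.ext (congrArg Cat.Hom.toFunctor
    (limit.hom_ext (F := F ⋙ forget) (f := m.toFunctor.toCatHom)
      (f' := limit.lift (F ⋙ forget) (forget.mapCone s)) fun j =>
      (congrArg forget.map (hm j)).trans (limit.lift_π (forget.mapCone s) j).symm))

instance : HasLimitsOfSize.{u, u} MarkedCat.{u} where
  has_limits_of_shape _ _ := ⟨fun F => ⟨⟨⟨_, isLimitLimitCone F⟩⟩⟩⟩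

/-- The colimit of the underlying categories. -/
noncomputable abbrev colimitCat : Cat.{u, u} := colimit (F ⋙ forget)

/-- The functors to the colimit of the underlying categories. -/
noncomputable abbrev colimitIncl (j : J) : (F.obj j).carrier ⥤ colimitCat F :=
  (colimit.ι (F ⋙ forget) j).toFunctor

/-- The images of marked morphisms in the colimit. -/
abbrev colimitMarked : MorphismProperty (colimitCat F) :=
  .ofHoms (fun v : Σ j, { α : Arrow (F.obj j).carrier // (F.obj j).marking.marked α.hom } =>
    (colimitIncl F v.1).map v.2.1.hom)

lemma colimitMarked_le : colimitMarked F ≤ MorphismProperty.isomorphisms _ := by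
  rw [MorphismProperty.ofHoms_le_iff]
  intro v
  have := (F.obj v.1).marking.isIso_of_marked _ v.2.2
  exact inferInstanceAs (IsIso ((colimitIncl F v.1).map v.2.1.hom))

/-- The colimit cocone of a diagram of marked categories. -/
noncomputable def colimitCocone : Cocone F where
  pt :=
    { carrier := colimitCat F
      marking := Marking.generate (colimitMarked F) (colimitMarked_le F) }
  ι :=
    { app := fun j => ⟨colimitIncl F j, fun f hf =>
        Marking.marked_of_mem (colimitMarked_le F) _ (MorphismProperty.ofHoms.mk
          (⟨j, Arrow.mk f, hf⟩ : Σ j, { α : Arrow (F.obj j).carrier //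
            (F.obj j).marking.marked α.hom }))⟩
      naturality := fun _ _ φ => Hom.ext
        (congrArg Cat.Hom.toFunctor ((colimit.cocone (F ⋙ forget)).ι.naturality φ)) }

/-- The functor from the colimit of the underlying categories induced by a cocone. -/
noncomputable abbrev colimitDesc (s : Cocone F) : colimitCat F ⥤ s.pt.carrier :=
  (colimit.desc (F ⋙ forget) (forget.mapCocone s)).toFunctor

lemma colimitIncl_comp_colimitDesc (s : Cocone F) (j : J) :
    colimitIncl F j ⋙ colimitDesc F s = (s.ι.app j).toFunctor :=
  congrArg Cat.Hom.toFunctor (colimit.ι_desc (forget.mapCocone s) j)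

/-- The colimit cocone is a colimit cocone. -/
noncomputable def isColimitColimitCocone : IsColimit (colimitCocone F) where
  desc s := ⟨colimitDesc F s, fun f hf => by
    refine Marking.marked_map_of_generate (colimitMarked_le F) _ s.pt.marking ?_ f hf
    rintro _ _ _ ⟨j, α, hα⟩
    exact marked_map_of_eq (colimitIncl_comp_colimitDesc F s j) α.hom
      ((s.ι.app j).map_marked _ hα)⟩
  fac s j := Hom.ext (colimitIncl_comp_colimitDesc F s j)
  uniq s m hm := Hom.ext (congrArg Cat.Hom.toFunctor
    (colimit.hom_ext (F := F ⋙ forget) (f := m.toFunctor.toCatHom)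
      (f' := colimit.desc (F ⋙ forget) (forget.mapCocone s)) fun j =>
      (congrArg forget.map (hm j)).trans (colimit.ι_desc (forget.mapCocone s) j).symm))

instance : HasColimitsOfSize.{u, u} MarkedCat.{u} where
  has_colimits_of_shape _ _ := ⟨fun F => ⟨⟨⟨_, isColimitColimitCocone F⟩⟩⟩⟩

end MarkedCat

end MarkedModel

namespace MarkedModel

/-! ### Generators of the category of marked categories -/

/-- The minimal marking: only identities are marked. -/
def Marking.min (A : Type u) [Category.{u} A] : Marking A where
  marked X Y f := ∃ h : X = Y, f = eqToHom h
  isIso_of_marked := by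
    rintro _ _ _ ⟨rfl, rfl⟩
    infer_instance
  id_mem _ := ⟨rfl, rfl⟩
  comp_mem := by
    rintro _ _ _ _ _ ⟨rfl, rfl⟩ ⟨rfl, rfl⟩
    exact ⟨rfl, by simp⟩
  inv_mem {X Y} e he := by
    obtain ⟨h, he⟩ := he
    refine ⟨h.symm, ?_⟩
    rw [← cancel_epi e.hom, e.hom_inv_id, he]
    simp

namespace MarkedCat

/-- A category with the minimal marking. -/
abbrev free (A : Type u) [Category.{u} A] : MarkedCat.{u} := ⟨A, Marking.min A⟩

/-- The morphism from a minimally marked category given by a functor. -/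
def freeHom {A : Type u} [Category.{u} A] {B : MarkedCat.{u}} (G : A ⥤ B.carrier) : free A ⟶ B :=
  ⟨G, by
    rintro _ _ _ ⟨rfl, rfl⟩
    rw [eqToHom_refl, G.map_id]
    exact B.marking.id_mem _⟩

end MarkedCat

/-- An arrow of a category generates it if each arrow is a composition of this arrow and its
inverse. -/
def Generates {X : Type*} [Category X] (a : Arrow X) : Prop :=
  ∀ {x y : X} (v : x ⟶ y), Arrow.mk v = Arrow.mk (𝟙 a.left) ∨ Arrow.mk v = Arrow.mk (𝟙 a.right) ∨
    Arrow.mk v = a ∨ ∃ _ : IsIso a.hom, Arrow.mk v = Arrow.mk (inv a.hom)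

lemma Generates.functor_ext {X Y : Type*} [Category X] [Category Y] {a : Arrow X}
    (ha : Generates a) {G H : X ⥤ Y} (h : G.mapArrow.obj a = H.mapArrow.obj a) : G = H := by
  refine functor_eq_of_arrow_mk fun v => ?_
  have key : G.mapArrow.obj (Arrow.mk v) = H.mapArrow.obj (Arrow.mk v) := by
    have hl : G.obj a.left = H.obj a.left := congrArg (fun b => b.left) h
    have hr : G.obj a.right = H.obj a.right := congrArg (fun b => b.right) h
    rcases ha v with e | e | e | ⟨_, e⟩
    · rw [e]
      simpa [Functor.mapArrow] using arrow_mk_id_congr hl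
    · rw [e]
      simpa [Functor.mapArrow] using arrow_mk_id_congr hr
    · rw [e, h]
    · rw [e]
      simpa [Functor.mapArrow] using arrow_mk_inv_congr (f := G.map a.hom) (f' := H.map a.hom) h
  exact key

/-- The category `0 ⟶ 1`. -/
abbrev WalkingArrow : Type u := ULift.{u} (Fin 2)

/-- The arrow of the category `0 ⟶ 1`. -/
def WalkingArrow.gen : Arrow WalkingArrow.{u} :=
  Arrow.mk (homOfLE (show (ULift.up 0 : WalkingArrow.{u}) ≤ ULift.up 1 from Fin.zero_le _))

lemma WalkingArrow.generates : Generates WalkingArrow.gen.{u} := by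
  rintro ⟨x⟩ ⟨y⟩ v
  have hv : ULift.up x ≤ ULift.up y := leOfHom v
  obtain rfl : v = homOfLE hv := Subsingleton.elim _ _
  fin_cases x <;> fin_cases y
  · exact Or.inl rfl
  · exact Or.inr (Or.inr (Or.inl rfl))
  · exact absurd hv (by decide)
  · exact Or.inr (Or.inl rfl)

/-- The functor given by a morphism. -/
def WalkingArrow.functor {X : Type*} [Category X] (a : Arrow X) : WalkingArrow.{u} ⥤ X :=
  Monotone.functor (f := ULift.down) (fun _ _ h => h) ⋙ ComposableArrows.mk₁ a.hom

lemma WalkingArrow.exists_eq_obj (x : WalkingArrow.{u}) : x = gen.left ∨ x = gen.right := by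
  obtain ⟨x⟩ := x
  fin_cases x
  · exact Or.inl rfl
  · exact Or.inr rfl

/-- The category which consists of an isomorphism. -/
def WalkingMarkedIso : Type u := ULift.{u} Bool

namespace WalkingMarkedIso

instance : Category.{u} WalkingMarkedIso.{u} where
  Hom _ _ := PUnit.{u + 1}
  id _ := ⟨⟩
  comp _ _ := ⟨⟩

/-- The generating arrow of the walking isomorphism. -/
def gen : Arrow WalkingMarkedIso.{u} := Arrow.mk (X := ⟨false⟩) (Y := ⟨true⟩) ⟨⟩

instance : IsIso gen.{u}.hom := ⟨⟨⟩, rfl, rfl⟩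

lemma generates : Generates gen.{u} := by
  rintro ⟨_ | _⟩ ⟨_ | _⟩ v
  · exact Or.inl rfl
  · exact Or.inr (Or.inr (Or.inl rfl))
  · exact Or.inr (Or.inr (Or.inr ⟨inferInstance, rfl⟩))
  · exact Or.inr (Or.inl rfl)

variable {X : Type*} [Category X]

/-- The functor given by an isomorphism. -/
def functor {x y : X} (e : x ≅ y) : WalkingMarkedIso.{u} ⥤ X where
  obj z := match z with
    | ⟨false⟩ => x
    | ⟨true⟩ => y
  map {z w} _ := match z, w with
    | ⟨false⟩, ⟨false⟩ => 𝟙 x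
    | ⟨false⟩, ⟨true⟩ => e.hom
    | ⟨true⟩, ⟨false⟩ => e.inv
    | ⟨true⟩, ⟨true⟩ => 𝟙 y
  map_id := by
    rintro ⟨_ | _⟩ <;> rfl
  map_comp := by
    rintro ⟨_ | _⟩ ⟨_ | _⟩ ⟨_ | _⟩ _ _ <;> simp

end WalkingMarkedIso

namespace MarkedCat

/-- The minimally marked category `0 ⟶ 1`. -/
abbrev arrowCat : MarkedCat.{u} := free WalkingArrow.{u}

/-- The maximally marked walking isomorphism. -/
abbrev isoCat : MarkedCat.{u} := ⟨WalkingMarkedIso.{u}, Marking.max _⟩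

variable {B : MarkedCat.{u}}

/-- The morphism given by a marked isomorphism. -/
noncomputable def isoCatHom {x y : B.carrier} (v : x ⟶ y) (hv : B.marking.marked v) :
    isoCat ⟶ B :=
  ⟨WalkingMarkedIso.functor (B.marking.toIso v hv), by
    rintro ⟨_ | _⟩ ⟨_ | _⟩ _ _
    · exact B.marking.id_mem _
    · exact hv
    · exact B.marking.toIso_inv_marked v hv
    · exact B.marking.id_mem _⟩

lemma marked_gen : isoCat.{u}.marking.marked WalkingMarkedIso.gen.hom :=
  inferInstanceAs (IsIso WalkingMarkedIso.gen.hom)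

end MarkedCat

open Cardinal in
/-- A marked category which corepresents the arrows, or the marked arrows, is finitely
presentable. -/
lemma isCardinalPresentable_of_generates (G : MarkedCat.{u}) (a : Arrow G.carrier)
    (ha : Generates a) (b : Prop) (hb : b → G.marking.marked a.hom)
    (h : ∀ (B : MarkedCat.{u}) (v : Arrow B.carrier), (b → B.marking.marked v.hom) →
      ∃ f : G ⟶ B, f.toFunctor.mapArrow.obj a = v) :
    letI := fact_isRegular_aleph0.{u}
    IsCardinalPresentable G ℵ₀ := by
  have := fact_isRegular_aleph0.{u}
  refine ⟨fun J _ _ => ⟨fun {F} => ?_⟩⟩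
  have : IsFiltered J := isFiltered_of_isCardinalFiltered J ℵ₀
  refine preservesColimit_of_preserves_colimit_cocone (FilteredColimit.isColimit F)
    (Types.FilteredColimit.isColimitOf _ _ (fun g => ?_) (fun i j f g hfg => ?_))
  -- The proposition `b` tells marked arrows from arbitrary ones. In either case the image of the
  -- generator comes from one stage, with its marking if required.
  · obtain ⟨j, α, hα, e⟩ : ∃ (j : J) (α : Arrow (F.obj j).carrier),
        (b → (F.obj j).marking.marked α.hom) ∧
        g.toFunctor.mapArrow.obj a = (FilteredColimit.incl F j).mapArrow.obj α := by
      by_cases hb' : b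
      · obtain ⟨j, α, hα, e⟩ := g.map_marked _ (hb hb')
        exact ⟨j, α, fun _ => hα, e⟩
      · obtain ⟨j, α, e⟩ := FilteredColimit.exists_incl_map_eq (F := F) (g.toFunctor.map a.hom)
        exact ⟨j, α, fun h => (hb' h).elim, e⟩
    obtain ⟨f, hf⟩ := h _ α hα
    refine ⟨j, f, MarkedCat.Hom.ext (ha.functor_ext (e.trans ?_))⟩
    rw [← hf]
    rfl
  · obtain ⟨k, φ, ψ, e⟩ := FilteredColimit.exists_of_incl_mapArrow_eq (F := F)
      (α := f.toFunctor.mapArrow.obj a) (β := g.toFunctor.mapArrow.obj a)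
      (congrArg (fun q : G ⟶ (FilteredColimit.cocone F).pt => q.toFunctor.mapArrow.obj a) hfg)
    exact ⟨k, φ, ψ, MarkedCat.Hom.ext (ha.functor_ext e)⟩

end MarkedModel

namespace MarkedModel

/-! ### Generating cofibrations and trivial cofibrations -/

namespace MarkedCat

lemma exists_lift {A B X Y : MarkedCat.{u}} {i : A ⟶ B} {p : X ⟶ Y} [HasLiftingProperty i p]
    {t : A ⟶ X} {b : B ⟶ Y} (sq : t ≫ p = i ≫ b) : ∃ l : B ⟶ X, i ≫ l = t ∧ l ≫ p = b :=
  have sq : CommSq t i p b := ⟨sq⟩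
  ⟨sq.lift, sq.fac_left, sq.fac_right⟩

lemma hom_ext_of_discrete {S : Type u} {B : MarkedCat.{u}} {f g : free (Discrete S) ⟶ B}
    (h : ∀ s, f.toFunctor.obj ⟨s⟩ = g.toFunctor.obj ⟨s⟩) : f = g :=
  Hom.ext (Discrete.functor_ext h)

/-- The morphism from a discrete category given by a family of objects. -/
abbrev discreteHom {S : Type u} {B : MarkedCat.{u}} (x : S → B.carrier) : free (Discrete S) ⟶ B :=
  freeHom (Discrete.functor x)

/-- The inclusion of the empty category in the category with one object. -/
def emptyHom : free (Discrete PEmpty.{u + 1}) ⟶ free (Discrete PUnit.{u + 1}) :=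
  discreteHom PEmpty.elim

/-- The inclusion of the endpoints of an arrow. -/
def endpoints : free (Discrete WalkingArrow.{u}) ⟶ arrowCat.{u} :=
  discreteHom id

/-- The morphism which identifies two parallel arrows. -/
noncomputable def fold : pushout endpoints.{u} endpoints.{u} ⟶ arrowCat.{u} :=
  pushout.desc (𝟙 _) (𝟙 _) rfl

lemma inl_fold_comp {Z : MarkedCat.{u}} (b : arrowCat ⟶ Z) :
    pushout.inl _ _ ≫ fold ≫ b = b := by
  rw [← Category.assoc]
  exact (congrArg (· ≫ b) (pushout.inl_desc _ _ _)).trans (Category.id_comp b)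

lemma inr_fold_comp {Z : MarkedCat.{u}} (b : arrowCat ⟶ Z) :
    pushout.inr _ _ ≫ fold ≫ b = b := by
  rw [← Category.assoc]
  exact (congrArg (· ≫ b) (pushout.inr_desc _ _ _)).trans (Category.id_comp b)

/-- The morphism which marks an isomorphism. -/
def mark : free WalkingMarkedIso.{u} ⟶ isoCat.{u} := freeHom (𝟭 _)

/-- The inclusion of an endpoint of a marked isomorphism. -/
def isoEndpoint : free (Discrete PUnit.{u + 1}) ⟶ isoCat.{u} :=
  discreteHom fun _ => WalkingMarkedIso.gen.left

/-- The generating cofibrations. -/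
noncomputable def generatingCofibrations : Fin 4 → Arrow MarkedCat.{u} :=
  ![Arrow.mk emptyHom, Arrow.mk endpoints, Arrow.mk fold, Arrow.mk mark]

variable {X Y : MarkedCat.{u}} (p : X ⟶ Y)

lemma surjective_of_hasLiftingProperty [HasLiftingProperty emptyHom p] :
    Function.Surjective p.toFunctor.obj := by
  intro y
  obtain ⟨l, -, hl⟩ := exists_lift (i := emptyHom) (p := p) (t := discreteHom PEmpty.elim)
    (b := discreteHom fun _ => y) (hom_ext_of_discrete fun s => s.elim)
  exact ⟨l.toFunctor.obj ⟨⟨⟩⟩, congrArg (fun f => f.toFunctor.obj ⟨⟨⟩⟩) hl⟩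

lemma full_of_hasLiftingProperty [HasLiftingProperty endpoints p] : p.toFunctor.Full where
  map_surjective {x x'} v := by
    obtain ⟨l, hl, hl'⟩ := exists_lift (i := endpoints) (p := p)
      (t := discreteHom fun a => ![x, x'] a.down)
      (b := freeHom (WalkingArrow.functor (Arrow.mk v))) (hom_ext_of_discrete fun s => by
        rcases WalkingArrow.exists_eq_obj s with rfl | rfl <;> rfl)
    have h₁ : l.toFunctor.obj WalkingArrow.gen.left = x :=
      congrArg (fun f => f.toFunctor.obj ⟨WalkingArrow.gen.left⟩) hl
    have h₂ : l.toFunctor.obj WalkingArrow.gen.right = x' :=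
      congrArg (fun f => f.toFunctor.obj ⟨WalkingArrow.gen.right⟩) hl
    have h₃ : p.toFunctor.mapArrow.obj (l.toFunctor.mapArrow.obj WalkingArrow.gen) = Arrow.mk v :=
      congrArg (fun f => f.toFunctor.mapArrow.obj WalkingArrow.gen) hl'
    subst h₁ h₂
    exact ⟨_, Arrow.mk_injective _ _ h₃⟩

/-- Parallel arrows with the same image form a lifting problem against `fold`, and a solution equals
both of them. -/
lemma faithful_of_hasLiftingProperty [HasLiftingProperty fold p] : p.toFunctor.Faithful where
  map_injective {x x' v v'} h := by
    let f (v : x ⟶ x') : arrowCat ⟶ X := freeHom (WalkingArrow.functor (Arrow.mk v))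
    have hf : endpoints ≫ f v = endpoints ≫ f v' := hom_ext_of_discrete fun s => by
      rcases WalkingArrow.exists_eq_obj s with rfl | rfl <;> rfl
    have hp : f v ≫ p = f v' ≫ p := Hom.ext (WalkingArrow.generates.functor_ext
      (congrArg Arrow.mk h))
    obtain ⟨l, hl, -⟩ := exists_lift (i := fold) (p := p) (t := pushout.desc (f v) (f v') hf)
      (b := f v ≫ p) (by
        apply pushout.hom_ext
        · rw [inl_fold_comp, ← Category.assoc]
          exact congrArg (· ≫ p) (pushout.inl_desc _ _ _)
        · rw [inr_fold_comp, ← Category.assoc, hp]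
          exact congrArg (· ≫ p) (pushout.inr_desc _ _ _))
    have h₁ : l = f v := (inl_fold_comp l).symm.trans
      ((congrArg (pushout.inl _ _ ≫ ·) hl).trans (pushout.inl_desc _ _ _))
    have h₂ : l = f v' := (inr_fold_comp l).symm.trans
      ((congrArg (pushout.inr _ _ ≫ ·) hl).trans (pushout.inr_desc _ _ _))
    exact Arrow.mk_injective _ _ (congrArg
      (fun f : arrowCat ⟶ X => f.toFunctor.mapArrow.obj WalkingArrow.gen) (h₁.symm.trans h₂))

lemma marked_of_hasLiftingProperty [HasLiftingProperty mark p] {x y : X.carrier} (v : x ⟶ y)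
    [IsIso v] (hv : Y.marking.marked (p.toFunctor.map v)) : X.marking.marked v := by
  obtain ⟨l, hl, -⟩ := exists_lift (i := mark) (p := p)
    (t := freeHom (WalkingMarkedIso.functor (asIso v))) (b := isoCatHom _ hv)
    (Hom.ext (WalkingMarkedIso.generates.functor_ext rfl))
  have h : l.toFunctor = WalkingMarkedIso.functor (asIso v) := congrArg Hom.toFunctor hl
  have h' : X.marking.marked (l.toFunctor.map WalkingMarkedIso.gen.hom) :=
    l.map_marked _ marked_gen
  exact marked_map_of_eq h.symm WalkingMarkedIso.gen.hom h'

lemma hasLiftingProperty_of_cofibrations {A B : MarkedCat.{u}} {i : A ⟶ B}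
    (hi : Function.Injective i.toFunctor.obj) {p : X ⟶ Y} (hp : trivialFibrations MarkedCat.{u} p) :
    HasLiftingProperty i p where
  sq_hasLift {t b} sq := by
    obtain ⟨h₁, h₂⟩ := (trivialFibrations_iff p).1 hp
    obtain ⟨l, hl, hl'⟩ := exists_lift_of_isFullyFaithful (i := i) hi h₁ h₂ t b sq.w
    exact ⟨⟨l, hl, hl'⟩⟩

/-- The two legs of `t` agree on objects and after `p`, hence agree. Arguing directly avoids a
description of the objects of the pushout. -/
lemma hasLiftingProperty_fold {p : X ⟶ Y} (hp : (fn p).Faithful) : HasLiftingProperty fold p where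
  sq_hasLift {t b} sq := by
    have h : pushout.inl _ _ ≫ t = pushout.inr _ _ ≫ t := by
      refine hom_ext_of_faithful p hp ?_ fun d => ?_
      · rw [Category.assoc, Category.assoc, sq.w, inl_fold_comp, inr_fold_comp]
      · have := congrArg (· ≫ t) (pushout.condition (f := endpoints.{u}) (g := endpoints.{u}))
        simp only [Category.assoc] at this
        exact congrArg (fun f => f.toFunctor.obj ⟨d⟩) this
    refine ⟨⟨pushout.inl _ _ ≫ t, ?_, ?_⟩⟩
    · apply pushout.hom_ext
      · exact inl_fold_comp _
      · exact (inr_fold_comp _).trans h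
    · rw [Category.assoc, sq.w, inl_fold_comp]

/-- The four generators detect, in order, surjectivity on objects, fullness, faithfulness and
reflection of markings. -/
lemma trivialFibrations_iff_generatingCofibrations :
    trivialFibrations MarkedCat.{u} p ↔
      ∀ i, HasLiftingProperty (generatingCofibrations i).hom p := by
  constructor
  · intro hp i
    fin_cases i
    · exact hasLiftingProperty_of_cofibrations (i := emptyHom) (fun x => PEmpty.elim x.as) hp
    · exact hasLiftingProperty_of_cofibrations (fun _ _ h => Discrete.ext h) hp
    · exact hasLiftingProperty_fold ((trivialFibrations_iff p).1 hp).1.faithful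
    · exact hasLiftingProperty_of_cofibrations (fun _ _ h => h) hp
  · intro h
    have h₀ : HasLiftingProperty emptyHom p := h 0
    have h₁ : HasLiftingProperty endpoints p := h 1
    have h₂ : HasLiftingProperty fold p := h 2
    have h₃ : HasLiftingProperty mark p := h 3
    have := full_of_hasLiftingProperty p
    have := faithful_of_hasLiftingProperty p
    refine (trivialFibrations_iff p).2 ⟨⟨full_of_hasLiftingProperty p,
      faithful_of_hasLiftingProperty p, fun {x y} v hv => ?_⟩, surjective_of_hasLiftingProperty p⟩
    -- The generator `mark` only tests isomorphisms, so `v` must first be shown invertible.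
    have hv' : IsIso (p.toFunctor.map v) := Y.marking.isIso_of_marked _ hv
    have : IsIso v := isIso_of_fully_faithful p.toFunctor v
    exact marked_of_hasLiftingProperty p v hv

lemma markedIsofibrations_iff_isoEndpoint :
    markedIsofibrations MarkedCat.{u} p ↔ HasLiftingProperty isoEndpoint p := by
  rw [markedIsofibrations_iff]
  constructor
  · intro hp
    refine ⟨fun {t b} sq => ?_⟩
    have e : p.toFunctor.obj (t.toFunctor.obj ⟨⟨⟩⟩) = b.toFunctor.obj WalkingMarkedIso.gen.left :=
      congrArg (fun f => f.toFunctor.obj ⟨⟨⟩⟩) sq.w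
    obtain ⟨c, v, hv, h⟩ := hp (t.toFunctor.obj ⟨⟨⟩⟩) _
      (eqToHom e ≫ b.toFunctor.map WalkingMarkedIso.gen.hom)
      (Y.marking.comp_mem _ _ (Y.marking.marked_eqToHom e) (b.map_marked _ marked_gen))
    rw [Arrow.arrow_mk_eqToHom_comp] at h
    exact ⟨⟨isoCatHom v hv, hom_ext_of_discrete fun _ => rfl,
      Hom.ext (WalkingMarkedIso.generates.functor_ext h)⟩⟩
  · intro _ c d w hw
    obtain ⟨l, hl, hl'⟩ := exists_lift (i := isoEndpoint) (p := p) (t := discreteHom fun _ => c)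
      (b := isoCatHom w hw) (hom_ext_of_discrete fun _ => rfl)
    have e : l.toFunctor.obj WalkingMarkedIso.gen.left = c :=
      congrArg (fun f => f.toFunctor.obj ⟨⟨⟩⟩) hl
    subst e
    exact ⟨_, l.toFunctor.map WalkingMarkedIso.gen.hom, l.map_marked _ marked_gen,
      congrArg (fun f => f.toFunctor.mapArrow.obj WalkingMarkedIso.gen) hl'⟩

end MarkedCat

end MarkedModel

namespace MarkedModel

/-! ### Combinatorial model categories -/

/-- In a locally presentable category every source is presentable; for finitely many sources a
common successor cardinal, hence a regular one, serves all of them. -/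
lemma hasSmallObjectArgument_ofHoms {C : Type (u + 1)} [Category.{u} C]
    [HasColimitsOfSize.{u, u} C] [IsLocallyPresentable.{u} C] {ι : Type u} [Finite ι]
    {A B : ι → C} (f : ∀ i, A i ⟶ B i) :
    (MorphismProperty.ofHoms f).HasSmallObjectArgument.{u} := by
  have h (i : ι) : ∃ (κ : Cardinal.{u}) (_ : Fact κ.IsRegular), IsCardinalPresentable (A i) κ :=
    Functor.IsAccessible.exists_cardinal
  choose κ₀ hκ₀ hA using h
  obtain ⟨M, hM⟩ := Finite.exists_le κ₀
  let κ : Cardinal.{u} := Order.succ (max Cardinal.aleph0 M)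
  have hκ : κ.IsRegular := Cardinal.isRegular_succ (le_max_left _ _)
  have : Fact κ.IsRegular := ⟨hκ⟩
  have : Nonempty κ.ord.ToType := by simpa using hκ.ne_zero
  have := WellFoundedLT.toOrderBot κ.ord.ToType
  have hA' (i : ι) : IsCardinalPresentable (A i) κ :=
    isCardinalPresentable_of_le _ (((hM i).trans (le_max_right _ _)).trans (Order.le_succ _))
  refine ⟨κ, inferInstance, inferInstance, { preservesColimit := ?_ }⟩
  rintro _ _ X Y i ⟨i⟩ f hf
  have := preservesColimitsOfShape_of_isCardinalPresentable (A i) κ κ.ord.ToType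
  infer_instance

namespace MarkedCat

/-- The marked categories which corepresent arrows and marked arrows. -/
def generators : ULift.{u} Bool → MarkedCat.{u} := fun b => cond b.down arrowCat isoCat

lemma isCardinalPresentable_generators (b : ULift.{u} Bool) :
    letI := Cardinal.fact_isRegular_aleph0.{u}
    IsCardinalPresentable (generators b) Cardinal.aleph0 := by
  obtain ⟨_ | _⟩ := b
  · exact isCardinalPresentable_of_generates isoCat _ WalkingMarkedIso.generates True
      (fun _ => marked_gen) fun B v hv => ⟨isoCatHom v.hom (hv trivial), rfl⟩
  · exact isCardinalPresentable_of_generates arrowCat _ WalkingArrow.generates False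
      (fun h => h.elim) fun B v _ => ⟨freeHom (WalkingArrow.functor v), rfl⟩

variable {X Y : MarkedCat.{u}}

lemma hom_ext_of_arrowCat {f g : X ⟶ Y} (h : ∀ a : arrowCat ⟶ X, a ≫ f = a ≫ g) : f = g :=
  Hom.ext (functor_eq_of_arrow_mk fun v => congrArg
    (fun q => q.toFunctor.mapArrow.obj WalkingArrow.gen)
    (h (freeHom (WalkingArrow.functor (Arrow.mk v)))))

lemma mapArrow_injective_of_mono (i : X ⟶ Y) [Mono i] :
    Function.Injective i.toFunctor.mapArrow.obj := by
  intro a b h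
  have e : (freeHom (WalkingArrow.functor a) : arrowCat ⟶ X) ≫ i =
      freeHom (WalkingArrow.functor b) ≫ i :=
    Hom.ext (WalkingArrow.generates.functor_ext h)
  exact congrArg (fun q => q.toFunctor.mapArrow.obj WalkingArrow.gen) ((cancel_mono i).1 e)

end MarkedCat

section

variable {C : Type (u + 1)} [Category.{u} C] [HasMarked C]

/-- A monomorphism is injective on arrows, as arrows are corepresented by `arrowCat`. The hypothesis
adds surjectivity on arrows and on marked arrows. -/
lemma isFullyFaithful_of_surjective_comp {X Y : C} (i : X ⟶ Y)
    [Mono ((HasMarked.und (C := C)).map i)]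
    (h : ∀ b, Function.Surjective fun f : MarkedCat.generators b ⟶ HasMarked.und.obj X =>
      f ≫ HasMarked.und.map i) :
    IsFullyFaithful i ∧ Function.Surjective (fn i).obj := by
  have inj : Function.Injective (fn i).mapArrow.obj := MarkedCat.mapArrow_injective_of_mono _
  have inj' : Function.Injective (fn i).obj := fun x y e =>
    congrArg (·.left) (@inj (Arrow.mk (𝟙 x)) (Arrow.mk (𝟙 y)) (by
      simpa [Functor.mapArrow] using arrow_mk_id_congr e))
  have surj (v : Arrow (Und Y)) : ∃ a, (fn i).mapArrow.obj a = v := by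
    obtain ⟨f, hf⟩ := h ⟨true⟩ (MarkedCat.freeHom (WalkingArrow.functor v))
    exact ⟨f.toFunctor.mapArrow.obj WalkingArrow.gen,
      congrArg (fun q : MarkedCat.arrowCat ⟶ HasMarked.und.obj Y =>
        q.toFunctor.mapArrow.obj WalkingArrow.gen) hf⟩
  refine ⟨⟨⟨fun {x y} v => ?_⟩, ⟨fun {x y v w} e => ?_⟩, fun {x y} v hv => ?_⟩, fun y => ?_⟩
  · obtain ⟨a, ha⟩ := surj (Arrow.mk v)
    obtain rfl := inj' (congrArg (·.left) ha : (fn i).obj a.left = (fn i).obj x)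
    obtain rfl := inj' (congrArg (·.right) ha : (fn i).obj a.right = (fn i).obj y)
    exact ⟨a.hom, Arrow.mk_injective _ _ ha⟩
  · exact Arrow.mk_injective _ _ (inj (congrArg Arrow.mk e))
  · obtain ⟨f, hf⟩ := h ⟨false⟩ (MarkedCat.isoCatHom _ hv)
    have e : f.toFunctor.mapArrow.obj WalkingMarkedIso.gen = Arrow.mk v :=
      inj (congrArg (fun q : MarkedCat.isoCat ⟶ HasMarked.und.obj Y =>
        q.toFunctor.mapArrow.obj WalkingMarkedIso.gen) hf)
    have hm : IsMarked X (f.toFunctor.mapArrow.obj WalkingMarkedIso.gen).hom :=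
      f.map_marked _ MarkedCat.marked_gen
    rw [e] at hm
    exact hm
  · obtain ⟨a, ha⟩ := surj (Arrow.mk (𝟙 y))
    exact ⟨a.left, congrArg (·.left) ha⟩

variable [MarkedTheory C]

/-- The identity of the target lifts along `i`, which gives a section, and a split monic morphism of
this kind is invertible. -/
lemma isIso_of_isFullyFaithful {X Y : C} (i : X ⟶ Y) [Mono i] (h : IsFullyFaithful i)
    (h' : Function.Surjective (fn i).obj) : IsIso i := by
  choose t ht using h'
  obtain ⟨s, hs, -⟩ := h.exists_lift (𝟙 Y) t fun d => by rw [ht, fn_id_obj]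
  have : IsSplitEpi i := ⟨⟨⟨s, hs⟩⟩⟩
  exact isIso_of_mono_of_isSplitEpi i

lemma trivialFibrations_iff_und {X Y : C} (p : X ⟶ Y) :
    trivialFibrations C p ↔ trivialFibrations MarkedCat.{u} (HasMarked.und.map p) := by
  rw [trivialFibrations_iff, trivialFibrations_iff]
  exact ⟨fun ⟨h, h'⟩ => ⟨⟨h.full, h.faithful, h.reflects⟩, h'⟩,
    fun ⟨h, h'⟩ => ⟨⟨h.full, h.faithful, h.reflects⟩, h'⟩⟩

variable (C) [(HasMarked.und (C := C)).IsRightAdjoint]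

/-- By adjunction, morphisms out of these objects are the arrows and the marked arrows of the
underlying marked category. They separate morphisms and detect isomorphisms among monomorphisms. -/
lemma isStrongGenerator_leftAdjoint_generators :
    (ObjectProperty.ofObj fun b => (HasMarked.und (C := C)).leftAdjoint.obj
      (MarkedCat.generators b)).IsStrongGenerator := by
  have adj := Adjunction.ofIsRightAdjoint (HasMarked.und (C := C))
  rw [ObjectProperty.isStrongGenerator_iff]
  constructor
  · intro X Y f g h
    have e : HasMarked.und.map f = HasMarked.und.map g :=
      MarkedCat.hom_ext_of_arrowCat fun a => by
        apply (adj.homEquiv _ _).symm.injective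
        rw [adj.homEquiv_naturality_right_symm, adj.homEquiv_naturality_right_symm]
        exact h _ (ObjectProperty.ofObj_apply _ ⟨true⟩) _
    exact MarkedTheory.fn_injective _ _ (congrArg MarkedCat.Hom.toFunctor e)
  · intro X Y i _ h
    obtain ⟨h₁, h₂⟩ := isFullyFaithful_of_surjective_comp i fun b g => by
      obtain ⟨f, hf⟩ := h _ (ObjectProperty.ofObj_apply _ b) ((adj.homEquiv _ _).symm g)
      refine ⟨adj.homEquiv _ _ f, ?_⟩
      have := adj.homEquiv_naturality_right f i
      exact this.symm.trans ((Equiv.eq_symm_apply _).1 hf)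
    exact isIso_of_isFullyFaithful i h₁ h₂

variable [HasColimitsOfSize.{u, u} C]
  [PreservesFilteredColimitsOfSize.{u, u} (HasMarked.und (C := C))]

/-- A left adjoint preserves finite presentability when its right adjoint preserves filtered
colimits, so the strong generator consists of finitely presentable objects. -/
lemma isLocallyPresentable : IsLocallyPresentable.{u} C := by
  have := Cardinal.fact_isRegular_aleph0.{u}
  refine ⟨Cardinal.aleph0, inferInstance,
    (IsCardinalLocallyPresentable.iff_exists_isStrongGenerator C Cardinal.aleph0).2
      ⟨_, inferInstance, isStrongGenerator_leftAdjoint_generators C, ?_⟩⟩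
  rintro _ ⟨b⟩
  have : (HasMarked.und (C := C)).IsCardinalAccessible Cardinal.aleph0 := ⟨fun J _ _ => by
    have : IsFiltered J := isFiltered_of_isCardinalFiltered J Cardinal.aleph0
    exact PreservesFilteredColimitsOfSize.preserves_filtered_colimits J⟩
  have := MarkedCat.isCardinalPresentable_generators b
  exact (Adjunction.ofIsRightAdjoint (HasMarked.und (C := C))).isCardinalPresentable_leftAdjoint_obj
    Cardinal.aleph0 (MarkedCat.generators b)

/-- Both classes of fibrations are detected on underlying marked categories, and the adjunction
transfers lifting properties to the images of the generators. -/
lemma isCombinatorial : IsCombinatorial C := by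
  have hC : IsLocallyPresentable.{u} C := isLocallyPresentable C
  have adj := Adjunction.ofIsRightAdjoint (HasMarked.und (C := C))
  refine ⟨⟨_, _, hasSmallObjectArgument_ofHoms fun i : ULift.{u} (Fin 4) =>
      HasMarked.und.leftAdjoint.map (MarkedCat.generatingCofibrations i.down).hom,
    hasSmallObjectArgument_ofHoms fun _ : PUnit.{u + 1} =>
      HasMarked.und.leftAdjoint.map MarkedCat.isoEndpoint, ?_, ?_⟩, hC⟩
  · ext X Y p
    rw [trivialFibrations_iff_und, MarkedCat.trivialFibrations_iff_generatingCofibrations]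
    constructor
    · rintro h _ _ _ ⟨i⟩
      exact (adj.hasLiftingProperty_iff _ _).2 (h i.down)
    · intro h i
      exact (adj.hasLiftingProperty_iff _ _).1 (h _ (MorphismProperty.ofHoms.mk (ULift.up i)))
  · rw [fibrations_eq]
    ext X Y p
    refine Iff.trans (MarkedCat.markedIsofibrations_iff_isoEndpoint (HasMarked.und.map p)) ?_
    constructor
    · rintro h _ _ _ ⟨i⟩
      exact (adj.hasLiftingProperty_iff _ _).2 h
    · intro h
      exact (adj.hasLiftingProperty_iff _ _).1 (h _ (MorphismProperty.ofHoms.mk PUnit.unit))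

end

end MarkedModel

namespace MarkedModel

/-! ### Universal marked pre-additive categories -/

lemma functor_eq_of_free {A B : Type u} [Category.{u} A] [Category.{u} B] [Preadditive B]
    {F G : Free ℤ A ⥤ B} [F.Additive] [G.Additive]
    (h : Free.embedding ℤ A ⋙ F = Free.embedding ℤ A ⋙ G) : F = G := by
  have ho (x : A) : F.obj x = G.obj x := Functor.congr_obj h x
  refine CategoryTheory.Functor.ext ho fun X Y f => ?_
  let φ : (X ⟶ Y) →+ (F.obj X ⟶ F.obj Y) := F.mapAddHom
  let ψ : (X ⟶ Y) →+ (F.obj X ⟶ F.obj Y) := AddMonoidHom.mk'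
    (fun f => eqToHom (ho X) ≫ G.map f ≫ eqToHom (ho Y).symm) (by simp)
  have e : φ = ψ := Finsupp.addHom_ext' fun g => AddMonoidHom.ext_int (Functor.congr_hom h g)
  exact DFunLike.congr_fun e f

namespace UniversalPreAdd

/-- The functor underlying a morphism to a marked pre-additive category. -/
def toPreAdd {K : MarkedCat.{u}} {B : MarkedPreAddCat.{u}} (Φ : K ⟶ HasMarked.und.obj B) :
    K.carrier ⥤ B.carrier := Φ.toFunctor

variable (K : MarkedCat.{u}) (P : ∀ B : MarkedPreAddCat.{u}, (K ⟶ HasMarked.und.obj B) → Prop)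

/-- The relation of having the same image under all morphisms in a given class. -/
def rel : HomRel (Free ℤ K.carrier) := fun _ _ f g =>
  -- The quantifier runs over a large class, but only a proposition is formed, so the quotient
  -- category stays small.
  ∀ (B : MarkedPreAddCat.{u}) (Φ : K ⟶ HasMarked.und.obj B), P B Φ →
    (Free.lift ℤ (toPreAdd Φ)).map f = (Free.lift ℤ (toPreAdd Φ)).map g

instance : Congruence (rel K P) where
  equivalence := ⟨fun _ _ _ _ => rfl, fun h B Φ hΦ => (h B Φ hΦ).symm,
    fun h h' B Φ hΦ => (h B Φ hΦ).trans (h' B Φ hΦ)⟩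
  comp_left f _ _ h B Φ hΦ := by
    rw [Functor.map_comp, Functor.map_comp, h B Φ hΦ]
  comp_right f h B Φ hΦ := by
    rw [Functor.map_comp, Functor.map_comp, h B Φ hΦ]

lemma rel_add ⦃X Y : Free ℤ K.carrier⦄ (f₁ f₂ g₁ g₂ : X ⟶ Y) (hf : rel K P f₁ f₂)
    (hg : rel K P g₁ g₂) : rel K P (f₁ + g₁) (f₂ + g₂) := fun B Φ hΦ => by
  rw [Functor.map_add, Functor.map_add, hf B Φ hΦ, hg B Φ hΦ]

/-- The category underlying the universal marked pre-additive category. -/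
abbrev Carrier : Type u := CategoryTheory.Quotient (rel K P)

noncomputable instance : Preadditive (Carrier K P) := Quotient.preadditive _ (rel_add K P)

instance : (Quotient.functor (rel K P)).Additive := Quotient.functor_additive _ (rel_add K P)

/-- The functor to the universal pre-additive category. -/
noncomputable def unitFunctor : K.carrier ⥤ Carrier K P :=
  Free.embedding ℤ K.carrier ⋙ Quotient.functor (rel K P)

/-- The images of the marked morphisms. -/
abbrev markedArrows : MorphismProperty (Carrier K P) :=
  .ofHoms (fun v : { α : Arrow K.carrier // K.marking.marked α.hom } =>
    (unitFunctor K P).map v.1.hom)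

lemma markedArrows_le : markedArrows K P ≤ MorphismProperty.isomorphisms _ := by
  rw [MorphismProperty.ofHoms_le_iff]
  intro v
  have := K.marking.isIso_of_marked _ v.2
  exact inferInstanceAs (IsIso ((unitFunctor K P).map v.1.hom))

/-- The universal marked pre-additive category with a morphism from `K` such that all the
morphisms satisfying `P` factor through it. -/
noncomputable def univ : MarkedPreAddCat.{u} where
  carrier := Carrier K P
  marking := Marking.generate (markedArrows K P) (markedArrows_le K P)

/-- The universal morphism. -/
noncomputable def unit : K ⟶ HasMarked.und.obj (univ K P) :=
  ⟨unitFunctor K P, fun {_ _} f hf => Marking.marked_of_mem (markedArrows_le K P) _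
    (MorphismProperty.ofHoms.mk
      (⟨Arrow.mk f, hf⟩ : { α : Arrow K.carrier // K.marking.marked α.hom }))⟩

section

variable {K P} {B : MarkedPreAddCat.{u}} (Φ : K ⟶ HasMarked.und.obj B) (hΦ : P B Φ)

/-- The functor induced by the universal property. -/
noncomputable def descFunctor : Carrier K P ⥤ B.carrier :=
  CategoryTheory.Quotient.lift _ (Free.lift ℤ (toPreAdd Φ)) fun _ _ _ _ h => h B Φ hΦ

lemma unitFunctor_comp_descFunctor : unitFunctor K P ⋙ descFunctor Φ hΦ = toPreAdd Φ :=
  functor_eq_of_arrow_mk fun v => congrArg Arrow.mk ((Free.lift_map_single ℤ (toPreAdd Φ) v 1).trans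
    (one_smul _ _))

/-- The morphism induced by the universal property. -/
noncomputable def desc : univ K P ⟶ B where
  toFunctor := descFunctor Φ hΦ
  additive := ⟨by
    rintro ⟨_⟩ ⟨_⟩ ⟨f⟩ ⟨g⟩
    exact (Free.lift ℤ (toPreAdd Φ)).map_add (f := f) (g := g)⟩
  map_marked f hf := by
    refine Marking.marked_map_of_generate (markedArrows_le K P) _ B.marking ?_ f hf
    rintro _ _ _ ⟨α, hα⟩
    exact marked_map_of_eq (unitFunctor_comp_descFunctor Φ hΦ) α.hom (Φ.map_marked _ hα)

lemma unit_desc : unit K P ≫ HasMarked.und.map (desc Φ hΦ) = Φ :=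
  MarkedCat.Hom.ext (unitFunctor_comp_descFunctor Φ hΦ)

end

variable {K P}

lemma hom_ext {B : MarkedPreAddCat.{u}} {f g : univ K P ⟶ B}
    (h : unit K P ≫ HasMarked.und.map f = unit K P ≫ HasMarked.und.map g) : f = g := by
  let f' : Carrier K P ⥤ B.carrier := f.toFunctor
  let g' : Carrier K P ⥤ B.carrier := g.toFunctor
  have : f'.Additive := f.additive
  have : g'.Additive := g.additive
  have e : f' = g' := Quotient.lift_unique' _ _ _ (functor_eq_of_free
    (F := Quotient.functor (rel K P) ⋙ f') (G := Quotient.functor (rel K P) ⋙ g')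
    (congrArg MarkedCat.Hom.toFunctor h))
  exact MarkedPreAddCat.Hom.ext e

/-- An additive relation that holds under all admissible morphisms is imposed by the congruence.
This makes the coprojections of the colimit additive. -/
lemma unitFunctor_map_add {X Y : K.carrier} {v w z : X ⟶ Y}
    (h : ∀ (B : MarkedPreAddCat.{u}) (Φ : K ⟶ HasMarked.und.obj B), P B Φ →
      (toPreAdd Φ).map z = (toPreAdd Φ).map v + (toPreAdd Φ).map w) :
    (unitFunctor K P).map z = (unitFunctor K P).map v + (unitFunctor K P).map w := by
  refine CategoryTheory.Quotient.sound (rel K P) (f₁ := (Free.embedding ℤ K.carrier).map z)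
    (f₂ := (Free.embedding ℤ K.carrier).map v + (Free.embedding ℤ K.carrier).map w)
    fun B Φ hΦ => ?_
  have e (v : X ⟶ Y) : (Free.lift ℤ (toPreAdd Φ)).map
      ((Free.embedding ℤ K.carrier).map v) = (toPreAdd Φ).map v :=
    (Free.lift_map_single ℤ (toPreAdd Φ) v 1).trans (one_smul _ _)
  rw [Functor.map_add, e, e, e]
  exact h B Φ hΦ

end UniversalPreAdd

namespace MarkedPreAddCat

/-- With no condition on the admissible morphisms, the universal morphism is an initial object of
the category of structured arrows. -/
instance : (HasMarked.und (C := MarkedPreAddCat.{u})).IsRightAdjoint := by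
  have (K : MarkedCat.{u}) :
      HasInitial (StructuredArrow K (HasMarked.und (C := MarkedPreAddCat.{u}))) :=
    IsInitial.hasInitial (X := StructuredArrow.mk (UniversalPreAdd.unit K fun _ _ => True))
      (IsInitial.ofUniqueHom
        (fun Y => StructuredArrow.homMk (UniversalPreAdd.desc Y.hom trivial)
          (UniversalPreAdd.unit_desc _ _))
        fun Y m => StructuredArrow.hom_ext _ _ (UniversalPreAdd.hom_ext
          ((StructuredArrow.w m).trans (UniversalPreAdd.unit_desc Y.hom trivial).symm)))
  exact isRightAdjointOfStructuredArrowInitials _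

variable {J : Type u} [Category.{u} J] (F : J ⥤ MarkedPreAddCat.{u})

/-- The colimit of the underlying marked categories. -/
noncomputable abbrev colimitUnd : MarkedCat.{u} := colimit (F ⋙ HasMarked.und)

/-- The condition of being additive on each of the categories in a diagram. -/
abbrev IsAdditiveFamily (B : MarkedPreAddCat.{u}) (Φ : colimitUnd F ⟶ HasMarked.und.obj B) : Prop :=
  ∀ j, Functor.Additive (C := (F.obj j).carrier) (D := B.carrier)
    (colimit.ι (F ⋙ HasMarked.und) j ≫ Φ).toFunctor

/-- The colimit cocone of a diagram of marked pre-additive categories. -/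
noncomputable def colimitCocone : Cocone F where
  pt := UniversalPreAdd.univ (colimitUnd F) (IsAdditiveFamily F)
  ι :=
    { app := fun j =>
        { toFunctor := (colimit.ι (F ⋙ HasMarked.und) j ≫ UniversalPreAdd.unit _ _).toFunctor
          additive := ⟨UniversalPreAdd.unitFunctor_map_add fun _ _ hΦ =>
            (hΦ j).map_add⟩
          map_marked := (colimit.ι (F ⋙ HasMarked.und) j ≫ UniversalPreAdd.unit _ _).map_marked }
      naturality := fun _ _ φ => Hom.ext (congrArg MarkedCat.Hom.toFunctor
        (congrArg (· ≫ UniversalPreAdd.unit _ (IsAdditiveFamily F))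
          (colimit.w (F ⋙ HasMarked.und) φ))) }

lemma isAdditiveFamily_desc (s : Cocone F) :
    IsAdditiveFamily F s.pt (colimit.desc (F ⋙ HasMarked.und) (HasMarked.und.mapCocone s)) := by
  intro j
  rw [colimit.ι_desc]
  exact (s.ι.app j).additive

/-- The colimit cocone is a colimit cocone. -/
noncomputable def isColimitColimitCocone : IsColimit (colimitCocone F) where
  desc s := UniversalPreAdd.desc _ (isAdditiveFamily_desc F s)
  fac s j := Hom.ext (congrArg MarkedCat.Hom.toFunctor (show colimit.ι (F ⋙ HasMarked.und) j ≫
      UniversalPreAdd.unit _ _ ≫ HasMarked.und.map (UniversalPreAdd.desc _ (isAdditiveFamily_desc F s)) =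
        HasMarked.und.map (s.ι.app j) by
    rw [UniversalPreAdd.unit_desc]
    exact colimit.ι_desc (HasMarked.und.mapCocone s) j))
  uniq s m hm := UniversalPreAdd.hom_ext ((colimit.hom_ext fun j =>
    (congrArg HasMarked.und.map (hm j)).trans
      (colimit.ι_desc (HasMarked.und.mapCocone s) j).symm).trans
      (UniversalPreAdd.unit_desc _ _).symm)

instance : HasColimitsOfSize.{u, u} MarkedPreAddCat.{u} where
  has_colimits_of_shape _ _ := ⟨fun F => ⟨⟨⟨_, isColimitColimitCocone F⟩⟩⟩⟩

end MarkedPreAddCat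

end MarkedModel

namespace MarkedModel

/-! ### Limits of marked pre-additive categories -/

section

variable {A : Type u} [Category.{u} A] [Preadditive A] {X Y X' Y' : A}

lemma arrow_mk_add_congr {f g : X ⟶ Y} {f' g' : X' ⟶ Y'} (hf : Arrow.mk f = Arrow.mk f')
    (hg : Arrow.mk g = Arrow.mk g') : Arrow.mk (f + g) = Arrow.mk (f' + g') := by
  obtain rfl : X = X' := congrArg (·.left) hf
  obtain rfl : Y = Y' := congrArg (·.right) hf
  rw [Arrow.mk_injective _ _ hf, Arrow.mk_injective _ _ hg]

lemma arrow_mk_neg_congr {f : X ⟶ Y} {f' : X' ⟶ Y'} (hf : Arrow.mk f = Arrow.mk f') :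
    Arrow.mk (-f) = Arrow.mk (-f') := by
  obtain rfl : X = X' := congrArg (·.left) hf
  obtain rfl : Y = Y' := congrArg (·.right) hf
  rw [Arrow.mk_injective _ _ hf]

lemma arrow_mk_zero_congr (hX : X = X') (hY : Y = Y') :
    Arrow.mk (0 : X ⟶ Y) = Arrow.mk (0 : X' ⟶ Y') := by
  subst hX hY
  rfl

end

namespace MarkedPreAddCat

variable {J : Type u} [Category.{u} J] (F : J ⥤ MarkedPreAddCat.{u})

/-- The objects of the limit: compatible families of objects. -/
structure LimitObj : Type u where
  /-- the family of objects -/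
  obj : ∀ j, (F.obj j).carrier
  map_obj : ∀ {j k : J} (φ : j ⟶ k), (F.map φ).toFunctor.obj (obj j) = obj k

namespace LimitObj

variable {F}

/-- The morphisms of the limit: compatible families of morphisms. -/
def homs (X Y : LimitObj F) : AddSubgroup (∀ j, X.obj j ⟶ Y.obj j) where
  carrier := { f | ∀ {j k : J} (φ : j ⟶ k),
    Arrow.mk ((F.map φ).toFunctor.map (f j)) = Arrow.mk (f k) }
  zero_mem' := by
    intro j k φ
    have := (F.map φ).additive
    rw [Pi.zero_apply, Pi.zero_apply, Functor.map_zero]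
    exact arrow_mk_zero_congr (X.map_obj φ) (Y.map_obj φ)
  add_mem' := by
    intro f g hf hg j k φ
    have := (F.map φ).additive
    rw [Pi.add_apply, Pi.add_apply, Functor.map_add]
    exact arrow_mk_add_congr (hf φ) (hg φ)
  neg_mem' := by
    intro f hf j k φ
    have := (F.map φ).additive
    rw [Pi.neg_apply, Pi.neg_apply, Functor.map_neg]
    exact arrow_mk_neg_congr (hf φ)

instance : Category.{u} (LimitObj F) where
  Hom X Y := homs X Y
  id X := ⟨fun _ => 𝟙 _, fun φ => by
    rw [CategoryTheory.Functor.map_id]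
    exact arrow_mk_id_congr (X.map_obj φ)⟩
  comp f g := ⟨fun j => f.1 j ≫ g.1 j, fun φ => by
    rw [Functor.map_comp]
    exact arrow_mk_comp_congr (f.2 φ) (g.2 φ)⟩
  id_comp f := Subtype.ext (funext fun j => Category.id_comp (f.1 j))
  comp_id f := Subtype.ext (funext fun j => Category.comp_id (f.1 j))
  assoc f g h := Subtype.ext (funext fun j => Category.assoc (f.1 j) (g.1 j) (h.1 j))

instance : Preadditive (LimitObj F) where
  homGroup X Y := inferInstanceAs (AddCommGroup (homs X Y))
  add_comp _ _ _ f g h := Subtype.ext (funext fun j =>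
    Preadditive.add_comp _ _ _ (f.1 j) (g.1 j) (h.1 j))
  comp_add _ _ _ f g h := Subtype.ext (funext fun j =>
    Preadditive.comp_add _ _ _ (f.1 j) (g.1 j) (h.1 j))

variable (F) in
/-- The projections from the limit. -/
def proj (j : J) : LimitObj F ⥤ (F.obj j).carrier where
  obj X := X.obj j
  map f := f.1 j

lemma arrow_ext {a b : Arrow (LimitObj F)}
    (h : ∀ j, (proj F j).mapArrow.obj a = (proj F j).mapArrow.obj b) : a = b := by
  obtain ⟨⟨X, hX⟩, ⟨Y, hY⟩, f⟩ := a
  obtain ⟨⟨X', hX'⟩, ⟨Y', hY'⟩, f'⟩ := b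
  obtain rfl : X = X' := funext fun j => congrArg (·.left) (h j)
  obtain rfl : Y = Y' := funext fun j => congrArg (·.right) (h j)
  obtain rfl : f = f' := Subtype.ext (funext fun j => Arrow.mk_injective _ _ (h j))
  rfl

end LimitObj

/-- The limit cone of a diagram of marked pre-additive categories. -/
def limitCone : Cone F where
  pt :=
    { carrier := LimitObj F
      marking := Marking.preimage (fun j => (F.obj j).marking) (LimitObj.proj F) }
  π :=
    { app := fun j => ⟨LimitObj.proj F j, ⟨rfl⟩, fun _ hf => hf.2 j⟩
      naturality := fun _ _ φ => Hom.ext (functor_eq_of_arrow_mk fun v => (v.2 φ).symm) }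

/-- The functor to the limit induced by a cone. -/
def limitLift (s : Cone F) : s.pt.carrier ⥤ LimitObj F where
  obj x := ⟨fun j => (s.π.app j).toFunctor.obj x, fun φ =>
    congrArg (fun f : s.pt ⟶ _ => f.toFunctor.obj x) (s.w φ)⟩
  map v := ⟨fun j => (s.π.app j).toFunctor.map v, fun φ =>
    congrArg (fun f : s.pt ⟶ _ => Arrow.mk (f.toFunctor.map v)) (s.w φ)⟩
  map_id x := Subtype.ext (funext fun j => (s.π.app j).toFunctor.map_id x)
  map_comp v w := Subtype.ext (funext fun j => (s.π.app j).toFunctor.map_comp v w)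

/-- The limit cone is a limit cone. -/
def isLimitLimitCone : IsLimit (limitCone F) where
  lift s :=
    { toFunctor := limitLift F s
      additive := ⟨Subtype.ext (funext fun j => (s.π.app j).additive.map_add)⟩
      map_marked := fun f hf =>
        ⟨(have := s.pt.marking.isIso_of_marked f hf
          inferInstanceAs (IsIso ((limitLift F s).map f))), fun j => (s.π.app j).map_marked f hf⟩ }
  fac _ _ := rfl
  uniq s _ hm := Hom.ext (functor_eq_of_arrow_mk fun v => LimitObj.arrow_ext fun j =>
    congrArg (fun f : s.pt ⟶ _ => Arrow.mk (f.toFunctor.map v)) (hm j))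

instance : HasLimitsOfSize.{u, u} MarkedPreAddCat.{u} where
  has_limits_of_shape _ _ := ⟨fun F => ⟨⟨⟨_, isLimitLimitCone F⟩⟩⟩⟩

end MarkedPreAddCat

end MarkedModel

namespace MarkedModel

/-! ### Filtered colimits of pre-additive categories -/

namespace FilteredColimit

variable {J : Type u} [Category.{u} J] {F : J ⥤ MarkedCat.{u}}

lemma push_comp {j k l : J} (φ : j ⟶ k) (ψ : k ⟶ l) (α : Arrow (F.obj j).carrier) :
    push (φ ≫ ψ) α = push ψ (push φ α) :=
  congrArg (fun q => q.toFunctor.mapArrow.obj α) (F.map_comp φ ψ)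

lemma map_comp_obj {j k l : J} (φ : j ⟶ k) (ψ : k ⟶ l) (x : (F.obj j).carrier) :
    (F.map (φ ≫ ψ)).toFunctor.obj x = (F.map ψ).toFunctor.obj ((F.map φ).toFunctor.obj x) :=
  congrArg (fun q => q.toFunctor.obj x) (F.map_comp φ ψ)

variable [IsFiltered J]

lemma exists_of_mkOb_eq_of_mkOb_eq {j k : J} {x y : (F.obj j).carrier} {x' y' : (F.obj k).carrier}
    (hx : mkOb x = mkOb x') (hy : mkOb y = mkOb y') : ∃ (l : J) (φ : j ⟶ l) (ψ : k ⟶ l),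
      (F.map φ).toFunctor.obj x = (F.map ψ).toFunctor.obj x' ∧
      (F.map φ).toFunctor.obj y = (F.map ψ).toFunctor.obj y' := by
  obtain ⟨l, φ, ψ, h⟩ := exists_of_mkOb_eq hx
  obtain ⟨l', φ', ψ', h'⟩ := exists_of_mkOb_eq hy
  obtain ⟨s, a, b, h₁, h₂⟩ := IsFiltered.bowtie φ φ' ψ ψ'
  refine ⟨s, φ ≫ a, ψ ≫ a, ?_, ?_⟩
  · rw [map_comp_obj, map_comp_obj, h]
  · rw [h₁, h₂, map_comp_obj, map_comp_obj, h']

lemma incl_map_map {j k : J} (φ : j ⟶ k) {x y : (F.obj j).carrier} (v : x ⟶ y) :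
    Arrow.mk ((incl F k).map ((F.map φ).toFunctor.map v)) = Arrow.mk ((incl F j).map v) :=
  incl_push φ (Arrow.mk v)

/-- Finitely many parallel morphisms have parallel representatives at one stage, so the axioms of a
pre-additive category are inherited from the stages. -/
lemma exists_rep (n : ℕ) {X Y : Obj F} (f : Fin n → (X ⟶ Y)) :
    ∃ (j : J) (x y : (F.obj j).carrier) (v : Fin n → (x ⟶ y)), (incl F j).obj x = X ∧
      (incl F j).obj y = Y ∧ ∀ i, Arrow.mk (f i) = Arrow.mk ((incl F j).map (v i)) := by
  induction n with
  | zero =>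
    obtain ⟨j, x, rfl⟩ := exists_mkOb X
    obtain ⟨k, y, rfl⟩ := exists_mkOb Y
    exact ⟨IsFiltered.max j k, (F.map (IsFiltered.leftToMax j k)).toFunctor.obj x,
      (F.map (IsFiltered.rightToMax j k)).toFunctor.obj y, Fin.elim0, mkOb_map _ _, mkOb_map _ _,
      fun i => i.elim0⟩
  | succ n ih =>
    obtain ⟨j, x, y, v, rfl, rfl, h⟩ := ih fun i => f i.succ
    obtain ⟨k, α, hα⟩ := exists_incl_map_eq (f 0)
    obtain ⟨l, φ, ψ, hx, hy⟩ := exists_of_mkOb_eq_of_mkOb_eq (x := x) (y := y)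
      (congrArg (·.left) hα) (congrArg (·.right) hα)
    refine ⟨l, _, _, Fin.cons (eqToHom hx ≫ (push ψ α).hom ≫ eqToHom hy.symm)
      fun i => (F.map φ).toFunctor.map (v i), mkOb_map _ _, mkOb_map _ _, Fin.cases ?_ fun i => ?_⟩
    · rw [Fin.cons_zero]
      refine (hα.trans (incl_push ψ α).symm).trans ?_
      exact congrArg (incl F l).mapArrow.obj (arrow_mk_conj hx (push ψ α).hom hy.symm).symm
    · rw [Fin.cons_succ]
      exact (h i).trans (incl_map_map φ (v i)).symm

lemma hom_family_ind {n : ℕ} {motive : ∀ {X Y : Obj F}, (Fin n → (X ⟶ Y)) → Prop}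
    (h : ∀ (j : J) {x y : (F.obj j).carrier} (v : Fin n → (x ⟶ y)),
      motive fun i => (incl F j).map (v i)) {X Y : Obj F} (f : Fin n → (X ⟶ Y)) : motive f := by
  obtain ⟨j, x, y, v, rfl, rfl, e⟩ := exists_rep n f
  obtain rfl : f = fun i => (incl F j).map (v i) := funext fun i => Arrow.mk_injective _ _ (e i)
  exact h j v

lemma comp_family_ind {n m : ℕ}
    {motive : ∀ {X Y Z : Obj F}, (Fin n → (X ⟶ Y)) → (Fin m → (Y ⟶ Z)) → Prop}
    (h : ∀ (j : J) {x y z : (F.obj j).carrier} (v : Fin n → (x ⟶ y)) (w : Fin m → (y ⟶ z)),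
      motive (fun i => (incl F j).map (v i)) (fun i => (incl F j).map (w i)))
    {X Y Z : Obj F} (f : Fin n → (X ⟶ Y)) (g : Fin m → (Y ⟶ Z)) : motive f g := by
  obtain ⟨j, x, y, v, rfl, hy, hv⟩ := exists_rep n f
  obtain ⟨k, y', z, w, rfl, rfl, hw⟩ := exists_rep m g
  obtain ⟨l, φ, ψ, e⟩ := exists_of_mkOb_eq hy
  let v' (i : Fin n) := (F.map φ).toFunctor.map (v i)
  let w' (i : Fin m) := eqToHom e ≫ (F.map ψ).toFunctor.map (w i)
  have hv' (i : Fin n) : Arrow.mk (f i) = Arrow.mk ((incl F l).map (v' i)) :=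
    (hv i).trans (incl_map_map φ (v i)).symm
  have hw' (i : Fin m) : Arrow.mk (g i) = Arrow.mk ((incl F l).map (w' i)) := by
    refine ((hw i).trans (incl_map_map ψ (w i)).symm).trans ?_
    exact congrArg (incl F l).mapArrow.obj (Arrow.arrow_mk_eqToHom_comp _ e).symm
  have key {X Y Z X' Y' Z' : Obj F} (hX : X = X') (hY : Y = Y') (hZ : Z = Z')
      (f : Fin n → (X ⟶ Y)) (g : Fin m → (Y ⟶ Z)) (f' : Fin n → (X' ⟶ Y'))
      (g' : Fin m → (Y' ⟶ Z')) (hf : ∀ i, Arrow.mk (f i) = Arrow.mk (f' i))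
      (hg : ∀ i, Arrow.mk (g i) = Arrow.mk (g' i)) (h : motive f' g') : motive f g := by
    subst hX hY hZ
    obtain rfl : f = f' := funext fun i => Arrow.mk_injective _ _ (hf i)
    obtain rfl : g = g' := funext fun i => Arrow.mk_injective _ _ (hg i)
    exact h
  exact key (mkOb_map φ x).symm (mkOb_map ψ y' |>.symm.trans (congrArg mkOb e.symm))
    (mkOb_map ψ z).symm f g _ _ hv' hw' (h l v' w')

variable [∀ j, Preadditive (F.obj j).carrier]

lemma incl_map_zero_congr {j k : J} {x y : (F.obj j).carrier} {x' y' : (F.obj k).carrier}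
    (hadd : ∀ {j k : J} (φ : j ⟶ k), (F.map φ).toFunctor.Additive)
    (hx : mkOb x = mkOb x') (hy : mkOb y = mkOb y') :
    Arrow.mk ((incl F j).map (0 : x ⟶ y)) = Arrow.mk ((incl F k).map (0 : x' ⟶ y')) := by
  obtain ⟨l, φ, ψ, hx, hy⟩ := exists_of_mkOb_eq_of_mkOb_eq hx hy
  have := hadd φ
  have := hadd ψ
  rw [← incl_map_map φ, ← incl_map_map ψ, (F.map φ).toFunctor.map_zero,
    (F.map ψ).toFunctor.map_zero]
  exact congrArg (incl F l).mapArrow.obj (arrow_mk_zero_congr hx hy)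

lemma incl_map_add_congr {j k : J} {x y : (F.obj j).carrier} {x' y' : (F.obj k).carrier}
    (hadd : ∀ {j k : J} (φ : j ⟶ k), (F.map φ).toFunctor.Additive)
    {v w : x ⟶ y} {v' w' : x' ⟶ y'}
    (hv : Arrow.mk ((incl F j).map v) = Arrow.mk ((incl F k).map v'))
    (hw : Arrow.mk ((incl F j).map w) = Arrow.mk ((incl F k).map w')) :
    Arrow.mk ((incl F j).map (v + w)) = Arrow.mk ((incl F k).map (v' + w')) := by
  obtain ⟨l, φ, ψ, h⟩ := exists_of_incl_mapArrow_eq (α := Arrow.mk v) (β := Arrow.mk v') hv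
  obtain ⟨l', φ', ψ', h'⟩ := exists_of_incl_mapArrow_eq (α := Arrow.mk w) (β := Arrow.mk w') hw
  obtain ⟨s, a, b, h₁, h₂⟩ := IsFiltered.bowtie φ φ' ψ ψ'
  have := hadd (φ ≫ a)
  have := hadd (ψ ≫ a)
  rw [← incl_map_map (φ ≫ a), ← incl_map_map (ψ ≫ a), (F.map _).toFunctor.map_add,
    (F.map _).toFunctor.map_add]
  refine congrArg (incl F s).mapArrow.obj (arrow_mk_add_congr
    (show push (φ ≫ a) (Arrow.mk v) = push (ψ ≫ a) (Arrow.mk v') from ?_)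
    (show push (φ ≫ a) (Arrow.mk w) = push (ψ ≫ a) (Arrow.mk w') from ?_))
  · rw [push_comp, push_comp, h]
  · rw [h₁, h₂, push_comp, push_comp, h']

variable [hadd : ∀ {j k : J} (φ : j ⟶ k), (F.map φ).toFunctor.Additive]

/-- Zero morphisms, and sums below, are specified on all representatives at once; a choice is then
automatically compatible with every `incl F j`. -/
lemma exists_zero (X Y : Obj F) : ∃ f : X ⟶ Y, ∀ (j : J) (x y : (F.obj j).carrier),
    mkOb x = X → mkOb y = Y → Arrow.mk f = Arrow.mk ((incl F j).map (0 : x ⟶ y)) := by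
  obtain ⟨j, x, y, -, rfl, rfl, -⟩ := exists_rep 0 (X := X) (Y := Y) Fin.elim0
  exact ⟨(incl F j).map 0, fun k x' y' hx hy => incl_map_zero_congr hadd hx.symm hy.symm⟩

lemma exists_add {X Y : Obj F} (f g : X ⟶ Y) : ∃ h : X ⟶ Y,
    ∀ (j : J) {x y : (F.obj j).carrier} (v w : x ⟶ y), Arrow.mk f = Arrow.mk ((incl F j).map v) →
      Arrow.mk g = Arrow.mk ((incl F j).map w) →
        Arrow.mk h = Arrow.mk ((incl F j).map (v + w)) :=
  hom_family_ind (motive := fun {X Y} (f : Fin 2 → (X ⟶ Y)) => ∃ h : X ⟶ Y,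
      ∀ (j : J) {x y : (F.obj j).carrier} (v w : x ⟶ y),
      Arrow.mk (f 0) = Arrow.mk ((incl F j).map v) →
      Arrow.mk (f 1) = Arrow.mk ((incl F j).map w) →
        Arrow.mk h = Arrow.mk ((incl F j).map (v + w)))
    (fun j _ _ v => ⟨(incl F j).map (v 0 + v 1), fun _ _ _ _ _ hv hw =>
      incl_map_add_congr hadd hv hw⟩) ![f, g]

/-- The addition of morphisms of the colimit. -/
noncomputable instance (X Y : Obj F) : Add (X ⟶ Y) where
  add f g := (exists_add f g).choose

/-- The zero morphism of the colimit. -/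
noncomputable instance (X Y : Obj F) : Zero (X ⟶ Y) where
  zero := (exists_zero X Y).choose

lemma incl_map_zero (j : J) (x y : (F.obj j).carrier) :
    (incl F j).map (0 : x ⟶ y) = (0 : (incl F j).obj x ⟶ (incl F j).obj y) :=
  (Arrow.mk_injective _ _ ((exists_zero _ _).choose_spec j x y rfl rfl)).symm

lemma incl_map_add (j : J) {x y : (F.obj j).carrier} (v w : x ⟶ y) :
    (incl F j).map (v + w) = (incl F j).map v + (incl F j).map w :=
  (Arrow.mk_injective _ _ ((exists_add _ _).choose_spec j v w rfl rfl)).symm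

lemma exists_neg {X Y : Obj F} (f : X ⟶ Y) : ∃ g : X ⟶ Y, g + f = 0 :=
  hom_family_ind (motive := fun {X Y} (f : Fin 1 → (X ⟶ Y)) => ∃ g : X ⟶ Y, g + f 0 = 0)
    (fun j _ _ v => ⟨(incl F j).map (-v 0), by
      rw [← incl_map_add, neg_add_cancel, incl_map_zero]⟩) ![f]

/-- The negation of morphisms of the colimit. -/
noncomputable instance (X Y : Obj F) : Neg (X ⟶ Y) where
  neg f := (exists_neg f).choose

noncomputable instance (X Y : Obj F) : AddCommGroup (X ⟶ Y) where
  add_assoc f g h := hom_family_ind (motive := fun {X Y} (f : Fin 3 → (X ⟶ Y)) => f 0 + f 1 + f 2 = f 0 + (f 1 + f 2))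
    (fun j _ _ v => by simp only [← incl_map_add, add_assoc]) ![f, g, h]
  zero_add f := hom_family_ind (motive := fun {X Y} (f : Fin 1 → (X ⟶ Y)) => 0 + f 0 = f 0)
    (fun j _ _ v => by rw [← incl_map_zero, ← incl_map_add, zero_add]) ![f]
  add_zero f := hom_family_ind (motive := fun {X Y} (f : Fin 1 → (X ⟶ Y)) => f 0 + 0 = f 0)
    (fun j _ _ v => by rw [← incl_map_zero, ← incl_map_add, add_zero]) ![f]
  add_comm f g := hom_family_ind (motive := fun {X Y} (f : Fin 2 → (X ⟶ Y)) => f 0 + f 1 = f 1 + f 0)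
    (fun j _ _ v => by simp only [← incl_map_add, add_comm]) ![f, g]
  neg_add_cancel f := (exists_neg f).choose_spec
  nsmul := nsmulRec
  zsmul := zsmulRec

noncomputable instance : Preadditive (Obj F) where
  homGroup _ _ := inferInstance
  add_comp _ _ _ f f' g := comp_family_ind
    (motive := fun {X Y Z} (f : Fin 2 → (X ⟶ Y)) (g : Fin 1 → (Y ⟶ Z)) =>
      (f 0 + f 1) ≫ g 0 = f 0 ≫ g 0 + f 1 ≫ g 0)
    (fun j _ _ _ v w => by
      simp only [← incl_map_add, ← Functor.map_comp, Preadditive.add_comp]) ![f, f'] ![g]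
  comp_add _ _ _ f g g' := comp_family_ind
    (motive := fun {X Y Z} (f : Fin 1 → (X ⟶ Y)) (g : Fin 2 → (Y ⟶ Z)) =>
      f 0 ≫ (g 0 + g 1) = f 0 ≫ g 0 + f 0 ≫ g 1)
    (fun j _ _ _ v w => by
      simp only [← incl_map_add, ← Functor.map_comp, Preadditive.comp_add]) ![f] ![g, g']

instance (j : J) : (incl F j).Additive where
  map_add := incl_map_add j _ _

lemma additive_of_incl_comp {D : Type u} [Category.{u} D] [Preadditive D] (G : Obj F ⥤ D)
    (h : ∀ j, (incl F j ⋙ G).Additive) : G.Additive where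
  map_add {X Y f g} := hom_family_ind (motive := fun {X Y} (f : Fin 2 → (X ⟶ Y)) => G.map (f 0 + f 1) =
      G.map (f 0) + G.map (f 1)) (fun j _ _ v => by
    rw [← incl_map_add]
    exact (h j).map_add) ![f, g]

end FilteredColimit

end MarkedModel

namespace MarkedModel

/-! ### Preservation of filtered colimits -/

namespace MarkedPreAddCat

variable {J : Type u} [Category.{u} J] (F : J ⥤ MarkedPreAddCat.{u})

instance (j : J) : Preadditive ((F ⋙ HasMarked.und).obj j).carrier := (F.obj j).preadditive

instance {j k : J} (φ : j ⟶ k) : ((F ⋙ HasMarked.und).map φ).toFunctor.Additive :=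
  (F.map φ).additive

variable [IsFiltered J]

/-- The colimit cocone of a filtered diagram of marked pre-additive categories. -/
noncomputable def filteredCocone : Cocone F where
  pt := { carrier := FilteredColimit.Obj (F ⋙ HasMarked.und), marking := FilteredColimit.marking }
  ι :=
    { app := fun j => ⟨FilteredColimit.incl (F ⋙ HasMarked.und) j,
        inferInstanceAs (FilteredColimit.incl (F ⋙ HasMarked.und) j).Additive,
        ((FilteredColimit.cocone (F ⋙ HasMarked.und)).ι.app j).map_marked⟩
      naturality := fun _ _ φ => Hom.ext
        (FilteredColimit.map_comp_incl (F := F ⋙ HasMarked.und) φ) }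

/-- The cocone `filteredCocone` is a colimit cocone. -/
noncomputable def isColimitFilteredCocone : IsColimit (filteredCocone F) where
  desc s := ⟨((FilteredColimit.isColimit _).desc (HasMarked.und.mapCocone s)).toFunctor,
    FilteredColimit.additive_of_incl_comp (D := s.pt.carrier) _ (fun j => by
      refine cast (congrArg (Functor.Additive (C := (F.obj j).carrier) (D := s.pt.carrier)) ?_)
        (s.ι.app j).additive
      exact congrArg MarkedCat.Hom.toFunctor
        ((FilteredColimit.isColimit _).fac (HasMarked.und.mapCocone s) j).symm),
    ((FilteredColimit.isColimit _).desc (HasMarked.und.mapCocone s)).map_marked⟩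
  fac s j := Hom.ext (congrArg MarkedCat.Hom.toFunctor
    ((FilteredColimit.isColimit _).fac (HasMarked.und.mapCocone s) j))
  uniq s m hm := Hom.ext (congrArg MarkedCat.Hom.toFunctor
    ((FilteredColimit.isColimit _).uniq (HasMarked.und.mapCocone s) (HasMarked.und.map m)
      fun j => congrArg HasMarked.und.map (hm j)))

instance : PreservesFilteredColimitsOfSize.{u, u} (HasMarked.und (C := MarkedPreAddCat.{u})) where
  preserves_filtered_colimits _ _ _ := ⟨fun {F} =>
    preservesColimit_of_preserves_colimit_cocone (isColimitFilteredCocone F)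
      (FilteredColimit.isColimit (F ⋙ HasMarked.und))⟩

end MarkedPreAddCat

/-! ### Isomorphisms and maximal markings in filtered colimits -/

lemma Marking.isIso_map {A B : Type u} [Category.{u} A] [Category.{u} B] (M : Marking A)
    (F : A ⥤ B) {X Y : A} (v : X ⟶ Y) (hv : M.marked v) : IsIso (F.map v) :=
  have := M.isIso_of_marked v hv
  inferInstance

lemma Marking.ext_of_marked_iff {A : Type u} [Category.{u} A] {M N : Marking A}
    (h : ∀ {X Y : A} (f : X ⟶ Y), M.marked f ↔ N.marked f) : M = N := by
  obtain ⟨m, _, _, _, _⟩ := M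
  obtain ⟨n, _, _, _, _⟩ := N
  obtain rfl : m = n := MorphismProperty.ext _ _ fun _ _ f => h f
  rfl

namespace FilteredColimit

variable {J : Type u} [Category.{u} J] {F : J ⥤ MarkedCat.{u}}

lemma map_comp_map_eq {j k l : J} (φ : j ⟶ k) (ψ : k ⟶ l) {x y : (F.obj j).carrier} {v w : x ⟶ y}
    (h : (F.map φ).toFunctor.map v = (F.map φ).toFunctor.map w) :
    (F.map (φ ≫ ψ)).toFunctor.map v = (F.map (φ ≫ ψ)).toFunctor.map w := by
  refine Arrow.mk_injective _ _ ?_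
  change push _ (Arrow.mk v) = push _ (Arrow.mk w)
  rw [push_comp, push_comp]
  exact congrArg (fun t => push ψ (Arrow.mk t)) h

variable [IsFiltered J]

lemma exists_map_eq {j : J} {x y : (F.obj j).carrier} {v w : x ⟶ y}
    (h : (incl F j).map v = (incl F j).map w) :
    ∃ (k : J) (φ : j ⟶ k), (F.map φ).toFunctor.map v = (F.map φ).toFunctor.map w := by
  obtain ⟨k, φ, ψ, e⟩ := exists_of_incl_mapArrow_eq (α := Arrow.mk v) (β := Arrow.mk w)
    (congrArg Arrow.mk h)
  refine ⟨_, φ ≫ IsFiltered.coeqHom φ ψ, Arrow.mk_injective _ _ ?_⟩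
  change push _ (Arrow.mk v) = push _ (Arrow.mk w)
  rw [push_comp, e, IsFiltered.coeq_condition, push_comp]

lemma exists_map_inv {j : J} {x y : (F.obj j).carrier} (v : x ⟶ y) [IsIso ((incl F j).map v)] :
    ∃ (k : J) (φ : j ⟶ k) (w : (F.map φ).toFunctor.obj y ⟶ (F.map φ).toFunctor.obj x),
      (incl F k).map ((F.map φ).toFunctor.map v ≫ w) = 𝟙 _ ∧
      (incl F k).map (w ≫ (F.map φ).toFunctor.map v) = 𝟙 _ := by
  obtain ⟨k, α, hα⟩ := exists_incl_map_eq (inv ((incl F j).map v))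
  obtain ⟨l, φ, ψ, hy, hx⟩ := exists_of_mkOb_eq_of_mkOb_eq (x := y) (y := x)
    (congrArg (·.left) hα) (congrArg (·.right) hα)
  have e : Arrow.mk ((incl F l).map (eqToHom hy ≫ (push ψ α).hom ≫ eqToHom hx.symm)) =
      Arrow.mk (inv ((incl F j).map v)) :=
    (congrArg (incl F l).mapArrow.obj (arrow_mk_conj hy (push ψ α).hom hx.symm)).trans
      ((incl_push ψ α).trans hα.symm)
  have e' := incl_map_map φ v
  refine ⟨l, φ, eqToHom hy ≫ (push ψ α).hom ≫ eqToHom hx.symm, Arrow.mk_injective _ _ ?_,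
    Arrow.mk_injective _ _ ?_⟩
  · rw [(incl F l).map_comp]
    refine (arrow_mk_comp_congr e' e).trans ?_
    rw [IsIso.hom_inv_id]
    exact arrow_mk_id_congr (mkOb_map φ x).symm
  · rw [(incl F l).map_comp]
    refine (arrow_mk_comp_congr e e').trans ?_
    rw [IsIso.inv_hom_id]
    exact arrow_mk_id_congr (mkOb_map φ y).symm

/-- The inverse comes from some stage, and the two identities it satisfies in the colimit already
hold at a later one. -/
lemma exists_isIso {j : J} {x y : (F.obj j).carrier} (v : x ⟶ y) [IsIso ((incl F j).map v)] :
    ∃ (k : J) (φ : j ⟶ k), IsIso ((F.map φ).toFunctor.map v) := by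
  obtain ⟨k, φ, w, h₁, h₂⟩ := exists_map_inv v
  obtain ⟨l, ψ, e₁⟩ := exists_map_eq (w := 𝟙 _) (h₁.trans ((incl F k).map_id _).symm)
  obtain ⟨l', ψ', e₂⟩ := exists_map_eq (w := 𝟙 _) (h₂.trans ((incl F k).map_id _).symm)
  obtain ⟨s, a, b, h⟩ := IsFiltered.span ψ ψ'
  replace e₁ := map_comp_map_eq ψ a e₁
  replace e₂ := map_comp_map_eq ψ' b e₂
  rw [← h] at e₂
  rw [(F.map (ψ ≫ a)).toFunctor.map_comp, (F.map (ψ ≫ a)).toFunctor.map_id] at e₁ e₂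
  refine ⟨s, φ ≫ ψ ≫ a, ((MorphismProperty.isomorphisms _).arrow_mk_iso_iff
    (eqToIso (push_comp φ (ψ ≫ a) (Arrow.mk v)))).2 ⟨_, e₁, e₂⟩⟩

/-- A filtered colimit of categories in which all isomorphisms are marked has the same
property. -/
lemma marking_eq_max (hF : ∀ j, (F.obj j).marking = Marking.max _) :
    marking (F := F) = Marking.max _ := by
  refine Marking.ext_of_marked_iff fun {X Y} f => ⟨marking.isIso_of_marked f, fun hf => ?_⟩
  obtain ⟨j, α, e⟩ := exists_incl_map_eq f
  obtain rfl : X = (incl F j).obj α.left := congrArg (fun a => a.left) e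
  obtain rfl : Y = (incl F j).obj α.right := congrArg (fun a => a.right) e
  obtain rfl := Arrow.mk_injective _ _ e
  have : IsIso ((incl F j).map α.hom) := hf
  obtain ⟨k, φ, h⟩ := exists_isIso α.hom
  refine ⟨k, push φ α, ?_, (incl_push φ α).symm⟩
  rw [hF]
  exact h

end FilteredColimit

/-! ### Reflection of maximally marked categories -/

instance : (HasMarked.und (C := MarkedCat.{u})).IsRightAdjoint :=
  inferInstanceAs (𝟭 MarkedCat.{u}).IsRightAdjoint

instance : PreservesFilteredColimitsOfSize.{u, u} (HasMarked.und (C := MarkedCat.{u})) :=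
  inferInstanceAs (PreservesFilteredColimitsOfSize.{u, u} (𝟭 MarkedCat.{u}))

namespace CatReflection

/-- Forgetting the marking is left adjoint to marking all isomorphisms. -/
def adj : MarkedCat.forget.{u} ⊣ HasMarked.und (C := Cat.{u, u}) :=
  Adjunction.mkOfHomEquiv
    { homEquiv := fun A B =>
        { toFun := fun f => ⟨f.toFunctor, fun v hv =>
            A.marking.isIso_map f.toFunctor v hv⟩
          invFun := fun f => f.toFunctor.toCatHom
          left_inv := fun _ => rfl
          right_inv := fun _ => rfl } }

instance : Reflective (HasMarked.und (C := Cat.{u, u})) where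
  map_surjective f := ⟨f.toFunctor.toCatHom, rfl⟩
  map_injective h := Cat.Hom.ext (congrArg MarkedCat.Hom.toFunctor h)
  L := MarkedCat.forget
  adj := adj

/-- The filtered colimit of maximally marked categories is maximally marked, so it lies in the
essential image of the fully faithful `HasMarked.und`, which therefore creates it. -/
instance : PreservesFilteredColimitsOfSize.{u, u} (HasMarked.und (C := Cat.{u, u})) where
  preserves_filtered_colimits J _ _ := ⟨fun {F} => by
    have e : FilteredColimit.marking (F := F ⋙ HasMarked.und) = Marking.max _ :=
      FilteredColimit.marking_eq_max fun _ => rfl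
    have i : HasMarked.und.obj (Cat.of (FilteredColimit.Obj (F ⋙ HasMarked.und))) ≅
        (FilteredColimit.cocone (F ⋙ HasMarked.und)).pt :=
      eqToIso (congrArg (MarkedCat.mk (FilteredColimit.Obj (F ⋙ HasMarked.und))) e.symm)
    have := createsColimitOfFullyFaithfulOfIso'
      (FilteredColimit.isColimit (F ⋙ HasMarked.und)) _ i
    infer_instance⟩

end CatReflection

namespace PreAddCat

/-- Marking all isomorphisms. -/
def max : PreAddCat.{u} ⥤ MarkedPreAddCat.{u} where
  obj A := { carrier := A.carrier, marking := Marking.max A.carrier }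
  map f := ⟨f.toFunctor, f.additive, (HasMarked.und.map f).map_marked⟩

/-- Forgetting the marking. -/
def forgetMarking : MarkedPreAddCat.{u} ⥤ PreAddCat.{u} where
  obj A := { carrier := A.carrier }
  map f := ⟨f.toFunctor, f.additive⟩

/-- Forgetting the marking is left adjoint to marking all isomorphisms. -/
def adj : forgetMarking.{u} ⊣ max.{u} :=
  Adjunction.mkOfHomEquiv
    { homEquiv := fun A B =>
        { toFun := fun f => ⟨f.toFunctor, f.additive, fun v hv =>
            A.marking.isIso_map f.toFunctor v hv⟩
          invFun := fun f => ⟨f.toFunctor, f.additive⟩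
          left_inv := fun _ => rfl
          right_inv := fun _ => rfl } }

instance : Reflective max.{u} where
  map_surjective f := ⟨⟨f.toFunctor, f.additive⟩, rfl⟩
  map_injective h := Hom.ext (congrArg MarkedPreAddCat.Hom.toFunctor h)
  L := forgetMarking
  adj := adj

instance : HasLimitsOfSize.{u, u} PreAddCat.{u} := hasLimits_of_reflective max

instance : HasColimitsOfSize.{u, u} PreAddCat.{u} := hasColimits_of_reflective max

instance : PreservesFilteredColimitsOfSize.{u, u} max.{u} where
  preserves_filtered_colimits J _ _ := ⟨fun {F} => by
    have e : FilteredColimit.marking (F := (F ⋙ max) ⋙ HasMarked.und) = Marking.max _ :=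
      FilteredColimit.marking_eq_max fun _ => rfl
    have i : max.obj { carrier := FilteredColimit.Obj ((F ⋙ max) ⋙ HasMarked.und) } ≅
        (MarkedPreAddCat.filteredCocone (F ⋙ max)).pt :=
      eqToIso (congrArg (MarkedPreAddCat.mk (FilteredColimit.Obj ((F ⋙ max) ⋙ HasMarked.und)))
        e.symm)
    have := createsColimitOfFullyFaithfulOfIso'
      (MarkedPreAddCat.isColimitFilteredCocone (F ⋙ max)) _ i
    infer_instance⟩

/-- The functor is the composite of `max` with the corresponding functor on marked pre-additive
categories, and both are right adjoints. -/
instance : (HasMarked.und (C := PreAddCat.{u})).IsRightAdjoint :=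
  inferInstanceAs (max ⋙ HasMarked.und (C := MarkedPreAddCat.{u})).IsRightAdjoint

instance : PreservesFilteredColimitsOfSize.{u, u} (HasMarked.und (C := PreAddCat.{u})) :=
  inferInstanceAs (PreservesFilteredColimitsOfSize.{u, u}
    (max ⋙ HasMarked.und (C := MarkedPreAddCat.{u})))

end PreAddCat

end MarkedModel

theorem mainTheorem1 :
    (MarkedModel.IsSimplicialModelCategory CategoryTheory.Cat.{u, u} ∧
      MarkedModel.IsCombinatorial CategoryTheory.Cat.{u, u} ∧
      HomotopicalAlgebra.fibrations CategoryTheory.Cat.{u, u} =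
        MarkedModel.markedIsofibrations CategoryTheory.Cat.{u, u} ∧
      MarkedModel.AllBifibrant CategoryTheory.Cat.{u, u}) ∧
    (MarkedModel.IsSimplicialModelCategory MarkedModel.MarkedCat.{u} ∧
      MarkedModel.IsCombinatorial MarkedModel.MarkedCat.{u} ∧
      HomotopicalAlgebra.fibrations MarkedModel.MarkedCat.{u} =
        MarkedModel.markedIsofibrations MarkedModel.MarkedCat.{u} ∧
      MarkedModel.AllBifibrant MarkedModel.MarkedCat.{u}) ∧
    (MarkedModel.IsSimplicialModelCategory MarkedModel.PreAddCat.{u} ∧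
      MarkedModel.IsCombinatorial MarkedModel.PreAddCat.{u} ∧
      HomotopicalAlgebra.fibrations MarkedModel.PreAddCat.{u} =
        MarkedModel.markedIsofibrations MarkedModel.PreAddCat.{u} ∧
      MarkedModel.AllBifibrant MarkedModel.PreAddCat.{u}) ∧
    (MarkedModel.IsSimplicialModelCategory MarkedModel.MarkedPreAddCat.{u} ∧
      MarkedModel.IsCombinatorial MarkedModel.MarkedPreAddCat.{u} ∧
      HomotopicalAlgebra.fibrations MarkedModel.MarkedPreAddCat.{u} =
        MarkedModel.markedIsofibrations MarkedModel.MarkedPreAddCat.{u} ∧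
      MarkedModel.AllBifibrant MarkedModel.MarkedPreAddCat.{u}) := by
  have key (C : Type (u + 1)) [Category.{u} C] [MarkedModel.HasMarked C]
      [MarkedModel.MarkedTheory C] [HasLimitsOfSize.{u, u} C] [HasColimitsOfSize.{u, u} C]
      [(MarkedModel.HasMarked.und (C := C)).IsRightAdjoint]
      [PreservesFilteredColimitsOfSize.{u, u} (MarkedModel.HasMarked.und (C := C))] :
      MarkedModel.IsSimplicialModelCategory C ∧ MarkedModel.IsCombinatorial C ∧
        fibrations C = MarkedModel.markedIsofibrations C ∧ MarkedModel.AllBifibrant C :=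
    ⟨MarkedModel.isSimplicialModelCategory C, MarkedModel.isCombinatorial C,
      MarkedModel.fibrations_eq, MarkedModel.allBifibrant C⟩
  exact ⟨key _, key _, key _, key _⟩
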